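/- All alphabets are finite. Let $(S,T)\sim p(s,t)$ be a pair of correlated discrete memoryless sources, so that $p(s^n,t^n)=\prod_{i=1}^n p(s_i,t_i)$, and let $p(y_1y_2|x_1x_2)$ be a discrete memoryless two-user interference channel. A block code of length $n$ consists of encoders $f_1:\mathcal S^n\to\mathcal X_1^n$, $f_2:\mathcal T^n\to\mathcal X_2^n$ and decoders $\phi_1:\mathcal Y_1^n\to\mathcal S^n$, $\phi_2:\mathcal Y_2^n\to\mathcal T^n$; its error probabilities are $P_{e1}=\Pr\{\phi_1(Y_1^n)\ne S^n\}$ and $P_{e2}=\Pr\{\phi_2(Y_2^n)\ne T^n\}$ when $f_1(S^n)$ and $f_2(T^n)$ are sent over the channel. The source pair is called admissible for the channel if for every $\epsilon\in(0,1)$ and all sufficiently large $n$ there is a block code of length $n$ with $\max\{P_{e1},P_{e2}\}\le\epsilon$. Let $K=f(S)=g(T)$ be the common part of $S$ and $T$ in the sense of Gács, Körner and Witsenhausen, that is, the finest random variable that is with probability one both a function of $S$ and a function of $T$. **Theorem.** The source pair $(S,T)\sim p(s,t)$ is admissible for the interference channel $p(y_1y_2|x_1x_2)$ if there exist auxiliary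 random variables $W_0,W_1,W_2$ and channel inputs $X_1,X_2$, with outputs $Y_1,Y_2$ of the channel, such that the joint distribution factors as $$p(s,t,w_0,w_1,w_2,x_1,x_2,y_1,y_2)=p(s,t)\,p(w_0)\,p(w_1|w_0)\,p(w_2|w_0)\,p(x_1|s\,w_1w_0)\,p(x_2|t\,w_2w_0)\,p(y_1y_2|x_1x_2)$$ and the following thirteen inequalities hold: $$\begin{aligned} H(S|K)&<I(SX_1;Y_1|W_0W_2K),\\ H(T|K)&<I(TX_2;Y_2|W_0W_1K),\\ H(S)&<I(W_0W_2SX_1;Y_1),\\ H(T)&<I(W_0W_1TX_2;Y_2),\\ H(S|K)+H(T|K)&<I(SX_1;Y_1|W_0W_1W_2K)+I(W_1TX_2;Y_2|W_0K),\\ H(S|K)+H(T|K)&<I(TX_2;Y_2|W_0W_1W_2K)+I(W_2SX_1;Y_1|W_0K),\\ H(S|K)+H(T|K)&<I(SW_2X_1;Y_1|W_0W_1K)+I(TW_1X_2;Y_2|W_0W_2K),\\ H(S|K)+H(T)&<I(W_0W_1TX_2;Y_2)+I(SX_1;Y_1|W_0W_1W_2K),\\ H(S)+H(T|K)&<I(W_0W_2SX_1;Y_1)+I(TX_2;Y_2|W_0W_1W_2K),\\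 2H(S|K)+H(T|K)&<I(SX_1;Y_1|W_0W_1W_2K)+I(SW_2X_1;Y_1|W_0K)+I(TW_1X_2;Y_2|W_0W_2K),\\ H(S|K)+2H(T|K)&<I(TX_2;Y_2|W_0W_1W_2K)+I(TW_1X_2;Y_2|W_0K)+I(SW_2X_1;Y_1|W_0W_1K),\\ H(S)+H(S|K)+H(T|K)&<I(SX_1;Y_1|W_0W_1W_2K)+I(W_0W_2SX_1;Y_1)+I(TW_1X_2;Y_2|W_0W_2K),\\ H(T)+H(S|K)+H(T|K)&<I(TX_2;Y_2|W_0W_1W_2K)+I(W_0W_1TX_2;Y_2)+I(SW_2X_1;Y_1|W_0W_1K). \end{aligned}$$ -/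

import Mathlib

namespace CorrIC

section Information

variable {Ω A B C : Type*}

/-- The pair `(X, Y)` of two random variables, as a random variable. -/
abbrev pair (X : Ω → A) (Y : Ω → B) : Ω → A × B := fun ω => (X ω, Y ω)

infixr:70 " ⋄ " => CorrIC.pair

/-- The probability that `X = a`, as a real number. -/
noncomputable def prob (P : PMF Ω) (X : Ω → A) (a : A) : ℝ := (P.map X a).toReal

/-- Entropy `H(X) = -∑ p(x) log p(x)`, in nats. -/
noncomputable def entropy [Fintype A] (P : PMF Ω) (X : Ω → A) : ℝ :=
  -∑ a, prob P X a * Real.log (prob P X a)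

/-- Conditional entropy `H(X|Z) = -∑ p(x,z) log p(x|z)`. Terms with `p(x,z) = 0` vanish. -/
noncomputable def condEntropy [Fintype A] [Fintype C] (P : PMF Ω) (X : Ω → A) (Z : Ω → C) : ℝ :=
  -∑ a, ∑ c, prob P (X ⋄ Z) (a, c) * Real.log (prob P (X ⋄ Z) (a, c) / prob P Z c)

/-- Mutual information `I(X;Y) = ∑ p(x,y) log (p(x,y) / (p(x) p(y)))`. -/
noncomputable def mutualInfo [Fintype A] [Fintype B] (P : PMF Ω) (X : Ω → A) (Y : Ω → B) : ℝ :=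
  ∑ a, ∑ b, prob P (X ⋄ Y) (a, b) *
    Real.log (prob P (X ⋄ Y) (a, b) / (prob P X a * prob P Y b))

/-- Conditional mutual information
`I(X;Y|Z) = ∑ p(x,y,z) log (p(x,y|z) / (p(x|z) p(y|z)))`. -/
noncomputable def condMutualInfo [Fintype A] [Fintype B] [Fintype C]
    (P : PMF Ω) (X : Ω → A) (Y : Ω → B) (Z : Ω → C) : ℝ :=
  ∑ a, ∑ b, ∑ c, prob P (X ⋄ Y ⋄ Z) (a, b, c) *
    Real.log ((prob P (X ⋄ Y ⋄ Z) (a, b, c) / prob P Z c) /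
      ((prob P (X ⋄ Z) (a, c) / prob P Z c) * (prob P (Y ⋄ Z) (b, c) / prob P Z c)))

end Information

section Source

variable {𝒮 𝒯 κ : Type*}

/-- `f(S) = g(T)` with probability one. -/
def IsCommonFunction {D : Type*} (p : PMF (𝒮 × 𝒯)) (f : 𝒮 → D) (g : 𝒯 → D) : Prop :=
  ∀ s t, p (s, t) ≠ 0 → f s = g t

/-- `K = f(S) = g(T)` is the common part of `(S, T) ∼ p` in the sense of Gács, Körner and
Witsenhausen: it is a common function of `S` and `T`, and it is the finest one, that is, every
common function of `S` and `T` is almost surely a function of `K`. Since the alphabets are finite,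
it is enough to compare with functions with values in `ℕ`. -/
structure IsCommonPart (p : PMF (𝒮 × 𝒯)) (f : 𝒮 → κ) (g : 𝒯 → κ) : Prop where
  common : IsCommonFunction p f g
  finest : ∀ (f' : 𝒮 → ℕ) (g' : 𝒯 → ℕ), IsCommonFunction p f' g' →
    ∃ h : κ → ℕ, ∀ s t, p (s, t) ≠ 0 → f' s = h (f s)

end Source

section Code

variable {𝒮 𝒯 𝒳₁ 𝒳₂ 𝒴₁ 𝒴₂ : Type*}

/-- A source-channel block code of length `n`: two encoders and two decoders. -/
structure BlockCode (𝒮 𝒯 𝒳₁ 𝒳₂ 𝒴₁ 𝒴₂ : Type*) (n : ℕ) where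
  f₁ : (Fin n → 𝒮) → (Fin n → 𝒳₁)
  f₂ : (Fin n → 𝒯) → (Fin n → 𝒳₂)
  φ₁ : (Fin n → 𝒴₁) → (Fin n → 𝒮)
  φ₂ : (Fin n → 𝒴₂) → (Fin n → 𝒯)

variable [Fintype 𝒮] [Fintype 𝒯] [Fintype 𝒴₁] [Fintype 𝒴₂] {n : ℕ}

/-- The probability that the sources emit `(sⁿ, tⁿ)` and the channel, fed with the encoded
sequences, outputs `(y₁ⁿ, y₂ⁿ)`:
`∏ᵢ p(sᵢ,tᵢ) · ∏ᵢ p(y₁ᵢ y₂ᵢ | x₁ᵢ x₂ᵢ)` with `x₁ⁿ = f₁(sⁿ)`, `x₂ⁿ = f₂(tⁿ)`. -/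
noncomputable def systemProb (p : PMF (𝒮 × 𝒯)) (ch : 𝒳₁ → 𝒳₂ → PMF (𝒴₁ × 𝒴₂))
    (c : BlockCode 𝒮 𝒯 𝒳₁ 𝒳₂ 𝒴₁ 𝒴₂ n)
    (s : Fin n → 𝒮) (t : Fin n → 𝒯) (y₁ : Fin n → 𝒴₁) (y₂ : Fin n → 𝒴₂) : ℝ :=
  (∏ i, (p (s i, t i)).toReal) * ∏ i, (ch (c.f₁ s i) (c.f₂ t i) (y₁ i, y₂ i)).toReal

open Classical in
/-- The probability that decoder 1 does not recover `Sⁿ`. -/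
noncomputable def errorProb₁ (p : PMF (𝒮 × 𝒯)) (ch : 𝒳₁ → 𝒳₂ → PMF (𝒴₁ × 𝒴₂))
    (c : BlockCode 𝒮 𝒯 𝒳₁ 𝒳₂ 𝒴₁ 𝒴₂ n) : ℝ :=
  ∑ s, ∑ t, ∑ y₁, ∑ y₂, if c.φ₁ y₁ ≠ s then systemProb p ch c s t y₁ y₂ else 0

open Classical in
/-- The probability that decoder 2 does not recover `Tⁿ`. -/
noncomputable def errorProb₂ (p : PMF (𝒮 × 𝒯)) (ch : 𝒳₁ → 𝒳₂ → PMF (𝒴₁ × 𝒴₂))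
    (c : BlockCode 𝒮 𝒯 𝒳₁ 𝒳₂ 𝒴₁ 𝒴₂ n) : ℝ :=
  ∑ s, ∑ t, ∑ y₁, ∑ y₂, if c.φ₂ y₂ ≠ t then systemProb p ch c s t y₁ y₂ else 0

/-- The source pair `p(s,t)` is admissible for the interference channel `p(y₁y₂|x₁x₂)`: for every
`ε ∈ (0,1)` and all sufficiently large `n`, some code of length `n` has both error probabilities
at most `ε`. -/
def Admissible (p : PMF (𝒮 × 𝒯)) (ch : 𝒳₁ → 𝒳₂ → PMF (𝒴₁ × 𝒴₂)) : Prop :=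
  ∀ ε : ℝ, 0 < ε → ε < 1 → ∃ N : ℕ, ∀ n ≥ N, ∃ c : BlockCode 𝒮 𝒯 𝒳₁ 𝒳₂ 𝒴₁ 𝒴₂ n,
    max (errorProb₁ p ch c) (errorProb₂ p ch c) ≤ ε

end Code

end CorrIC

open CorrIC

/-! The proof is random coding that combines superposition on the common part, random partitions of
the source words, and non-unique decoding of the interfering codeword. Every value `k` of the block
common part receives a cloud centre `W₀ k`. Each user throws its source words at random into `M ≈
exp (n R)` cells, draws one satellite codeword for every pair (common part, cell), and draws one
channel input for every source word given the word, its satellite and its cloud centre. Since `f s =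
g t` almost surely, both users work over the same cloud centre.

Decoder 1 looks for a word `s'` that passes a test together with some satellite of user 2 over the
same cloud centre; which satellite is irrelevant. A wrong `s'` falls into one of five patterns: with
the true common part, it shares the true cell or not (sharing costs `1/M₁`), and the satellite of
user 2 is the transmitted one or not (the latter leaves up to `M₂` candidates); with another common
part, everything is fresh. These are the five terms of `ev_errUnion_le`. Adding the bounds of both
decoders and fixing a good codebook gives `exists_oneShot_code`.

The test asks that five products of densities be at least `exp (n (D j - δ))`, where `D j` is a
mutual information minus a source entropy. True words pass by Chebyshev (`exists_evSystem_test_le`).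
For wrong words the indicator of the test is at most `exp (-n (D j - δ))` times the `j`-th product.
Averaged over the codebook and summed over words, that product is at most one, because letter by
letter it is bounded by a posterior distribution given the output (`isDensityFamily_densities`,
`testBound_densityTest`).

Hence `exists_block_code`: the errors vanish as soon as positive partition rates `R₁`, `R₂` satisfy
five linear inequalities per user. Eliminating the two rates in `exists_rates` turns these into the
thirteen inequalities of the theorem. -/

namespace CorrIC

/-! ### Finite expectations and product laws. -/

section Expectation

variable {α β ι : Type*} [Fintype α] [Fintype β] [Fintype ι]

/-- Expectation of `F` under the weight function `μ`. -/
noncomputable def ev (μ F : α → ℝ) : ℝ := ∑ x, μ x * F x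

/-- `μ` is a probability mass function. -/
structure IsProb (μ : α → ℝ) : Prop where
  nonneg : ∀ x, 0 ≤ μ x
  sum_one : ∑ x, μ x = 1

/-- The indicator of a proposition. -/
noncomputable def ind (a : Prop) : ℝ := by
  classical exact if a then 1 else 0

lemma ind_nonneg (a : Prop) : 0 ≤ ind a := by unfold ind; split_ifs <;> norm_num

lemma ind_le_one (a : Prop) : ind a ≤ 1 := by unfold ind; split_ifs <;> norm_num

lemma ind_of {a : Prop} (h : a) : ind a = 1 := by simp [ind, h]

lemma ind_of_not {a : Prop} (h : ¬ a) : ind a = 0 := by simp [ind, h]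

lemma ind_mono {a b : Prop} (h : a → b) : ind a ≤ ind b := by
  by_cases ha : a
  · rw [ind_of ha, ind_of (h ha)]
  · rw [ind_of_not ha]; exact ind_nonneg _

lemma ind_and (a b : Prop) : ind (a ∧ b) = ind a * ind b := by
  by_cases ha : a <;> by_cases hb : b <;> simp [ind, ha, hb]

lemma ev_nonneg {μ F : α → ℝ} (hμ : IsProb μ) (hF : ∀ x, 0 ≤ F x) : 0 ≤ ev μ F :=
  Finset.sum_nonneg fun x _ => mul_nonneg (hμ.nonneg x) (hF x)

lemma ev_mono {μ F G : α → ℝ} (hμ : IsProb μ) (h : ∀ x, F x ≤ G x) : ev μ F ≤ ev μ G :=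
  Finset.sum_le_sum fun x _ => mul_le_mul_of_nonneg_left (h x) (hμ.nonneg x)

lemma ev_mono_supp {μ F G : α → ℝ} (hμ : IsProb μ) (h : ∀ x, μ x ≠ 0 → F x ≤ G x) :
    ev μ F ≤ ev μ G := by
  refine Finset.sum_le_sum fun x _ => ?_
  by_cases hx : μ x = 0
  · simp [hx]
  · exact mul_le_mul_of_nonneg_left (h x hx) (hμ.nonneg x)

lemma ev_const {μ : α → ℝ} (hμ : IsProb μ) (c : ℝ) : ev μ (fun _ => c) = c := by
  rw [ev, ← Finset.sum_mul, hμ.sum_one, one_mul]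

lemma ev_le {μ F : α → ℝ} (hμ : IsProb μ) {c : ℝ} (h : ∀ x, F x ≤ c) : ev μ F ≤ c :=
  (ev_mono hμ h).trans (ev_const hμ c).le

lemma ev_add (μ F G : α → ℝ) : ev μ (fun x => F x + G x) = ev μ F + ev μ G := by
  simp [ev, mul_add, Finset.sum_add_distrib]

lemma ev_mul_left (μ F : α → ℝ) (c : ℝ) : ev μ (fun x => c * F x) = c * ev μ F := by
  simp only [ev, Finset.mul_sum]
  exact Finset.sum_congr rfl fun x _ => by ring

lemma ev_sum {γ : Type*} (μ : α → ℝ) (F : γ → α → ℝ) (t : Finset γ) :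
    ev μ (fun x => ∑ i ∈ t, F i x) = ∑ i ∈ t, ev μ (F i) := by
  simp only [ev, Finset.mul_sum]
  exact Finset.sum_comm

lemma ev_comm (μ : α → ℝ) (ν : β → ℝ) (F : α → β → ℝ) :
    ev μ (fun x => ev ν (F x)) = ev ν fun y => ev μ fun x => F x y := by
  simp only [ev, Finset.mul_sum]
  rw [Finset.sum_comm]
  exact Finset.sum_congr rfl fun x _ => Finset.sum_congr rfl fun y _ => by ring

lemma IsProb.exists_le {μ F : α → ℝ} (hμ : IsProb μ) {c : ℝ} (h : ev μ F ≤ c) :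
    ∃ x, F x ≤ c := by
  by_contra! hc
  have h0 : ∃ x, μ x ≠ 0 := by
    by_contra! h0
    simpa [h0] using hμ.sum_one
  obtain ⟨x, hx⟩ := h0
  have : ev μ (fun _ => c) < ev μ F :=
    Finset.sum_lt_sum (fun y _ => mul_le_mul_of_nonneg_left (hc y).le (hμ.nonneg y))
      ⟨x, Finset.mem_univ x,
        mul_lt_mul_of_pos_left (hc x) (lt_of_le_of_ne (hμ.nonneg x) (Ne.symm hx))⟩
  rw [ev_const hμ] at this
  linarith

/-- The law of independent coordinates. -/
noncomputable def piw (μ : ι → α → ℝ) : (ι → α) → ℝ := fun X => ∏ i, μ i (X i)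

variable [DecidableEq ι]

lemma sum_prod_pi (h : ι → α → ℝ) : ∑ X : ι → α, ∏ i, h i (X i) = ∏ i, ∑ x, h i x := by
  rw [Finset.prod_univ_sum, Fintype.piFinset_univ]

lemma IsProb.piw {μ : ι → α → ℝ} (hμ : ∀ i, IsProb (μ i)) : IsProb (piw μ) where
  nonneg X := Finset.prod_nonneg fun i _ => (hμ i).nonneg _
  sum_one := by
    simp only [CorrIC.piw, sum_prod_pi]
    exact Finset.prod_eq_one fun i _ => (hμ i).sum_one

lemma ev_piw_prod (μ G : ι → α → ℝ) :
    ev (piw μ) (fun X => ∏ i, G i (X i)) = ∏ i, ev (μ i) (G i) := by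
  simp only [ev, piw, ← Finset.prod_mul_distrib]
  exact sum_prod_pi fun i x => μ i x * G i x

lemma ev_eq_sum_indicator [DecidableEq α] (μ : α → ℝ) (x : α) :
    ev μ (fun z => if z = x then 1 else 0) = μ x := by
  simp [ev]

/-- Products of one-coordinate functions are covered by `ev_piw_prod`. Indicators of points are such
products and span all functions of the coordinate, so linearity finishes; `ev_piw_two` takes the
same route. -/
lemma ev_piw_one {μ : ι → α → ℝ} (hμ : ∀ i, IsProb (μ i)) (i : ι) (F : α → ℝ) :
    ev (piw μ) (fun X => F (X i)) = ev (μ i) F := by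
  classical
  have key : ∀ x, ev (piw μ) (fun X => if X i = x then 1 else 0) = μ i x := by
    intro x
    have h := ev_piw_prod μ (fun l z => if l = i then (if z = x then 1 else 0) else 1)
    simp only [Finset.prod_ite_eq', Finset.mem_univ, if_true] at h
    rw [h, ← Finset.mul_prod_erase _ _ (Finset.mem_univ i)]
    rw [Finset.prod_eq_one]
    · simp [ev_eq_sum_indicator]
    · intro l hl
      simp [Finset.ne_of_mem_erase hl, ev_const (hμ l)]
  calc ev (piw μ) (fun X => F (X i))
      = ev (piw μ) (fun X => ∑ x, F x * (if X i = x then 1 else 0)) := by simp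
    _ = ∑ x, F x * μ i x := by
        rw [ev_sum]
        exact Finset.sum_congr rfl fun x _ => by rw [ev_mul_left, key]
    _ = ev (μ i) F := Finset.sum_congr rfl fun x _ => mul_comm _ _

lemma ev_piw_two {μ : ι → α → ℝ} (hμ : ∀ i, IsProb (μ i)) {i j : ι} (hij : i ≠ j)
    (F : α → α → ℝ) :
    ev (piw μ) (fun X => F (X i) (X j)) = ev (μ i) fun x => ev (μ j) fun y => F x y := by
  classical
  have key : ∀ x y, ev (piw μ) (fun X => (if X i = x then 1 else 0) * (if X j = y then 1 else 0))
      = μ i x * μ j y := by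
    intro x y
    have h := ev_piw_prod μ (fun l z => (if l = i then (if z = x then 1 else 0) else 1) *
      (if l = j then (if z = y then 1 else 0) else 1))
    simp only [Finset.prod_mul_distrib, Finset.prod_ite_eq', Finset.mem_univ, if_true] at h
    have hj : j ∈ Finset.univ.erase i := Finset.mem_erase.2 ⟨hij.symm, Finset.mem_univ j⟩
    rw [h, ← Finset.mul_prod_erase _ _ (Finset.mem_univ i), ← Finset.mul_prod_erase _ _ hj]
    rw [Finset.prod_eq_one]
    · simp [ev_eq_sum_indicator, hij, hij.symm]
    · intro l hl
      have h1 := Finset.ne_of_mem_erase hl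
      have h2 := Finset.ne_of_mem_erase (Finset.mem_of_mem_erase hl)
      simp [h1, h2, ev_const (hμ l)]
  calc ev (piw μ) (fun X => F (X i) (X j))
      = ev (piw μ) (fun X => ∑ x, ∑ y, F x y *
          ((if X i = x then 1 else 0) * (if X j = y then 1 else 0))) := by simp
    _ = ∑ x, ∑ y, F x y * (μ i x * μ j y) := by
        rw [ev_sum]
        refine Finset.sum_congr rfl fun x _ => ?_
        rw [ev_sum]
        exact Finset.sum_congr rfl fun y _ => by rw [ev_mul_left, key]
    _ = _ := by
        simp only [ev, Finset.mul_sum]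
        exact Finset.sum_congr rfl fun x _ => Finset.sum_congr rfl fun y _ => by ring

end Expectation

/-! ### Exchanging averages with sums over wrong words. -/

section Pull

variable {ι α β γ δ ε : Type*} [Fintype α] [Fintype β] [Fintype γ] [Fintype δ] [Fintype ε]

/-- The law `ν` does not depend on the wrong word `i`, as is the case for the channel output.
Bringing its average outside lets the remaining sum be bounded with that variable frozen; the
variants differ in how many averages are crossed. -/
lemma sum_ev_pull₁ (t : Finset ι) (μ : ι → α → ℝ) (ν : ε → ℝ) (F : ι → α → ε → ℝ) :
    ∑ i ∈ t, ev (μ i) (fun x => ev ν (F i x)) =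
      ev ν fun y => ∑ i ∈ t, ev (μ i) fun x => F i x y := by
  rw [ev_sum]
  exact Finset.sum_congr rfl fun i _ => ev_comm _ _ _

lemma sum_ev_pull₂ (t : Finset ι) (μ : ι → α → ℝ) (μ₂ : ι → α → β → ℝ) (ν : ε → ℝ)
    (F : ι → α → β → ε → ℝ) :
    ∑ i ∈ t, ev (μ i) (fun x => ev (μ₂ i x) fun x₂ => ev ν (F i x x₂)) =
      ev ν fun y => ∑ i ∈ t, ev (μ i) fun x => ev (μ₂ i x) fun x₂ => F i x x₂ y := by
  rw [← sum_ev_pull₁]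
  refine Finset.sum_congr rfl fun i _ => congrArg _ (funext fun x => ?_)
  exact ev_comm _ _ _

lemma sum_ev_pull₃ (t : Finset ι) (μ : ι → α → ℝ) (μ₂ : ι → α → β → ℝ)
    (μ₃ : ι → α → β → γ → ℝ) (ν : ε → ℝ) (F : ι → α → β → γ → ε → ℝ) :
    ∑ i ∈ t, ev (μ i) (fun x => ev (μ₂ i x) fun x₂ => ev (μ₃ i x x₂) fun x₃ =>
        ev ν (F i x x₂ x₃)) =
      ev ν fun y => ∑ i ∈ t, ev (μ i) fun x => ev (μ₂ i x) fun x₂ => ev (μ₃ i x x₂) fun x₃ =>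
        F i x x₂ x₃ y := by
  rw [← sum_ev_pull₂]
  refine Finset.sum_congr rfl fun i _ => congrArg _ (funext fun x => congrArg _ (funext fun x₂ => ?_))
  exact ev_comm _ _ _

lemma sum_ev_pull₄ (t : Finset ι) (μ : ι → α → ℝ) (μ₂ : ι → α → β → ℝ)
    (μ₃ : ι → α → β → γ → ℝ) (μ₄ : ι → α → β → γ → δ → ℝ) (ν : ε → ℝ)
    (F : ι → α → β → γ → δ → ε → ℝ) :
    ∑ i ∈ t, ev (μ i) (fun x => ev (μ₂ i x) fun x₂ => ev (μ₃ i x x₂) fun x₃ =>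
        ev (μ₄ i x x₂ x₃) fun x₄ => ev ν (F i x x₂ x₃ x₄)) =
      ev ν fun y => ∑ i ∈ t, ev (μ i) fun x => ev (μ₂ i x) fun x₂ => ev (μ₃ i x x₂) fun x₃ =>
        ev (μ₄ i x x₂ x₃) fun x₄ => F i x x₂ x₃ x₄ y := by
  rw [← sum_ev_pull₃]
  refine Finset.sum_congr rfl fun i _ => congrArg _ (funext fun x => congrArg _ (funext fun x₂ =>
    congrArg _ (funext fun x₃ => ?_)))
  exact ev_comm _ _ _

end Pull

/-! ### The random codebook of one user. -/

section User

variable {𝒮 κ 𝒲₀ 𝒲 𝒳 : Type*} [Fintype 𝒮] [Fintype κ] [Fintype 𝒲] [Fintype 𝒳]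
  [DecidableEq 𝒮] [DecidableEq κ] {M : ℕ}

/-- The uniform law on `Fin M`. -/
noncomputable def unif (M : ℕ) : Fin M → ℝ := fun _ => (M : ℝ)⁻¹

lemma isProb_unif (hM : 0 < M) : IsProb (unif M) where
  nonneg _ := by unfold unif; positivity
  sum_one := by
    have : (M : ℝ) ≠ 0 := by positivity
    simp [unif, this]

/-- Expectation over the random codebook of one user, given the cloud centres `W₀`: a random
partition `a` of the source alphabet into `M` cells, satellite codewords `V`, and channel
inputs `X`. -/
noncomputable def evUser (f : 𝒮 → κ) (q : 𝒲₀ → 𝒲 → ℝ) (r : 𝒮 → 𝒲 → 𝒲₀ → 𝒳 → ℝ)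
    (W₀ : κ → 𝒲₀) (F : (𝒮 → Fin M) → (κ × Fin M → 𝒲) → (𝒮 → 𝒳) → ℝ) : ℝ :=
  ev (piw fun _ : 𝒮 => unif M) fun a => ev (piw fun k : κ × Fin M => q (W₀ k.1)) fun V =>
    ev (piw fun s => r s (V (f s, a s)) (W₀ (f s))) fun X => F a V X

/-- Exact for distinct indices; for equal indices a nonnegative term is added. The surplus keeps
factors like `1 - 1/M` out of all later estimates. -/
lemma ev_piw_pair_le {ι α : Type*} [Fintype ι] [Fintype α] [DecidableEq ι] {μ : ι → α → ℝ}
    (hμ : ∀ i, IsProb (μ i)) (i j : ι) {G : α → α → ℝ} (hG : ∀ x y, 0 ≤ G x y) :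
    ev (piw μ) (fun X => G (X i) (X j)) ≤
      ind (i = j) * ev (μ i) (fun x => G x x) + ev (μ i) fun x => ev (μ j) fun y => G x y := by
  by_cases h : i = j
  · subst h
    rw [ind_of rfl, one_mul, ev_piw_one hμ i fun x => G x x]
    exact le_add_of_nonneg_right (ev_nonneg (hμ i) fun x => ev_nonneg (hμ i) fun y => hG x y)
  · rw [ind_of_not h, zero_mul, zero_add, ev_piw_two hμ h]

lemma ev_unif_eq (x : Fin M) : ev (unif M) (fun y => ind (x = y)) = (M : ℝ)⁻¹ := by
  simp [ev, unif, ind]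

variable {f : 𝒮 → κ} {q : 𝒲₀ → 𝒲 → ℝ} {r : 𝒮 → 𝒲 → 𝒲₀ → 𝒳 → ℝ}
  (hM : 0 < M) (hq : ∀ w₀, IsProb (q w₀)) (hr : ∀ s w w₀, IsProb (r s w w₀)) (W₀ : κ → 𝒲₀)

include hM hq hr

lemma evUser_mono {F G : (𝒮 → Fin M) → (κ × Fin M → 𝒲) → (𝒮 → 𝒳) → ℝ}
    (h : ∀ a V X, F a V X ≤ G a V X) : evUser f q r W₀ F ≤ evUser f q r W₀ G :=
  ev_mono (.piw fun _ => isProb_unif hM) fun _ => ev_mono (.piw fun _ => hq _) fun _ =>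
    ev_mono (.piw fun _ => hr _ _ _) fun _ => h _ _ _

/-- The cell of `s` only selects which satellite is read, and all satellites over one cloud centre
have the same law, so the partition averages out. -/
lemma evUser_single (s : 𝒮) (F : 𝒲 → 𝒳 → ℝ) :
    evUser (M := M) f q r W₀ (fun a V X => F (V (f s, a s)) (X s)) =
      ev (q (W₀ (f s))) fun w => ev (r s w (W₀ (f s))) fun x => F w x := by
  have h1 : ∀ (a : 𝒮 → Fin M) (V : κ × Fin M → 𝒲),
      ev (piw fun s => r s (V (f s, a s)) (W₀ (f s))) (fun X => F (V (f s, a s)) (X s)) =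
        ev (r s (V (f s, a s)) (W₀ (f s))) fun x => F (V (f s, a s)) x :=
    fun a V => ev_piw_one (fun _ => hr _ _ _) s fun x => F (V (f s, a s)) x
  have h2 : ∀ a : 𝒮 → Fin M, ev (piw fun k : κ × Fin M => q (W₀ k.1)) (fun V =>
      ev (r s (V (f s, a s)) (W₀ (f s))) fun x => F (V (f s, a s)) x) =
      ev (q (W₀ (f s))) fun w => ev (r s w (W₀ (f s))) fun x => F w x :=
    fun a => ev_piw_one (μ := fun k : κ × Fin M => q (W₀ k.1)) (fun _ => hq _) (f s, a s)
      fun w => ev (r s w (W₀ (f s))) fun x => F w x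
  simp only [evUser, h1, h2]
  exact ev_const (.piw fun _ => isProb_unif hM) _

/-- Two distinct words over one cloud centre fall into the same cell with probability `1/M`, and
then read the same satellite; otherwise their satellites are independent, an event whose probability
is bounded by one. -/
lemma evUser_pair_same_le {s s' : 𝒮} (hs : s ≠ s') (hf : f s' = f s)
    {F : 𝒲 → 𝒳 → 𝒲 → 𝒳 → ℝ} (hF : ∀ w x w' x', 0 ≤ F w x w' x') :
    evUser (M := M) f q r W₀ (fun a V X => F (V (f s, a s)) (X s) (V (f s', a s')) (X s')) ≤
      (M : ℝ)⁻¹ * (ev (q (W₀ (f s))) fun w => ev (r s w (W₀ (f s))) fun x =>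
        ev (r s' w (W₀ (f s))) fun x' => F w x w x') +
      ev (q (W₀ (f s))) fun w => ev (r s w (W₀ (f s))) fun x =>
        ev (q (W₀ (f s))) fun w' => ev (r s' w' (W₀ (f s))) fun x' => F w x w' x' := by
  set w₀ := W₀ (f s) with hw₀
  let G : 𝒲 → 𝒲 → ℝ := fun w w' =>
    ev (r s w w₀) fun x => ev (r s' w' w₀) fun x' => F w x w' x'
  have hG : ∀ w w', 0 ≤ G w w' := fun w w' =>
    ev_nonneg (hr _ _ _) fun x => ev_nonneg (hr _ _ _) fun x' => hF _ _ _ _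
  have h1 : ∀ (a : 𝒮 → Fin M) (V : κ × Fin M → 𝒲),
      ev (piw fun s => r s (V (f s, a s)) (W₀ (f s)))
        (fun X => F (V (f s, a s)) (X s) (V (f s', a s')) (X s')) =
        G (V (f s, a s)) (V (f s, a s')) := by
    intro a V
    rw [ev_piw_two (μ := fun s => r s (V (f s, a s)) (W₀ (f s))) (fun _ => hr _ _ _) hs
      fun x x' => F (V (f s, a s)) x (V (f s', a s')) x', hf]
  have h2 : ∀ a : 𝒮 → Fin M, ev (piw fun k : κ × Fin M => q (W₀ k.1))
      (fun V => G (V (f s, a s)) (V (f s, a s'))) ≤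
      ind (a s = a s') * ev (q w₀) (fun w => G w w) +
        ev (q w₀) fun w => ev (q w₀) fun w' => G w w' := by
    intro a
    refine (ev_piw_pair_le (μ := fun k : κ × Fin M => q (W₀ k.1)) (fun _ => hq _)
      (f s, a s) (f s, a s') hG).trans (le_of_eq ?_)
    simp [hw₀]
  calc
    _ = ev (piw fun _ : 𝒮 => unif M) fun a => ev (piw fun k : κ × Fin M => q (W₀ k.1)) fun V =>
        G (V (f s, a s)) (V (f s, a s')) := by simp only [evUser, h1]
    _ ≤ ev (piw fun _ : 𝒮 => unif M) fun a => ind (a s = a s') * ev (q w₀) (fun w => G w w) +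
        ev (q w₀) fun w => ev (q w₀) fun w' => G w w' :=
      ev_mono (.piw fun _ => isProb_unif hM) h2
    _ = (M : ℝ)⁻¹ * ev (q w₀) (fun w => G w w) +
        ev (q w₀) fun w => ev (q w₀) fun w' => G w w' := by
      rw [ev_add, ev_const (.piw fun _ => isProb_unif hM)]
      simp_rw [mul_comm _ (ev (q w₀) (fun w => G w w))]
      rw [ev_mul_left, ev_piw_two (μ := fun _ : 𝒮 => unif M) (fun _ => isProb_unif hM) hs
        fun x y => ind (x = y)]
      simp only [ev_unif_eq]
      rw [ev_const (isProb_unif hM)]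
    _ = _ := by
      congr 1
      refine congrArg _ (funext fun w => ?_)
      exact ev_comm _ _ _

/-- Satellites are indexed by common part and cell, so words with different common parts never share
one, even when their cells coincide. -/
lemma evUser_pair_diff {s s' : 𝒮} (hf : f s ≠ f s') (F : 𝒲 → 𝒳 → 𝒲 → 𝒳 → ℝ) :
    evUser (M := M) f q r W₀ (fun a V X => F (V (f s, a s)) (X s) (V (f s', a s')) (X s')) =
      ev (q (W₀ (f s))) fun w => ev (r s w (W₀ (f s))) fun x =>
        ev (q (W₀ (f s'))) fun w' => ev (r s' w' (W₀ (f s'))) fun x' => F w x w' x' := by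
  let G : 𝒲 → 𝒲 → ℝ := fun w w' =>
    ev (r s w (W₀ (f s))) fun x => ev (r s' w' (W₀ (f s'))) fun x' => F w x w' x'
  have hs : s ≠ s' := fun h => hf (h ▸ rfl)
  have h1 : ∀ (a : 𝒮 → Fin M) (V : κ × Fin M → 𝒲),
      ev (piw fun s => r s (V (f s, a s)) (W₀ (f s)))
        (fun X => F (V (f s, a s)) (X s) (V (f s', a s')) (X s')) =
        G (V (f s, a s)) (V (f s', a s')) := fun a V =>
    ev_piw_two (μ := fun s => r s (V (f s, a s)) (W₀ (f s))) (fun _ => hr _ _ _) hs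
      fun x x' => F (V (f s, a s)) x (V (f s', a s')) x'
  have h2 : ∀ a : 𝒮 → Fin M, ev (piw fun k : κ × Fin M => q (W₀ k.1))
      (fun V => G (V (f s, a s)) (V (f s', a s'))) =
        ev (q (W₀ (f s))) fun w => ev (q (W₀ (f s'))) fun w' => G w w' := by
    intro a
    have hne : (f s, a s) ≠ (f s', a s') := fun h => hf (congrArg Prod.fst h)
    exact ev_piw_two (μ := fun k : κ × Fin M => q (W₀ k.1)) (fun _ => hq _) hne G
  simp only [evUser, h1, h2]
  rw [ev_const (.piw fun _ => isProb_unif hM)]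
  refine congrArg _ (funext fun w => ?_)
  exact ev_comm _ _ _

/-- Of the `M` satellites over the cloud centre of `s` exactly one is its own; the others are
independent of it and are counted as `M` instead of `M - 1`. -/
lemma evUser_sum_same_le (s : 𝒮) {F : 𝒲 → 𝒳 → 𝒲 → ℝ} (hF : ∀ w x w', 0 ≤ F w x w') :
    evUser (M := M) f q r W₀ (fun a V X => ∑ b, F (V (f s, a s)) (X s) (V (f s, b))) ≤
      (ev (q (W₀ (f s))) fun w => ev (r s w (W₀ (f s))) fun x => F w x w) +
      M * ev (q (W₀ (f s))) fun w => ev (r s w (W₀ (f s))) fun x =>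
        ev (q (W₀ (f s))) fun w' => F w x w' := by
  set w₀ := W₀ (f s) with hw₀
  let G : 𝒲 → 𝒲 → ℝ := fun w w' => ev (r s w w₀) fun x => F w x w'
  have hG : ∀ w w', 0 ≤ G w w' := fun w w' => ev_nonneg (hr _ _ _) fun x => hF _ _ _
  have h1 : ∀ (a : 𝒮 → Fin M) (V : κ × Fin M → 𝒲),
      ev (piw fun s => r s (V (f s, a s)) (W₀ (f s)))
        (fun X => ∑ b, F (V (f s, a s)) (X s) (V (f s, b))) =
        ∑ b, G (V (f s, a s)) (V (f s, b)) := by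
    intro a V
    rw [ev_sum]
    exact Finset.sum_congr rfl fun b _ =>
      ev_piw_one (fun _ => hr _ _ _) s fun x => F (V (f s, a s)) x (V (f s, b))
  have h2 : ∀ a : 𝒮 → Fin M, ev (piw fun k : κ × Fin M => q (W₀ k.1))
      (fun V => ∑ b, G (V (f s, a s)) (V (f s, b))) ≤
      ev (q w₀) (fun w => G w w) + M * ev (q w₀) fun w => ev (q w₀) fun w' => G w w' := by
    intro a
    rw [ev_sum]
    refine (Finset.sum_le_sum fun b _ => ev_piw_pair_le (μ := fun k : κ × Fin M => q (W₀ k.1))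
      (fun _ => hq _) (f s, a s) (f s, b) hG).trans (le_of_eq ?_)
    rw [Finset.sum_add_distrib, ← Finset.sum_mul]
    simp [hw₀, ind]
  simp only [evUser, h1]
  refine (ev_le (.piw fun _ => isProb_unif hM) h2).trans (le_of_eq ?_)
  congr 2
  refine congrArg _ (funext fun w => ?_)
  exact ev_comm _ _ _

lemma evUser_sum_diff (s : 𝒮) {k : κ} (hk : f s ≠ k) (F : 𝒲 → 𝒳 → 𝒲 → ℝ) :
    evUser (M := M) f q r W₀ (fun a V X => ∑ b, F (V (f s, a s)) (X s) (V (k, b))) =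
      M * ev (q (W₀ (f s))) fun w => ev (r s w (W₀ (f s))) fun x =>
        ev (q (W₀ k)) fun w' => F w x w' := by
  let G : 𝒲 → 𝒲 → ℝ := fun w w' => ev (r s w (W₀ (f s))) fun x => F w x w'
  have h1 : ∀ (a : 𝒮 → Fin M) (V : κ × Fin M → 𝒲),
      ev (piw fun s => r s (V (f s, a s)) (W₀ (f s)))
        (fun X => ∑ b, F (V (f s, a s)) (X s) (V (k, b))) =
        ∑ b, G (V (f s, a s)) (V (k, b)) := by
    intro a V
    rw [ev_sum]
    exact Finset.sum_congr rfl fun b _ =>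
      ev_piw_one (fun _ => hr _ _ _) s fun x => F (V (f s, a s)) x (V (k, b))
  have h2 : ∀ a : 𝒮 → Fin M, ev (piw fun k : κ × Fin M => q (W₀ k.1))
      (fun V => ∑ b, G (V (f s, a s)) (V (k, b))) =
        M * ev (q (W₀ (f s))) fun w => ev (q (W₀ k)) fun w' => G w w' := by
    intro a
    have hne : ∀ b, (f s, a s) ≠ (k, b) := fun b h => hk (congrArg Prod.fst h)
    rw [ev_sum, Finset.sum_congr rfl fun b _ =>
      ev_piw_two (μ := fun k : κ × Fin M => q (W₀ k.1)) (fun _ => hq _) (hne b) G]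
    simp
  simp only [evUser, h1, h2]
  rw [ev_const (.piw fun _ => isProb_unif hM)]
  congr 1
  refine congrArg _ (funext fun w => ?_)
  exact ev_comm _ _ _

end User

/-! ### Expected number of wrong words that pass the test. -/

section Decoder

variable {𝒮 𝒯 κ 𝒲₀ 𝒲₁ 𝒲₂ 𝒳₁ 𝒳₂ 𝒴 : Type*} [Fintype 𝒮] [Fintype 𝒯] [Fintype κ] [Fintype 𝒲₀]
  [Fintype 𝒲₁] [Fintype 𝒲₂] [Fintype 𝒳₁] [Fintype 𝒳₂] [Fintype 𝒴]
  [DecidableEq 𝒮] [DecidableEq 𝒯] [DecidableEq κ] {M₁ M₂ : ℕ}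

/-- The number of triples of a source word, an output and interfering codewords that pass the test
`L` is small, on average over the independently generated ones: the five ways in which a wrong
source word may share codewords with the true one. -/
structure TestBound (f : 𝒮 → κ) (q₀ : 𝒲₀ → ℝ) (q₁ : 𝒲₀ → 𝒲₁ → ℝ) (q₂ : 𝒲₀ → 𝒲₂ → ℝ)
    (r₁ : 𝒮 → 𝒲₁ → 𝒲₀ → 𝒳₁ → ℝ) (L : 𝒮 → 𝒲₀ → 𝒲₁ → 𝒲₂ → 𝒳₁ → 𝒴 → ℝ)
    (e₁ e₂ e₃ e₄ e₅ : ℝ) : Prop where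
  b₁ : ∀ k w₀ w₁ w₂ y, ∑ s with f s = k, ev (r₁ s w₁ w₀) (fun x => L s w₀ w₁ w₂ x y) ≤ e₁
  b₂ : ∀ k w₀ w₁ y, ∑ s with f s = k, ev (r₁ s w₁ w₀) (fun x => ev (q₂ w₀) fun w₂ =>
    L s w₀ w₁ w₂ x y) ≤ e₂
  b₃ : ∀ k w₀ w₂ y, ∑ s with f s = k, ev (q₁ w₀) (fun w₁ => ev (r₁ s w₁ w₀) fun x =>
    L s w₀ w₁ w₂ x y) ≤ e₃
  b₄ : ∀ k w₀ y, ∑ s with f s = k, ev (q₁ w₀) (fun w₁ => ev (r₁ s w₁ w₀) fun x =>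
    ev (q₂ w₀) fun w₂ => L s w₀ w₁ w₂ x y) ≤ e₄
  b₅ : ∀ y, ∑ s, ev q₀ (fun w₀ => ev (q₁ w₀) fun w₁ => ev (r₁ s w₁ w₀) fun x =>
    ev (q₂ w₀) fun w₂ => L s w₀ w₁ w₂ x y) ≤ e₅

variable {f : 𝒮 → κ} {g : 𝒯 → κ} {q₀ : 𝒲₀ → ℝ} {q₁ : 𝒲₀ → 𝒲₁ → ℝ} {q₂ : 𝒲₀ → 𝒲₂ → ℝ}
  {r₁ : 𝒮 → 𝒲₁ → 𝒲₀ → 𝒳₁ → ℝ} {r₂ : 𝒯 → 𝒲₂ → 𝒲₀ → 𝒳₂ → ℝ} {c : 𝒳₁ → 𝒳₂ → 𝒴 → ℝ}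
  {p : 𝒮 × 𝒯 → ℝ}

/-- The factors of the joint law are probability mass functions. -/
structure IsSystem (p : 𝒮 × 𝒯 → ℝ) (q₀ : 𝒲₀ → ℝ) (q₁ : 𝒲₀ → 𝒲₁ → ℝ) (q₂ : 𝒲₀ → 𝒲₂ → ℝ)
    (r₁ : 𝒮 → 𝒲₁ → 𝒲₀ → 𝒳₁ → ℝ) (r₂ : 𝒯 → 𝒲₂ → 𝒲₀ → 𝒳₂ → ℝ) (c : 𝒳₁ → 𝒳₂ → 𝒴 → ℝ) :
    Prop where
  hp : IsProb p
  hq₀ : IsProb q₀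
  hq₁ : ∀ w₀, IsProb (q₁ w₀)
  hq₂ : ∀ w₀, IsProb (q₂ w₀)
  hr₁ : ∀ s w w₀, IsProb (r₁ s w w₀)
  hr₂ : ∀ t w w₀, IsProb (r₂ t w w₀)
  hc : ∀ x₁ x₂, IsProb (c x₁ x₂)

variable (hM₁ : 0 < M₁) (hM₂ : 0 < M₂) (hsys : IsSystem p q₀ q₁ q₂ r₁ r₂ c)
  {L : 𝒮 → 𝒲₀ → 𝒲₁ → 𝒲₂ → 𝒳₁ → 𝒴 → ℝ} (hL : ∀ s w₀ w₁ w₂ x y, 0 ≤ L s w₀ w₁ w₂ x y)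

include hM₁ hM₂ hsys hL

/-- The cloud centre is shared. The four terms record whether the wrong word also shares the cell,
at the price `1/M₁`, and whether the satellite tried for user 2 is the transmitted one or one of
`M₂` others. -/
lemma ev_same_part_term (W₀ : κ → 𝒲₀) {s s' : 𝒮} {t : 𝒯} (hst : f s = g t) (hs : s ≠ s')
    (hf : f s' = f s) {w₀ : 𝒲₀} (hw₀ : W₀ (f s) = w₀) :
    (evUser (M := M₁) f q₁ r₁ W₀ fun a V X => evUser (M := M₂) g q₂ r₂ W₀ fun _ V' X' =>
      ev (c (X s) (X' t)) fun y => ∑ b, L s' (W₀ (f s')) (V (f s', a s')) (V' (f s', b)) (X s') y) ≤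
    (M₁ : ℝ)⁻¹ * (ev (q₁ w₀) fun w => ev (r₁ s w w₀) fun x => ev (r₁ s' w w₀) fun x' =>
        ev (q₂ w₀) fun v => ev (r₂ t v w₀) fun z => ev (c x z) fun y => L s' w₀ w v x' y) +
    (M₁ : ℝ)⁻¹ * (M₂ * ev (q₁ w₀) fun w => ev (r₁ s w w₀) fun x => ev (r₁ s' w w₀) fun x' =>
        ev (q₂ w₀) fun v => ev (r₂ t v w₀) fun z => ev (q₂ w₀) fun v' => ev (c x z) fun y =>
          L s' w₀ w v' x' y) +
    ((ev (q₁ w₀) fun w => ev (r₁ s w w₀) fun x => ev (q₁ w₀) fun w' =>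
        ev (r₁ s' w' w₀) fun x' => ev (q₂ w₀) fun v => ev (r₂ t v w₀) fun z => ev (c x z) fun y =>
          L s' w₀ w' v x' y) +
    M₂ * ev (q₁ w₀) fun w => ev (r₁ s w w₀) fun x => ev (q₁ w₀) fun w' =>
        ev (r₁ s' w' w₀) fun x' => ev (q₂ w₀) fun v => ev (r₂ t v w₀) fun z =>
          ev (q₂ w₀) fun v' => ev (c x z) fun y => L s' w₀ w' v' x' y) := by
  have hgw : W₀ (g t) = w₀ := by rw [← hst, hw₀]
  -- `D` is the contribution of the transmitted satellite of user 2, `P` that of a fresh one.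
  let D : 𝒲₁ → 𝒳₁ → 𝒲₁ → 𝒳₁ → ℝ := fun w x w' x' => ev (q₂ w₀) fun v => ev (r₂ t v w₀) fun z =>
    ev (c x z) fun y => L s' w₀ w' v x' y
  let P : 𝒲₁ → 𝒳₁ → 𝒲₁ → 𝒳₁ → ℝ := fun w x w' x' => ev (q₂ w₀) fun v => ev (r₂ t v w₀) fun z =>
    ev (q₂ w₀) fun v' => ev (c x z) fun y => L s' w₀ w' v' x' y
  have hD : ∀ w x w' x', 0 ≤ D w x w' x' := fun w x w' x' =>
    ev_nonneg (hsys.hq₂ _) fun _ => ev_nonneg (hsys.hr₂ _ _ _) fun _ =>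
      ev_nonneg (hsys.hc _ _) fun _ => hL _ _ _ _ _ _
  have hP : ∀ w x w' x', 0 ≤ P w x w' x' := fun w x w' x' =>
    ev_nonneg (hsys.hq₂ _) fun _ => ev_nonneg (hsys.hr₂ _ _ _) fun _ =>
      ev_nonneg (hsys.hq₂ _) fun _ => ev_nonneg (hsys.hc _ _) fun _ => hL _ _ _ _ _ _
  have h1 : ∀ (w : 𝒲₁) (x : 𝒳₁) (w' : 𝒲₁) (x' : 𝒳₁),
      (evUser (M := M₂) g q₂ r₂ W₀ fun _ V' X' =>
        ev (c x (X' t)) fun y => ∑ b, L s' w₀ w' (V' (g t, b)) x' y) ≤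
      D w x w' x' + M₂ * P w x w' x' := by
    intro w x w' x'
    have h := evUser_sum_same_le (f := g) hM₂ hsys.hq₂ hsys.hr₂ W₀ t (F := fun _ z v' =>
      ev (c x z) fun y => L s' w₀ w' v' x' y)
      (fun _ _ _ => ev_nonneg (hsys.hc _ _) fun _ => hL _ _ _ _ _ _)
    rw [hgw] at h
    refine le_trans (le_of_eq ?_) h
    simp only [ev_sum]
  let F : 𝒲₁ → 𝒳₁ → 𝒲₁ → 𝒳₁ → ℝ := fun w x w' x' => D w x w' x' + M₂ * P w x w' x'
  have hF : ∀ w x w' x', 0 ≤ F w x w' x' := fun w x w' x' =>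
    add_nonneg (hD w x w' x') (mul_nonneg (Nat.cast_nonneg _) (hP w x w' x'))
  have h2 := evUser_pair_same_le hM₁ hsys.hq₁ hsys.hr₁ W₀ hs hf hF
  rw [hw₀] at h2
  have h3 : ∀ (a : 𝒮 → Fin M₁) (V : κ × Fin M₁ → 𝒲₁) (X : 𝒮 → 𝒳₁),
      (evUser (M := M₂) g q₂ r₂ W₀ fun _ V' X' => ev (c (X s) (X' t)) fun y =>
        ∑ b, L s' (W₀ (f s')) (V (f s', a s')) (V' (f s', b)) (X s') y) ≤
      F (V (f s, a s)) (X s) (V (f s', a s')) (X s') := by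
    intro a V X
    have := h1 (V (f s, a s)) (X s) (V (f s', a s')) (X s')
    simp only [hf.trans hst, hgw] at this ⊢
    exact this
  refine ((evUser_mono hM₁ hsys.hq₁ hsys.hr₁ W₀ h3).trans h2).trans (le_of_eq ?_)
  simp only [ev_add, ev_mul_left, mul_add, F, D, P]

omit hL in
-- The right side is written as a function of two cloud centres applied to their values, the shape
-- that `ev_piw_two` needs for the later average over `W₀`.
lemma ev_diff_part_term (W₀ : κ → 𝒲₀) {s s' : 𝒮} {t : 𝒯} (hst : f s = g t)
    (hf : f s ≠ f s') :
    (evUser (M := M₁) f q₁ r₁ W₀ fun a V X => evUser (M := M₂) g q₂ r₂ W₀ fun _ V' X' =>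
      ev (c (X s) (X' t)) fun y => ∑ b, L s' (W₀ (f s')) (V (f s', a s')) (V' (f s', b)) (X s') y) =
    M₂ * (fun w₀ w₀' => ev (q₁ w₀) fun w => ev (r₁ s w w₀) fun x => ev (q₁ w₀') fun w' =>
        ev (r₁ s' w' w₀') fun x' => ev (q₂ w₀) fun v => ev (r₂ t v w₀) fun z =>
          ev (q₂ w₀') fun v' => ev (c x z) fun y => L s' w₀' w' v' x' y)
            (W₀ (f s)) (W₀ (f s')) := by
  have h1 : ∀ (x : 𝒳₁) (w' : 𝒲₁) (x' : 𝒳₁),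
      (evUser (M := M₂) g q₂ r₂ W₀ fun _ V' X' =>
        ev (c x (X' t)) fun y => ∑ b, L s' (W₀ (f s')) w' (V' (f s', b)) x' y) =
      M₂ * ev (q₂ (W₀ (f s))) fun v => ev (r₂ t v (W₀ (f s))) fun z =>
          ev (q₂ (W₀ (f s'))) fun v' => ev (c x z) fun y => L s' (W₀ (f s')) w' v' x' y := by
    intro x w' x'
    have h := evUser_sum_diff (f := g) hM₂ hsys.hq₂ hsys.hr₂ W₀ t (k := f s') (hst ▸ hf) (fun _ z v' =>
      ev (c x z) fun y => L s' (W₀ (f s')) w' v' x' y)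
    rw [← hst] at h
    rw [← h]
    simp only [ev_sum]
  simp only [h1]
  rw [evUser_pair_diff hM₁ hsys.hq₁ hsys.hr₁ W₀ hf fun w x w' x' =>
    M₂ * ev (q₂ (W₀ (f s))) fun v => ev (r₂ t v (W₀ (f s))) fun z =>
          ev (q₂ (W₀ (f s'))) fun v' => ev (c x z) fun y => L s' (W₀ (f s')) w' v' x' y]
  simp only [ev_mul_left]

variable {e₁ e₂ e₃ e₄ e₅ : ℝ} (hT : TestBound f q₀ q₁ q₂ r₁ L e₁ e₂ e₃ e₄ e₅)

include hT

/-- All variables of the true transmission, the output included, are frozen by moving their averages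
outside the sum. `TestBound` is uniform in those variables, so it applies pointwise to what remains.
-/
lemma sum_ev_same_part_le (W₀ : κ → 𝒲₀) {s : 𝒮} {t : 𝒯} (hst : f s = g t) :
    ∑ s' with s ≠ s' ∧ f s' = f s,
      (evUser (M := M₁) f q₁ r₁ W₀ fun a V X => evUser (M := M₂) g q₂ r₂ W₀ fun _ V' X' =>
        ev (c (X s) (X' t)) fun y =>
          ∑ b, L s' (W₀ (f s')) (V (f s', a s')) (V' (f s', b)) (X s') y) ≤
    (M₁ : ℝ)⁻¹ * e₁ + (M₁ : ℝ)⁻¹ * (M₂ * e₂) + (e₃ + M₂ * e₄) := by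
  obtain ⟨hp, hq₀, hq₁, hq₂, hr₁, hr₂, hc⟩ := hsys
  have hsub : (Finset.univ.filter fun s' => s ≠ s' ∧ f s' = f s) ⊆
      Finset.univ.filter fun s' => f s' = f s := fun s' hs' => by
    simp only [Finset.mem_filter, Finset.mem_univ, true_and] at hs' ⊢
    exact hs'.2
  refine (Finset.sum_le_sum fun s' hs' => ev_same_part_term (w₀ := W₀ (f s)) hM₁ hM₂
    ⟨hp, hq₀, hq₁, hq₂, hr₁, hr₂, hc⟩ hL W₀ hst (Finset.mem_filter.1 hs').2.1
    (Finset.mem_filter.1 hs').2.2 rfl).trans ?_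
  generalize W₀ (f s) = w₀
  simp only [Finset.sum_add_distrib, ← Finset.mul_sum]
  have hM1 : 0 ≤ (M₁ : ℝ)⁻¹ := by positivity
  have hM2 : 0 ≤ (M₂ : ℝ) := by positivity
  refine add_le_add (add_le_add (mul_le_mul_of_nonneg_left ?_ hM1)
    (mul_le_mul_of_nonneg_left (mul_le_mul_of_nonneg_left ?_ hM2) hM1))
    (add_le_add ?_ (mul_le_mul_of_nonneg_left ?_ hM2))
  · rw [← ev_sum]
    refine ev_le (hq₁ _) fun w => ?_
    rw [← ev_sum]
    refine ev_le (hr₁ _ _ _) fun x => ?_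
    rw [sum_ev_pull₁]
    refine ev_le (hq₂ _) fun v => ?_
    rw [sum_ev_pull₁]
    refine ev_le (hr₂ _ _ _) fun z => ?_
    rw [sum_ev_pull₁]
    refine ev_le (hc _ _) fun y => ?_
    refine (Finset.sum_le_sum_of_subset_of_nonneg hsub fun s' _ _ => ?_).trans
      (hT.b₁ (f s) w₀ w v y)
    exact ev_nonneg (hr₁ _ _ _) fun _ => hL _ _ _ _ _ _
  · rw [← ev_sum]
    refine ev_le (hq₁ _) fun w => ?_
    rw [← ev_sum]
    refine ev_le (hr₁ _ _ _) fun x => ?_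
    rw [sum_ev_pull₁]
    refine ev_le (hq₂ _) fun v => ?_
    rw [sum_ev_pull₁]
    refine ev_le (hr₂ _ _ _) fun z => ?_
    rw [sum_ev_pull₂]
    refine ev_le (hc _ _) fun y => ?_
    refine (Finset.sum_le_sum_of_subset_of_nonneg hsub fun s' _ _ => ?_).trans
      (hT.b₂ (f s) w₀ w y)
    exact ev_nonneg (hr₁ _ _ _) fun _ => ev_nonneg (hq₂ _) fun _ => hL _ _ _ _ _ _
  · rw [← ev_sum]
    refine ev_le (hq₁ _) fun w => ?_
    rw [← ev_sum]
    refine ev_le (hr₁ _ _ _) fun x => ?_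
    rw [sum_ev_pull₂]
    refine ev_le (hq₂ _) fun v => ?_
    rw [sum_ev_pull₂]
    refine ev_le (hr₂ _ _ _) fun z => ?_
    rw [sum_ev_pull₂]
    refine ev_le (hc _ _) fun y => ?_
    refine (Finset.sum_le_sum_of_subset_of_nonneg hsub fun s' _ _ => ?_).trans
      (hT.b₃ (f s) w₀ v y)
    exact ev_nonneg (hq₁ _) fun _ => ev_nonneg (hr₁ _ _ _) fun _ => hL _ _ _ _ _ _
  · rw [← ev_sum]
    refine ev_le (hq₁ _) fun w => ?_
    rw [← ev_sum]
    refine ev_le (hr₁ _ _ _) fun x => ?_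
    rw [sum_ev_pull₂]
    refine ev_le (hq₂ _) fun v => ?_
    rw [sum_ev_pull₂]
    refine ev_le (hr₂ _ _ _) fun z => ?_
    rw [sum_ev_pull₃]
    refine ev_le (hc _ _) fun y => ?_
    refine (Finset.sum_le_sum_of_subset_of_nonneg hsub fun s' _ _ => ?_).trans
      (hT.b₄ (f s) w₀ y)
    exact ev_nonneg (hq₁ _) fun _ => ev_nonneg (hr₁ _ _ _) fun _ => ev_nonneg (hq₂ _) fun _ =>
      hL _ _ _ _ _ _

lemma sum_ev_diff_part_le {s : 𝒮} {t : 𝒯} (hst : f s = g t) :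
    ∑ s' with f s ≠ f s', (ev (piw fun _ : κ => q₀) fun W₀ =>
      evUser (M := M₁) f q₁ r₁ W₀ fun a V X => evUser (M := M₂) g q₂ r₂ W₀ fun _ V' X' =>
        ev (c (X s) (X' t)) fun y =>
          ∑ b, L s' (W₀ (f s')) (V (f s', a s')) (V' (f s', b)) (X s') y) ≤ M₂ * e₅ := by
  obtain ⟨hp, hq₀, hq₁, hq₂, hr₁, hr₂, hc⟩ := hsys
  have h1 : ∀ s' ∈ Finset.univ.filter (fun s' => f s ≠ f s'), (ev (piw fun _ : κ => q₀) fun W₀ =>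
      evUser (M := M₁) f q₁ r₁ W₀ fun a V X => evUser (M := M₂) g q₂ r₂ W₀ fun _ V' X' =>
        ev (c (X s) (X' t)) fun y =>
          ∑ b, L s' (W₀ (f s')) (V (f s', a s')) (V' (f s', b)) (X s') y) =
      M₂ * ev q₀ fun w₀ => ev q₀ fun w₀' => ev (q₁ w₀) fun w => ev (r₁ s w w₀) fun x =>
        ev (q₁ w₀') fun w' => ev (r₁ s' w' w₀') fun x' => ev (q₂ w₀) fun v =>
          ev (r₂ t v w₀) fun z => ev (q₂ w₀') fun v' => ev (c x z) fun y =>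
            L s' w₀' w' v' x' y := by
    intro s' hs'
    have hf := (Finset.mem_filter.1 hs').2
    rw [← ev_piw_two (μ := fun _ : κ => q₀) (fun _ => hq₀) hf, ← ev_mul_left]
    exact congrArg _ (funext fun W₀ => ev_diff_part_term hM₁ hM₂
      ⟨hp, hq₀, hq₁, hq₂, hr₁, hr₂, hc⟩ W₀ hst hf)
  rw [Finset.sum_congr rfl h1, ← Finset.mul_sum]
  refine mul_le_mul_of_nonneg_left ?_ (Nat.cast_nonneg _)
  rw [← ev_sum]
  refine ev_le hq₀ fun w₀ => ?_
  rw [sum_ev_pull₁]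
  refine ev_le (hq₁ _) fun w => ?_
  rw [sum_ev_pull₁]
  refine ev_le (hr₁ _ _ _) fun x => ?_
  rw [sum_ev_pull₃]
  refine ev_le (hq₂ _) fun v => ?_
  rw [sum_ev_pull₃]
  refine ev_le (hr₂ _ _ _) fun z => ?_
  rw [sum_ev_pull₄]
  refine ev_le (hc _ _) fun y => ?_
  refine (Finset.sum_le_sum_of_subset_of_nonneg (Finset.filter_subset _ _) fun s' _ _ => ?_).trans
    (hT.b₅ y)
  exact ev_nonneg hq₀ fun _ => ev_nonneg (hq₁ _) fun _ => ev_nonneg (hr₁ _ _ _) fun _ =>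
    ev_nonneg (hq₂ _) fun _ => hL _ _ _ _ _ _

end Decoder

/-! ### Linearity of the codebook average and extraction of a good codebook. -/

section UserLinear

variable {𝒮 κ 𝒲₀ 𝒲 𝒳 : Type*} [Fintype 𝒮] [Fintype κ] [Fintype 𝒲] [Fintype 𝒳]
  [DecidableEq 𝒮] [DecidableEq κ] {M : ℕ} {f : 𝒮 → κ} {q : 𝒲₀ → 𝒲 → ℝ}
  {r : 𝒮 → 𝒲 → 𝒲₀ → 𝒳 → ℝ}

lemma evUser_add (W₀ : κ → 𝒲₀) (F G : (𝒮 → Fin M) → (κ × Fin M → 𝒲) → (𝒮 → 𝒳) → ℝ) :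
    evUser f q r W₀ (fun a V X => F a V X + G a V X) =
      evUser f q r W₀ F + evUser f q r W₀ G := by
  simp only [evUser, ev_add]

lemma evUser_sum {ι : Type*} (W₀ : κ → 𝒲₀) (t : Finset ι)
    (F : ι → (𝒮 → Fin M) → (κ × Fin M → 𝒲) → (𝒮 → 𝒳) → ℝ) :
    evUser f q r W₀ (fun a V X => ∑ i ∈ t, F i a V X) = ∑ i ∈ t, evUser f q r W₀ (F i) := by
  simp only [evUser, ev_sum]

lemma evUser_ev {α : Type*} [Fintype α] (μ : α → ℝ) (W₀ : κ → 𝒲₀)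
    (F : α → (𝒮 → Fin M) → (κ × Fin M → 𝒲) → (𝒮 → 𝒳) → ℝ) :
    evUser f q r W₀ (fun a V X => ev μ fun x => F x a V X) =
      ev μ fun x => evUser f q r W₀ (F x) := by
  simp only [evUser]
  rw [ev_comm μ]
  refine congrArg _ (funext fun a => ?_)
  rw [ev_comm μ]
  refine congrArg _ (funext fun V => ?_)
  rw [ev_comm μ]

lemma evUser_comm {𝒮' 𝒲' 𝒳' : Type*} [Fintype 𝒮'] [Fintype 𝒲'] [Fintype 𝒳']
    [DecidableEq 𝒮'] {M' : ℕ} {f' : 𝒮' → κ} {q' : 𝒲₀ → 𝒲' → ℝ}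
    {r' : 𝒮' → 𝒲' → 𝒲₀ → 𝒳' → ℝ} (W₀ : κ → 𝒲₀)
    (F : (𝒮 → Fin M) → (κ × Fin M → 𝒲) → (𝒮 → 𝒳) →
      (𝒮' → Fin M') → (κ × Fin M' → 𝒲') → (𝒮' → 𝒳') → ℝ) :
    evUser f q r W₀ (fun a V X => evUser f' q' r' W₀ (F a V X)) =
      evUser f' q' r' W₀ fun a' V' X' => evUser f q r W₀ fun a V X => F a V X a' V' X' := by
  change evUser f q r W₀ (fun a V X => ev (piw fun _ : 𝒮' => unif M') fun a' =>
    ev (piw fun k : κ × Fin M' => q' (W₀ k.1)) fun V' =>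
      ev (piw fun s => r' s (V' (f' s, a' s)) (W₀ (f' s))) fun X' => F a V X a' V' X') = _
  simp only [evUser_ev]
  rfl

lemma exists_evUser_le (hM : 0 < M) (hq : ∀ w₀, IsProb (q w₀))
    (hr : ∀ s w w₀, IsProb (r s w w₀)) {W₀ : κ → 𝒲₀}
    {F : (𝒮 → Fin M) → (κ × Fin M → 𝒲) → (𝒮 → 𝒳) → ℝ} {c : ℝ}
    (h : evUser f q r W₀ F ≤ c) : ∃ a V X, F a V X ≤ c := by
  obtain ⟨a, ha⟩ := (IsProb.piw fun _ : 𝒮 => isProb_unif hM).exists_le h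
  obtain ⟨V, hV⟩ := (IsProb.piw fun k : κ × Fin M => hq (W₀ k.1)).exists_le ha
  obtain ⟨X, hX⟩ := (IsProb.piw fun s => hr s (V (f s, a s)) (W₀ (f s))).exists_le hV
  exact ⟨a, V, X, hX⟩

end UserLinear

/-! ### Average of the union bound over all codebooks. -/

section OneShot

variable {𝒮 𝒯 κ 𝒲₀ 𝒲₁ 𝒲₂ 𝒳₁ 𝒳₂ 𝒴 : Type*} [Fintype 𝒮] [Fintype 𝒯] [Fintype κ] [Fintype 𝒲₀]
  [Fintype 𝒲₁] [Fintype 𝒲₂] [Fintype 𝒳₁] [Fintype 𝒳₂] [Fintype 𝒴]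
  [DecidableEq 𝒮] [DecidableEq 𝒯] [DecidableEq κ] {M₁ M₂ : ℕ}
  {f : 𝒮 → κ} {g : 𝒯 → κ} {q₀ : 𝒲₀ → ℝ} {q₁ : 𝒲₀ → 𝒲₁ → ℝ} {q₂ : 𝒲₀ → 𝒲₂ → ℝ}
  {r₁ : 𝒮 → 𝒲₁ → 𝒲₀ → 𝒳₁ → ℝ} {r₂ : 𝒯 → 𝒲₂ → 𝒲₀ → 𝒳₂ → ℝ} {c : 𝒳₁ → 𝒳₂ → 𝒴 → ℝ}
  {p : 𝒮 × 𝒯 → ℝ}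

/-- Expectation under the joint law of all the variables. -/
noncomputable def evSystem (p : 𝒮 × 𝒯 → ℝ) (q₀ : 𝒲₀ → ℝ) (q₁ : 𝒲₀ → 𝒲₁ → ℝ)
    (q₂ : 𝒲₀ → 𝒲₂ → ℝ) (r₁ : 𝒮 → 𝒲₁ → 𝒲₀ → 𝒳₁ → ℝ) (r₂ : 𝒯 → 𝒲₂ → 𝒲₀ → 𝒳₂ → ℝ)
    (c : 𝒳₁ → 𝒳₂ → 𝒴 → ℝ) (F : 𝒮 → 𝒯 → 𝒲₀ → 𝒲₁ → 𝒲₂ → 𝒳₁ → 𝒳₂ → 𝒴 → ℝ) : ℝ :=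
  ev p fun st => ev q₀ fun w₀ => ev (q₁ w₀) fun w₁ => ev (r₁ st.1 w₁ w₀) fun x₁ =>
    ev (q₂ w₀) fun w₂ => ev (r₂ st.2 w₂ w₀) fun x₂ => ev (c x₁ x₂) fun y =>
      F st.1 st.2 w₀ w₁ w₂ x₁ x₂ y

/-- The union bound on the error of a decoder that looks for a source word that passes the
test `A`: the true one fails it, or a wrong one passes it. -/
noncomputable def errUnion (f : 𝒮 → κ) (g : 𝒯 → κ) (A : 𝒮 → 𝒲₀ → 𝒲₁ → 𝒲₂ → 𝒳₁ → 𝒴 → Prop)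
    (W₀ : κ → 𝒲₀) (a : 𝒮 → Fin M₁) (V : κ × Fin M₁ → 𝒲₁) (X : 𝒮 → 𝒳₁) (a' : 𝒯 → Fin M₂)
    (V' : κ × Fin M₂ → 𝒲₂) (s : 𝒮) (t : 𝒯) (y : 𝒴) : ℝ :=
  ind (¬ A s (W₀ (f s)) (V (f s, a s)) (V' (g t, a' t)) (X s) y) +
    ∑ s' with s ≠ s', ∑ b, ind (A s' (W₀ (f s')) (V (f s', a s')) (V' (f s', b)) (X s') y)

/-- The failure of the true word reduces to the joint law by `evUser_single`. Wrong words with the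
true common part are bounded for each choice of `W₀`; those with another common part only after
averaging over `W₀`, because they use the independence of two cloud centres. -/
lemma ev_errUnion_le (hM₁ : 0 < M₁) (hM₂ : 0 < M₂) (hsys : IsSystem p q₀ q₁ q₂ r₁ r₂ c)
    (hfg : ∀ s t, p (s, t) ≠ 0 → f s = g t) {A : 𝒮 → 𝒲₀ → 𝒲₁ → 𝒲₂ → 𝒳₁ → 𝒴 → Prop}
    {e₁ e₂ e₃ e₄ e₅ : ℝ}
    (hT : TestBound f q₀ q₁ q₂ r₁ (fun s w₀ w₁ w₂ x y => ind (A s w₀ w₁ w₂ x y)) e₁ e₂ e₃ e₄ e₅) :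
    (ev (piw fun _ : κ => q₀) fun W₀ => evUser (M := M₁) f q₁ r₁ W₀ fun a V X =>
      evUser (M := M₂) g q₂ r₂ W₀ fun a' V' X' => ev p fun st => ev (c (X st.1) (X' st.2)) fun y =>
        errUnion f g A W₀ a V X a' V' st.1 st.2 y) ≤
    evSystem p q₀ q₁ q₂ r₁ r₂ c (fun s _ w₀ w₁ w₂ x₁ _ y => ind (¬ A s w₀ w₁ w₂ x₁ y)) +
      ((M₁ : ℝ)⁻¹ * e₁ + (M₁ : ℝ)⁻¹ * (M₂ * e₂) + (e₃ + M₂ * e₄) + M₂ * e₅) := by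
  have hL : ∀ s w₀ w₁ w₂ x y, 0 ≤ ind (A s w₀ w₁ w₂ x y) := fun _ _ _ _ _ _ => ind_nonneg _
  simp only [evUser_ev]
  rw [ev_comm, evSystem]
  rw [← ev_const hsys.hp ((M₁ : ℝ)⁻¹ * e₁ + (M₁ : ℝ)⁻¹ * (M₂ * e₂) + (e₃ + M₂ * e₄) + M₂ * e₅),
    ← ev_add]
  refine ev_mono_supp hsys.hp fun ⟨s, t⟩ hst => ?_
  have hk := hfg s t hst
  simp only [errUnion, ev_add, evUser_add]
  refine add_le_add (le_of_eq ?_) ?_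
  · have h1 : ∀ (W₀ : κ → 𝒲₀) (w₁ : 𝒲₁) (x₁ : 𝒳₁),
        (evUser (M := M₂) g q₂ r₂ W₀ fun a' V' X' => ev (c x₁ (X' t)) fun y =>
          ind (¬ A s (W₀ (f s)) w₁ (V' (g t, a' t)) x₁ y)) =
        ev (q₂ (W₀ (f s))) fun w₂ => ev (r₂ t w₂ (W₀ (f s))) fun x₂ => ev (c x₁ x₂) fun y =>
          ind (¬ A s (W₀ (f s)) w₁ w₂ x₁ y) := by
      intro W₀ w₁ x₁
      rw [evUser_single hM₂ hsys.hq₂ hsys.hr₂ W₀ t fun w₂ x₂ => ev (c x₁ x₂) fun y =>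
          ind (¬ A s (W₀ (f s)) w₁ w₂ x₁ y), hk]
    simp only [h1]
    have h2 := fun W₀ : κ → 𝒲₀ => evUser_single (M := M₁) (f := f) hM₁ hsys.hq₁ hsys.hr₁ W₀ s
      fun w₁ x₁ => ev (q₂ (W₀ (f s))) fun w₂ => ev (r₂ t w₂ (W₀ (f s))) fun x₂ =>
        ev (c x₁ x₂) fun y => ind (¬ A s (W₀ (f s)) w₁ w₂ x₁ y)
    simp only [h2]
    exact ev_piw_one (μ := fun _ : κ => q₀) (fun _ => hsys.hq₀) (f s) fun w₀ =>
      ev (q₁ w₀) fun w₁ => ev (r₁ s w₁ w₀) fun x₁ => ev (q₂ w₀) fun w₂ =>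
        ev (r₂ t w₂ w₀) fun x₂ => ev (c x₁ x₂) fun y => ind (¬ A s w₀ w₁ w₂ x₁ y)
  · have hsplit : ∀ F : 𝒮 → ℝ, ∑ s' with s ≠ s', F s' =
        ∑ s' with s ≠ s' ∧ f s' = f s, F s' + ∑ s' with f s ≠ f s', F s' := by
      intro F
      rw [← Finset.sum_filter_add_sum_filter_not _ (fun s' => f s' = f s), Finset.filter_filter,
        Finset.filter_filter]
      congr 2
      ext s'
      simp only [Finset.mem_filter, Finset.mem_univ, true_and]
      exact ⟨fun h h' => h.2 h'.symm, fun h => ⟨fun h' => h (h' ▸ rfl), fun h' => h h'.symm⟩⟩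
    have h5 := sum_ev_diff_part_le (p := p) hM₁ hM₂ hsys hL hT hk
    rw [← ev_sum] at h5
    simp only [hsplit, ev_add, evUser_add]
    refine add_le_add (ev_le (IsProb.piw fun _ : κ => hsys.hq₀) fun W₀ => ?_) ?_
    · refine le_trans (le_of_eq ?_) (sum_ev_same_part_le hM₁ hM₂ hsys hL hT W₀ hk)
      simp only [ev_sum, evUser_sum]
    · refine le_trans (le_of_eq ?_) h5
      simp only [ev_sum, evUser_sum]

end OneShot

/-! ### Decoders and derandomisation. -/

section Code

variable {𝒮 𝒯 κ 𝒲₀ 𝒲₁ 𝒲₂ 𝒳₁ 𝒳₂ 𝒴₁ 𝒴₂ : Type*} [Fintype 𝒮] [Fintype 𝒯] [Fintype κ]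
  [Fintype 𝒲₀] [Fintype 𝒲₁] [Fintype 𝒲₂] [Fintype 𝒳₁] [Fintype 𝒳₂] [Fintype 𝒴₁] [Fintype 𝒴₂]
  [DecidableEq 𝒮] [DecidableEq 𝒯] [DecidableEq κ] {M₁ M₂ : ℕ}
  {f : 𝒮 → κ} {g : 𝒯 → κ} {q₀ : 𝒲₀ → ℝ} {q₁ : 𝒲₀ → 𝒲₁ → ℝ} {q₂ : 𝒲₀ → 𝒲₂ → ℝ}
  {r₁ : 𝒮 → 𝒲₁ → 𝒲₀ → 𝒳₁ → ℝ} {r₂ : 𝒯 → 𝒲₂ → 𝒲₀ → 𝒳₂ → ℝ} {c : 𝒳₁ → 𝒳₂ → 𝒴₁ × 𝒴₂ → ℝ}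
  {p : 𝒮 × 𝒯 → ℝ}

omit [Fintype κ] [Fintype 𝒯] [DecidableEq 𝒯] [DecidableEq κ] [Fintype 𝒲₀] [Fintype 𝒲₁]
  [Fintype 𝒲₂] [Fintype 𝒳₁] in
-- The decoder returns any word that passes with some cell of the other user. If the true word
-- passes with the actual cell, the search succeeds, so an error exhibits a wrong word that passes,
-- and this one is counted in the union bound.
lemma exists_decoder [Nonempty 𝒮] {𝒴 : Type*} (f : 𝒮 → κ) (g : 𝒯 → κ)
    (A : 𝒮 → 𝒲₀ → 𝒲₁ → 𝒲₂ → 𝒳₁ → 𝒴 → Prop)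
    (W₀ : κ → 𝒲₀) (a : 𝒮 → Fin M₁) (V : κ × Fin M₁ → 𝒲₁) (X : 𝒮 → 𝒳₁) (a' : 𝒯 → Fin M₂)
    (V' : κ × Fin M₂ → 𝒲₂) : ∃ φ : 𝒴 → 𝒮, ∀ s t y, f s = g t →
      ind (φ y ≠ s) ≤ errUnion f g A W₀ a V X a' V' s t y := by
  let good : 𝒴 → 𝒮 → Prop := fun y s =>
    ∃ b, A s (W₀ (f s)) (V (f s, a s)) (V' (f s, b)) (X s) y
  have hφ : ∀ y, ∃ s, (∃ s', good y s') → good y s := by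
    intro y
    by_cases h : ∃ s', good y s'
    · exact ⟨h.choose, fun _ => h.choose_spec⟩
    · exact ⟨Classical.arbitrary 𝒮, fun h' => absurd h' h⟩
  choose φ hφ using hφ
  refine ⟨φ, fun s t y hst => ?_⟩
  have hwrong : 0 ≤ ∑ s' with s ≠ s', ∑ b,
      ind (A s' (W₀ (f s')) (V (f s', a s')) (V' (f s', b)) (X s') y) :=
    Finset.sum_nonneg fun _ _ => Finset.sum_nonneg fun _ _ => ind_nonneg _
  unfold errUnion
  by_cases htrue : A s (W₀ (f s)) (V (f s, a s)) (V' (g t, a' t)) (X s) y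
  · by_cases hs : φ y = s
    · rw [ind_of_not (not_not.2 hs)]
      exact add_nonneg (ind_nonneg _) hwrong
    · obtain ⟨b, hb⟩ := hφ y ⟨s, a' t, by rwa [← hst] at htrue⟩
      refine (ind_le_one _).trans (le_add_of_nonneg_of_le (ind_nonneg _) ?_)
      rw [← ind_of hb]
      refine le_trans ?_ (Finset.single_le_sum (f := fun s' => ∑ b,
        ind (A s' (W₀ (f s')) (V (f s', a s')) (V' (f s', b)) (X s') y))
        (fun _ _ => Finset.sum_nonneg fun _ _ => ind_nonneg _)
        (Finset.mem_filter.2 ⟨Finset.mem_univ (φ y), Ne.symm hs⟩))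
      exact Finset.single_le_sum (f := fun b =>
        ind (A (φ y) (W₀ (f (φ y))) (V (f (φ y), a (φ y))) (V' (f (φ y), b)) (X (φ y)) y))
        (fun _ _ => ind_nonneg _) (Finset.mem_univ b)
  · rw [ind_of htrue]
    exact (ind_le_one _).trans (le_add_of_nonneg_right hwrong)

/-- One-shot achievability by random coding. -/
theorem exists_oneShot_code [Nonempty 𝒮] [Nonempty 𝒯] (hM₁ : 0 < M₁) (hM₂ : 0 < M₂)
    (hsys : IsSystem p q₀ q₁ q₂ r₁ r₂ c) (hfg : ∀ s t, p (s, t) ≠ 0 → f s = g t)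
    {A₁ : 𝒮 → 𝒲₀ → 𝒲₁ → 𝒲₂ → 𝒳₁ → 𝒴₁ → Prop} {A₂ : 𝒯 → 𝒲₀ → 𝒲₂ → 𝒲₁ → 𝒳₂ → 𝒴₂ → Prop}
    {e₁ e₂ e₃ e₄ e₅ e₁' e₂' e₃' e₄' e₅' : ℝ}
    (hT₁ : TestBound f q₀ q₁ q₂ r₁ (fun s w₀ w₁ w₂ x y => ind (A₁ s w₀ w₁ w₂ x y))
      e₁ e₂ e₃ e₄ e₅)
    (hT₂ : TestBound g q₀ q₂ q₁ r₂ (fun s w₀ w₁ w₂ x y => ind (A₂ s w₀ w₁ w₂ x y))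
      e₁' e₂' e₃' e₄' e₅') :
    ∃ (f₁ : 𝒮 → 𝒳₁) (f₂ : 𝒯 → 𝒳₂) (φ₁ : 𝒴₁ → 𝒮) (φ₂ : 𝒴₂ → 𝒯),
      (ev p fun st => ev (c (f₁ st.1) (f₂ st.2)) fun y =>
        ind (φ₁ y.1 ≠ st.1) + ind (φ₂ y.2 ≠ st.2)) ≤
      evSystem p q₀ q₁ q₂ r₁ r₂ c (fun s _ w₀ w₁ w₂ x₁ _ y => ind (¬ A₁ s w₀ w₁ w₂ x₁ y.1)) +
        ((M₁ : ℝ)⁻¹ * e₁ + (M₁ : ℝ)⁻¹ * (M₂ * e₂) + (e₃ + M₂ * e₄) + M₂ * e₅) +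
      (evSystem p q₀ q₁ q₂ r₁ r₂ c (fun _ t w₀ w₁ w₂ _ x₂ y => ind (¬ A₂ t w₀ w₂ w₁ x₂ y.2)) +
        ((M₂ : ℝ)⁻¹ * e₁' + (M₂ : ℝ)⁻¹ * (M₁ * e₂') + (e₃' + M₁ * e₄') + M₁ * e₅')) := by
  -- The second decoder is treated as the first one in the system with the users exchanged.
  have hswap : ∀ F : 𝒯 × 𝒮 → ℝ, ev (fun ts : 𝒯 × 𝒮 => p ts.swap) F = ev p fun st => F st.swap :=
    fun F => Fintype.sum_equiv (Equiv.prodComm _ _) _ _ fun _ => rfl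
  have hsys' : IsSystem (fun ts : 𝒯 × 𝒮 => p ts.swap) q₀ q₂ q₁ r₂ r₁ (fun x₂ x₁ => c x₁ x₂) :=
    { hp := ⟨fun _ => hsys.hp.nonneg _, by
        have := hswap fun _ => 1
        simp only [ev, mul_one] at this
        rw [this, hsys.hp.sum_one]⟩
      hq₀ := hsys.hq₀, hq₁ := hsys.hq₂, hq₂ := hsys.hq₁, hr₁ := hsys.hr₂, hr₂ := hsys.hr₁
      hc := fun _ _ => hsys.hc _ _ }
  have hb₁ := ev_errUnion_le (f := f) (g := g) (A := fun s w₀ w₁ w₂ x (y : 𝒴₁ × 𝒴₂) =>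
    A₁ s w₀ w₁ w₂ x y.1) hM₁ hM₂ hsys hfg (e₁ := e₁) (e₂ := e₂) (e₃ := e₃) (e₄ := e₄) (e₅ := e₅)
    ⟨fun _ _ _ _ _ => hT₁.b₁ _ _ _ _ _, fun _ _ _ _ => hT₁.b₂ _ _ _ _,
      fun _ _ _ _ => hT₁.b₃ _ _ _ _, fun _ _ _ => hT₁.b₄ _ _ _, fun _ => hT₁.b₅ _⟩
  have hb₂ := ev_errUnion_le (f := g) (g := f) (A := fun s w₀ w₁ w₂ x (y : 𝒴₁ × 𝒴₂) =>
    A₂ s w₀ w₁ w₂ x y.2) hM₂ hM₁ hsys' (fun t s h => (hfg s t h).symm)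
    (e₁ := e₁') (e₂ := e₂') (e₃ := e₃') (e₄ := e₄') (e₅ := e₅')
    ⟨fun _ _ _ _ _ => hT₂.b₁ _ _ _ _ _, fun _ _ _ _ => hT₂.b₂ _ _ _ _,
      fun _ _ _ _ => hT₂.b₃ _ _ _ _, fun _ _ _ => hT₂.b₄ _ _ _, fun _ => hT₂.b₅ _⟩
  -- The exchanged system averages over user 2 before user 1; reordering returns to the original
  -- joint law.
  have hbad : evSystem (fun ts : 𝒯 × 𝒮 => p ts.swap) q₀ q₂ q₁ r₂ r₁ (fun x₂ x₁ => c x₁ x₂)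
      (fun s _ w₀ w₁ w₂ x₁ _ y => ind (¬ A₂ s w₀ w₁ w₂ x₁ y.2)) =
      evSystem p q₀ q₁ q₂ r₁ r₂ c (fun _ t w₀ w₁ w₂ _ x₂ y => ind (¬ A₂ t w₀ w₂ w₁ x₂ y.2)) := by
    simp only [evSystem, hswap, Prod.fst_swap, Prod.snd_swap]
    refine congrArg _ (funext fun st => congrArg _ (funext fun w₀ => ?_))
    have h1 : ∀ (w₂ : 𝒲₂) (F : 𝒲₁ → 𝒳₁ → 𝒳₂ → ℝ),
        (ev (r₂ st.2 w₂ w₀) fun x₂ => ev (q₁ w₀) fun w₁ => ev (r₁ st.1 w₁ w₀) fun x₁ => F w₁ x₁ x₂) =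
        ev (q₁ w₀) fun w₁ => ev (r₁ st.1 w₁ w₀) fun x₁ => ev (r₂ st.2 w₂ w₀) fun x₂ =>
          F w₁ x₁ x₂ := by
      intro w₂ F
      rw [ev_comm]
      exact congrArg _ (funext fun w₁ => ev_comm _ _ _)
    simp only [h1]
    rw [ev_comm]
    exact congrArg _ (funext fun w₁ => ev_comm _ _ _)
  rw [hbad] at hb₂
  -- The bounds are added before any codebook is fixed, so that a single choice serves both
  -- decoders.
  have hsum := add_le_add hb₁ hb₂
  simp only [hswap] at hsum
  rw [← ev_add] at hsum
  obtain ⟨W₀, h⟩ := (IsProb.piw fun _ : κ => hsys.hq₀).exists_le hsum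
  rw [evUser_comm (f := g), ← evUser_add] at h
  obtain ⟨a, V, X, h⟩ := exists_evUser_le hM₁ hsys.hq₁ hsys.hr₁ h
  rw [← evUser_add] at h
  obtain ⟨a', V', X', h⟩ := exists_evUser_le hM₂ hsys.hq₂ hsys.hr₂ h
  obtain ⟨φ₁, hφ₁⟩ := exists_decoder f g A₁ W₀ a V X a' V'
  obtain ⟨φ₂, hφ₂⟩ := exists_decoder g f A₂ W₀ a' V' X' a V
  refine ⟨X, X', φ₁, φ₂, le_trans ?_ h⟩
  rw [← ev_add]
  refine ev_mono_supp hsys.hp fun ⟨s, t⟩ hst => ?_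
  have hk := hfg s t hst
  simp only [Prod.swap_prod_mk]
  rw [← ev_add]
  exact ev_mono (hsys.hc _ _) fun y => add_le_add (hφ₁ s t y.1 hk) (hφ₂ t s y.2 hk.symm)

end Code

/-! ### Pairs of sequences versus sequences of pairs. -/

section Joint

variable {α β ι : Type*} [Fintype α] [Fintype β] [Fintype ι] [DecidableEq ι]

/-- The joint law of a variable and the output of a kernel. -/
noncomputable def joint (μ : α → ℝ) (ν : α → β → ℝ) : α × β → ℝ := fun z => μ z.1 * ν z.1 z.2

/-- The law of independent pairs, as a law of pairs of sequences. -/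
noncomputable def pairw (μ : ι → α × β → ℝ) : (ι → α) × (ι → β) → ℝ :=
  fun z => ∏ i, μ i (z.1 i, z.2 i)

omit [DecidableEq ι] [Fintype ι] in
lemma ev_joint (μ : α → ℝ) (ν : α → β → ℝ) (F : α → β → ℝ) :
    ev (joint μ ν) (fun z => F z.1 z.2) = ev μ fun a => ev (ν a) fun b => F a b := by
  simp only [ev, joint, Fintype.sum_prod_type, Finset.mul_sum, mul_assoc]

omit [DecidableEq ι] [Fintype ι] in
lemma IsProb.joint {μ : α → ℝ} {ν : α → β → ℝ} (hμ : IsProb μ) (hν : ∀ a, IsProb (ν a)) :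
    IsProb (joint μ ν) where
  nonneg z := mul_nonneg (hμ.nonneg _) ((hν _).nonneg _)
  sum_one := by
    have h := ev_joint μ ν fun _ _ => 1
    simp only [ev_const (hν _), ev_const hμ] at h
    simpa [ev] using h

lemma ev_pairw (μ : ι → α × β → ℝ) (F : (ι → α) × (ι → β) → ℝ) :
    ev (pairw μ) F = ev (piw μ) fun z => F (fun i => (z i).1, fun i => (z i).2) :=
  Fintype.sum_equiv (Equiv.arrowProdEquivProdArrow ι (fun _ => α) (fun _ => β)).symm _ _ fun _ => rfl

lemma IsProb.pairw {μ : ι → α × β → ℝ} (hμ : ∀ i, IsProb (μ i)) : IsProb (pairw μ) where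
  nonneg z := Finset.prod_nonneg fun i _ => (hμ i).nonneg _
  sum_one := by
    have h := ev_pairw μ fun _ => 1
    rw [ev_const (.piw hμ)] at h
    simpa [ev] using h

lemma ev_piw_ev_piw (μ : ι → α → ℝ) (ν : ι → α → β → ℝ) (F : (ι → α) → (ι → β) → ℝ) :
    (ev (piw μ) fun a => ev (piw fun i => ν i (a i)) fun b => F a b) =
      ev (piw fun i => joint (μ i) (ν i)) fun z => F (fun i => (z i).1) (fun i => (z i).2) := by
  rw [← ev_pairw _ fun z => F z.1 z.2]
  simp only [ev, Fintype.sum_prod_type, Finset.mul_sum, pairw, joint, piw, Finset.prod_mul_distrib,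
    mul_assoc]

end Joint

/-! ### A quantitative weak law of large numbers. -/

section Chebyshev

variable {Z : Type*} [Fintype Z] {Q : Z → ℝ}

/-- The cross terms vanish by independence and centring. -/
lemma ev_sum_sq_eq (hQ : IsProb Q) {φ : Z → ℝ} (h0 : ev Q φ = 0) (n : ℕ) :
    ev (piw fun _ : Fin n => Q) (fun z => (∑ i, φ (z i)) ^ 2) = n * ev Q fun x => φ x ^ 2 := by
  have h : ∀ i j : Fin n, ev (piw fun _ : Fin n => Q) (fun z => φ (z i) * φ (z j)) =
      if i = j then ev Q fun x => φ x ^ 2 else 0 := by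
    intro i j
    split_ifs with hij
    · subst hij
      rw [← ev_piw_one (μ := fun _ : Fin n => Q) (fun _ => hQ) i]
      simp only [pow_two]
    · rw [ev_piw_two (μ := fun _ : Fin n => Q) (fun _ => hQ) hij fun x y => φ x * φ y]
      simp only [ev_mul_left, h0, mul_zero]
      exact ev_const hQ 0
  simp only [pow_two (∑ i, _), Finset.sum_mul_sum, ev_sum, h]
  simp

lemma ev_chebyshev (hQ : IsProb Q) (φ : Z → ℝ) {δ : ℝ} (hδ : 0 < δ) {n : ℕ} (hn : 0 < n) :
    ev (piw fun _ : Fin n => Q) (fun z => ind (∑ i, φ (z i) < n * (ev Q φ - δ))) ≤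
      (ev Q fun x => (φ x - ev Q φ) ^ 2) / δ ^ 2 / n := by
  set m := ev Q φ with hm
  have hn' : (0 : ℝ) < n := by exact_mod_cast hn
  have h0 : ev Q (fun x => φ x - m) = 0 := by
    simp only [sub_eq_add_neg, ev_add, ev_const hQ, ← hm, add_neg_cancel]
  -- Markov's inequality for the square: below the threshold, the centred sum divided by `n * δ` is
  -- at most `-1`.
  have h1 : ∀ z : Fin n → Z, ind (∑ i, φ (z i) < n * (m - δ)) ≤
      (n * δ)⁻¹ ^ 2 * (∑ i, (φ (z i) - m)) ^ 2 := by
    intro z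
    by_cases h : ∑ i, φ (z i) < n * (m - δ)
    · rw [ind_of h, ← mul_pow]
      have h2 : ∑ i, (φ (z i) - m) ≤ -(n * δ) := by
        simp only [Finset.sum_sub_distrib, Finset.sum_const, Finset.card_univ, Fintype.card_fin,
          nsmul_eq_mul]
        linarith
      have h3 : (n * δ)⁻¹ * ∑ i, (φ (z i) - m) ≤ -1 := by
        calc _ ≤ (n * δ)⁻¹ * -(n * δ) := mul_le_mul_of_nonneg_left h2 (by positivity)
          _ = -1 := by field_simp
      nlinarith
    · rw [ind_of_not h]; positivity
  refine (ev_mono (.piw fun _ => hQ) h1).trans (le_of_eq ?_)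
  rw [ev_mul_left, ev_sum_sq_eq hQ h0]
  field_simp

/-- The probability that a product of densities is much smaller than typical vanishes. -/
lemma ev_density_le (hQ : IsProb Q) {ρ : Z → ℝ} (hρ : ∀ z, Q z ≠ 0 → 0 < ρ z) {δ : ℝ}
    (hδ : 0 < δ) {n : ℕ} (hn : 0 < n) :
    ev (piw fun _ : Fin n => Q) (fun z =>
      ind (¬ Real.exp (n * ((ev Q fun x => Real.log (ρ x)) - δ)) ≤ ∏ i, ρ (z i))) ≤
      (ev Q fun x => (Real.log (ρ x) - ev Q fun x => Real.log (ρ x)) ^ 2) / δ ^ 2 / n := by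
  refine le_trans (ev_mono_supp (.piw fun _ => hQ) fun z hz => ind_mono fun h => ?_)
    (ev_chebyshev hQ (fun x => Real.log (ρ x)) hδ hn)
  -- On the support all factors are positive, so the event on the product is an event on the sum of
  -- logarithms.
  have hpos : ∀ i, 0 < ρ (z i) := fun i => hρ _ fun h0 => hz (Finset.prod_eq_zero (Finset.mem_univ i) h0)
  rw [← Real.log_prod fun i _ => (hpos i).ne',
    Real.log_lt_iff_lt_exp (Finset.prod_pos fun i _ => hpos i)]
  exact not_le.1 h

end Chebyshev

/-! ### The density test on blocks. -/

section Block

variable {𝒮 𝒯 κ 𝒲₀ 𝒲₁ 𝒲₂ 𝒳₁ 𝒳₂ 𝒴 : Type*} [Fintype 𝒮] [Fintype 𝒯] [Fintype κ] [Fintype 𝒲₀]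
  [Fintype 𝒲₁] [Fintype 𝒲₂] [Fintype 𝒳₁] [Fintype 𝒳₂] [Fintype 𝒴]
  [DecidableEq 𝒮] [DecidableEq 𝒯] [DecidableEq κ] {n : ℕ}
  {f : 𝒮 → κ} {q₀ : 𝒲₀ → ℝ} {q₁ : 𝒲₀ → 𝒲₁ → ℝ} {q₂ : 𝒲₀ → 𝒲₂ → ℝ}
  {r₁ : 𝒮 → 𝒲₁ → 𝒲₀ → 𝒳₁ → ℝ}

/-- The densities `ρ` are subnormalised, for each of the five ways in which a wrong source word may
share codewords with the true one. -/
structure IsDensityFamily (f : 𝒮 → κ) (q₀ : 𝒲₀ → ℝ) (q₁ : 𝒲₀ → 𝒲₁ → ℝ) (q₂ : 𝒲₀ → 𝒲₂ → ℝ)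
    (r₁ : 𝒮 → 𝒲₁ → 𝒲₀ → 𝒳₁ → ℝ) (ρ : Fin 5 → 𝒮 → 𝒲₀ → 𝒲₁ → 𝒲₂ → 𝒳₁ → 𝒴 → ℝ) : Prop where
  nonneg : ∀ j s w₀ w₁ w₂ x y, 0 ≤ ρ j s w₀ w₁ w₂ x y
  b₁ : ∀ k w₀ w₁ w₂ y, ∑ s with f s = k, ev (r₁ s w₁ w₀) (fun x => ρ 0 s w₀ w₁ w₂ x y) ≤ 1
  b₂ : ∀ k w₀ w₁ y, ∑ s with f s = k, ev (r₁ s w₁ w₀) (fun x => ev (q₂ w₀) fun w₂ =>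
    ρ 1 s w₀ w₁ w₂ x y) ≤ 1
  b₃ : ∀ k w₀ w₂ y, ∑ s with f s = k, ev (q₁ w₀) (fun w₁ => ev (r₁ s w₁ w₀) fun x =>
    ρ 2 s w₀ w₁ w₂ x y) ≤ 1
  b₄ : ∀ k w₀ y, ∑ s with f s = k, ev (q₁ w₀) (fun w₁ => ev (r₁ s w₁ w₀) fun x =>
    ev (q₂ w₀) fun w₂ => ρ 3 s w₀ w₁ w₂ x y) ≤ 1
  b₅ : ∀ y, ∑ s, ev q₀ (fun w₀ => ev (q₁ w₀) fun w₁ => ev (r₁ s w₁ w₀) fun x =>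
    ev (q₂ w₀) fun w₂ => ρ 4 s w₀ w₁ w₂ x y) ≤ 1

/-- All the empirical densities are at least their typical values. -/
def densityTest (ρ : Fin 5 → 𝒮 → 𝒲₀ → 𝒲₁ → 𝒲₂ → 𝒳₁ → 𝒴 → ℝ) (D : Fin 5 → ℝ) (δ : ℝ)
    (s : Fin n → 𝒮) (w₀ : Fin n → 𝒲₀) (w₁ : Fin n → 𝒲₁) (w₂ : Fin n → 𝒲₂) (x : Fin n → 𝒳₁)
    (y : Fin n → 𝒴) : Prop :=
  ∀ j, Real.exp (n * (D j - δ)) ≤ ∏ i, ρ j (s i) (w₀ i) (w₁ i) (w₂ i) (x i) (y i)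

omit [Fintype κ] [DecidableEq 𝒮] in
lemma sum_fiber_prod (k : Fin n → κ) (h : Fin n → 𝒮 → ℝ) :
    ∑ s : Fin n → 𝒮 with (fun i => f (s i)) = k, ∏ i, h i (s i) =
      ∏ i, ∑ s with f s = k i, h i s := by
  rw [Finset.prod_univ_sum]
  congr 1
  ext s
  simp [Fintype.mem_piFinset, funext_iff]

omit [Fintype κ] [Fintype 𝒴] [DecidableEq 𝒮] in
-- A change of measure: passing the test makes the `j`-th product at least `exp (n (D j - δ))`, so
-- the indicator is dominated by the product over this threshold, with `j` chosen to match the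
-- sharing pattern. Averages and sums of the product factorise over letters, and each factor is at
-- most one by `IsDensityFamily`.
lemma testBound_densityTest (hq₀ : IsProb q₀) (hq₁ : ∀ w₀, IsProb (q₁ w₀))
    (hq₂ : ∀ w₀, IsProb (q₂ w₀)) (hr₁ : ∀ s w w₀, IsProb (r₁ s w w₀))
    {ρ : Fin 5 → 𝒮 → 𝒲₀ → 𝒲₁ → 𝒲₂ → 𝒳₁ → 𝒴 → ℝ}
    (hρ : IsDensityFamily f q₀ q₁ q₂ r₁ ρ) (D : Fin 5 → ℝ) (δ : ℝ) :
    TestBound (fun (s : Fin n → 𝒮) i => f (s i)) (piw fun _ => q₀) (fun w₀ => piw fun i => q₁ (w₀ i))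
      (fun w₀ => piw fun i => q₂ (w₀ i)) (fun s w w₀ => piw fun i => r₁ (s i) (w i) (w₀ i))
      (fun s w₀ w₁ w₂ x y => ind (densityTest ρ D δ s w₀ w₁ w₂ x y))
      (Real.exp (-(n * (D 0 - δ)))) (Real.exp (-(n * (D 1 - δ)))) (Real.exp (-(n * (D 2 - δ))))
      (Real.exp (-(n * (D 3 - δ)))) (Real.exp (-(n * (D 4 - δ)))) := by
  have hind : ∀ (j : Fin 5) (s : Fin n → 𝒮) (w₀ : Fin n → 𝒲₀) (w₁ : Fin n → 𝒲₁)
      (w₂ : Fin n → 𝒲₂) (x : Fin n → 𝒳₁) (y : Fin n → 𝒴),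
      ind (densityTest ρ D δ s w₀ w₁ w₂ x y) ≤ Real.exp (-(n * (D j - δ))) *
        ∏ i, ρ j (s i) (w₀ i) (w₁ i) (w₂ i) (x i) (y i) := by
    intro j s w₀ w₁ w₂ x y
    by_cases h : densityTest ρ D δ s w₀ w₁ w₂ x y
    · rw [ind_of h, Real.exp_neg, ← div_eq_inv_mul, one_le_div (Real.exp_pos _)]
      exact h j
    · rw [ind_of_not h]
      exact mul_nonneg (Real.exp_pos _).le (Finset.prod_nonneg fun _ _ => hρ.nonneg _ _ _ _ _ _ _)
  have hexp : ∀ {x c : ℝ}, c ≤ 1 → Real.exp x * c ≤ Real.exp x := fun h =>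
    mul_le_of_le_one_right (Real.exp_pos _).le h
  have hle : ∀ {h : Fin n → ℝ}, (∀ i, 0 ≤ h i) → (∀ i, h i ≤ 1) → ∏ i, h i ≤ 1 := fun h0 h1 =>
    Finset.prod_le_one (fun i _ => h0 i) fun i _ => h1 i
  have hx : ∀ j (s : Fin n → 𝒮) (w₀ : Fin n → 𝒲₀) (w₁ : Fin n → 𝒲₁) (w₂ : Fin n → 𝒲₂)
      (y : Fin n → 𝒴), ev (piw fun i => r₁ (s i) (w₁ i) (w₀ i))
        (fun x => ∏ i, ρ j (s i) (w₀ i) (w₁ i) (w₂ i) (x i) (y i)) =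
      ∏ i, ev (r₁ (s i) (w₁ i) (w₀ i)) fun x => ρ j (s i) (w₀ i) (w₁ i) (w₂ i) x (y i) :=
    fun j s w₀ w₁ w₂ y => ev_piw_prod _ fun i x => ρ j (s i) (w₀ i) (w₁ i) (w₂ i) x (y i)
  have hxw : ∀ j (s : Fin n → 𝒮) (w₀ : Fin n → 𝒲₀) (w₁ : Fin n → 𝒲₁) (y : Fin n → 𝒴),
      (ev (piw fun i => r₁ (s i) (w₁ i) (w₀ i)) fun x => ev (piw fun i => q₂ (w₀ i)) fun w₂ =>
        ∏ i, ρ j (s i) (w₀ i) (w₁ i) (w₂ i) (x i) (y i)) =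
      ∏ i, ev (r₁ (s i) (w₁ i) (w₀ i)) fun x => ev (q₂ (w₀ i)) fun w₂ =>
        ρ j (s i) (w₀ i) (w₁ i) w₂ x (y i) := by
    intro j s w₀ w₁ y
    rw [← ev_piw_prod _ fun i x => ev (q₂ (w₀ i)) fun w₂ => ρ j (s i) (w₀ i) (w₁ i) w₂ x (y i)]
    exact congrArg _ (funext fun x =>
      ev_piw_prod _ fun i w₂ => ρ j (s i) (w₀ i) (w₁ i) w₂ (x i) (y i))
  have hwx : ∀ j (s : Fin n → 𝒮) (w₀ : Fin n → 𝒲₀) (w₂ : Fin n → 𝒲₂) (y : Fin n → 𝒴),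
      (ev (piw fun i => q₁ (w₀ i)) fun w₁ => ev (piw fun i => r₁ (s i) (w₁ i) (w₀ i)) fun x =>
        ∏ i, ρ j (s i) (w₀ i) (w₁ i) (w₂ i) (x i) (y i)) =
      ∏ i, ev (q₁ (w₀ i)) fun w₁ => ev (r₁ (s i) w₁ (w₀ i)) fun x =>
        ρ j (s i) (w₀ i) w₁ (w₂ i) x (y i) := by
    intro j s w₀ w₂ y
    simp only [hx]
    exact ev_piw_prod _ fun i w₁ => ev (r₁ (s i) w₁ (w₀ i)) fun x =>
      ρ j (s i) (w₀ i) w₁ (w₂ i) x (y i)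
  have hwxw : ∀ j (s : Fin n → 𝒮) (w₀ : Fin n → 𝒲₀) (y : Fin n → 𝒴),
      (ev (piw fun i => q₁ (w₀ i)) fun w₁ => ev (piw fun i => r₁ (s i) (w₁ i) (w₀ i)) fun x =>
        ev (piw fun i => q₂ (w₀ i)) fun w₂ => ∏ i, ρ j (s i) (w₀ i) (w₁ i) (w₂ i) (x i) (y i)) =
      ∏ i, ev (q₁ (w₀ i)) fun w₁ => ev (r₁ (s i) w₁ (w₀ i)) fun x => ev (q₂ (w₀ i)) fun w₂ =>
        ρ j (s i) (w₀ i) w₁ w₂ x (y i) := by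
    intro j s w₀ y
    simp only [hxw]
    exact ev_piw_prod _ fun i w₁ => ev (r₁ (s i) w₁ (w₀ i)) fun x => ev (q₂ (w₀ i)) fun w₂ =>
      ρ j (s i) (w₀ i) w₁ w₂ x (y i)
  have hall : ∀ j (s : Fin n → 𝒮) (y : Fin n → 𝒴),
      (ev (piw fun _ => q₀) fun w₀ => ev (piw fun i => q₁ (w₀ i)) fun w₁ =>
        ev (piw fun i => r₁ (s i) (w₁ i) (w₀ i)) fun x => ev (piw fun i => q₂ (w₀ i)) fun w₂ =>
          ∏ i, ρ j (s i) (w₀ i) (w₁ i) (w₂ i) (x i) (y i)) =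
      ∏ i, ev q₀ fun w₀ => ev (q₁ w₀) fun w₁ => ev (r₁ (s i) w₁ w₀) fun x => ev (q₂ w₀) fun w₂ =>
        ρ j (s i) w₀ w₁ w₂ x (y i) := by
    intro j s y
    simp only [hwxw]
    exact ev_piw_prod _ fun i w₀ => ev (q₁ w₀) fun w₁ => ev (r₁ (s i) w₁ w₀) fun x =>
      ev (q₂ w₀) fun w₂ => ρ j (s i) w₀ w₁ w₂ x (y i)
  refine ⟨fun k w₀ w₁ w₂ y => ?_, fun k w₀ w₁ y => ?_, fun k w₀ w₂ y => ?_, fun k w₀ y => ?_,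
    fun y => ?_⟩
  · refine (Finset.sum_le_sum fun s _ => ev_mono (.piw fun _ => hr₁ _ _ _) fun x =>
      hind 0 s w₀ w₁ w₂ x y).trans ?_
    simp only [ev_mul_left, ← Finset.mul_sum, hx]
    rw [sum_fiber_prod k fun i s => ev (r₁ s (w₁ i) (w₀ i)) fun x =>
      ρ 0 s (w₀ i) (w₁ i) (w₂ i) x (y i)]
    exact hexp (hle (fun i => Finset.sum_nonneg fun s _ => ev_nonneg (hr₁ _ _ _) fun _ =>
      hρ.nonneg _ _ _ _ _ _ _) fun i => hρ.b₁ _ _ _ _ _)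
  · refine (Finset.sum_le_sum fun s _ => ev_mono (.piw fun _ => hr₁ _ _ _) fun x =>
      ev_mono (.piw fun _ => hq₂ _) fun w₂ => hind 1 s w₀ w₁ w₂ x y).trans ?_
    simp only [ev_mul_left, ← Finset.mul_sum, hxw]
    rw [sum_fiber_prod k fun i s => ev (r₁ s (w₁ i) (w₀ i)) fun x => ev (q₂ (w₀ i)) fun w₂ =>
      ρ 1 s (w₀ i) (w₁ i) w₂ x (y i)]
    exact hexp (hle (fun i => Finset.sum_nonneg fun s _ => ev_nonneg (hr₁ _ _ _) fun _ =>
      ev_nonneg (hq₂ _) fun _ => hρ.nonneg _ _ _ _ _ _ _) fun i => hρ.b₂ _ _ _ _)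
  · refine (Finset.sum_le_sum fun s _ => ev_mono (.piw fun _ => hq₁ _) fun w₁ =>
      ev_mono (.piw fun _ => hr₁ _ _ _) fun x => hind 2 s w₀ w₁ w₂ x y).trans ?_
    simp only [ev_mul_left, ← Finset.mul_sum, hwx]
    rw [sum_fiber_prod k fun i s => ev (q₁ (w₀ i)) fun w₁ => ev (r₁ s w₁ (w₀ i)) fun x =>
      ρ 2 s (w₀ i) w₁ (w₂ i) x (y i)]
    exact hexp (hle (fun i => Finset.sum_nonneg fun s _ => ev_nonneg (hq₁ _) fun _ =>
      ev_nonneg (hr₁ _ _ _) fun _ => hρ.nonneg _ _ _ _ _ _ _) fun i => hρ.b₃ _ _ _ _)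
  · refine (Finset.sum_le_sum fun s _ => ev_mono (.piw fun _ => hq₁ _) fun w₁ =>
      ev_mono (.piw fun _ => hr₁ _ _ _) fun x => ev_mono (.piw fun _ => hq₂ _) fun w₂ =>
        hind 3 s w₀ w₁ w₂ x y).trans ?_
    simp only [ev_mul_left, ← Finset.mul_sum, hwxw]
    rw [sum_fiber_prod k fun i s => ev (q₁ (w₀ i)) fun w₁ => ev (r₁ s w₁ (w₀ i)) fun x =>
      ev (q₂ (w₀ i)) fun w₂ => ρ 3 s (w₀ i) w₁ w₂ x (y i)]
    exact hexp (hle (fun i => Finset.sum_nonneg fun s _ => ev_nonneg (hq₁ _) fun _ =>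
      ev_nonneg (hr₁ _ _ _) fun _ => ev_nonneg (hq₂ _) fun _ => hρ.nonneg _ _ _ _ _ _ _)
      fun i => hρ.b₄ _ _ _)
  · refine (Finset.sum_le_sum fun s _ => ev_mono (.piw fun _ => hq₀) fun w₀ =>
      ev_mono (.piw fun _ => hq₁ _) fun w₁ => ev_mono (.piw fun _ => hr₁ _ _ _) fun x =>
        ev_mono (.piw fun _ => hq₂ _) fun w₂ => hind 4 s w₀ w₁ w₂ x y).trans ?_
    simp only [ev_mul_left, ← Finset.mul_sum, hall]
    rw [sum_prod_pi fun i s => ev q₀ fun w₀ => ev (q₁ w₀) fun w₁ => ev (r₁ s w₁ w₀) fun x =>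
      ev (q₂ w₀) fun w₂ => ρ 4 s w₀ w₁ w₂ x (y i)]
    exact hexp (hle (fun i => Finset.sum_nonneg fun s _ => ev_nonneg hq₀ fun _ =>
      ev_nonneg (hq₁ _) fun _ => ev_nonneg (hr₁ _ _ _) fun _ => ev_nonneg (hq₂ _) fun _ =>
        hρ.nonneg _ _ _ _ _ _ _) fun i => hρ.b₅ _)

end Block

/-! ### The joint law of all variables and its independent copies. -/

section SystemLaw

variable {𝒮 𝒯 𝒲₀ 𝒲₁ 𝒲₂ 𝒳₁ 𝒳₂ 𝒴 𝒴₁ 𝒴₂ : Type*} [Fintype 𝒮] [Fintype 𝒯] [Fintype 𝒲₀]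
  [Fintype 𝒲₁] [Fintype 𝒲₂] [Fintype 𝒳₁] [Fintype 𝒳₂] [Fintype 𝒴] [Fintype 𝒴₁] [Fintype 𝒴₂]
  {q₀ : 𝒲₀ → ℝ} {q₁ : 𝒲₀ → 𝒲₁ → ℝ} {q₂ : 𝒲₀ → 𝒲₂ → ℝ}
  {r₁ : 𝒮 → 𝒲₁ → 𝒲₀ → 𝒳₁ → ℝ} {r₂ : 𝒯 → 𝒲₂ → 𝒲₀ → 𝒳₂ → ℝ} {p : 𝒮 × 𝒯 → ℝ}

/-- The joint law of all the variables. -/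
noncomputable def systemLaw (p : 𝒮 × 𝒯 → ℝ) (q₀ : 𝒲₀ → ℝ) (q₁ : 𝒲₀ → 𝒲₁ → ℝ)
    (q₂ : 𝒲₀ → 𝒲₂ → ℝ) (r₁ : 𝒮 → 𝒲₁ → 𝒲₀ → 𝒳₁ → ℝ) (r₂ : 𝒯 → 𝒲₂ → 𝒲₀ → 𝒳₂ → ℝ)
    (c : 𝒳₁ → 𝒳₂ → 𝒴 → ℝ) : ((((((𝒮 × 𝒯) × 𝒲₀) × 𝒲₁) × 𝒳₁) × 𝒲₂) × 𝒳₂) × 𝒴 → ℝ :=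
  joint (joint (joint (joint (joint (joint p (fun _ => q₀)) (fun z => q₁ z.2))
    (fun z => r₁ z.1.1.1 z.2 z.1.2)) (fun z => q₂ z.1.1.2))
    (fun z => r₂ z.1.1.1.1.2 z.2 z.1.1.1.2)) (fun z => c z.1.1.2 z.2)

lemma IsSystem.isProb_systemLaw {c : 𝒳₁ → 𝒳₂ → 𝒴 → ℝ} (h : IsSystem p q₀ q₁ q₂ r₁ r₂ c) :
    IsProb (systemLaw p q₀ q₁ q₂ r₁ r₂ c) :=
  (((((h.hp.joint fun _ => h.hq₀).joint fun _ => h.hq₁ _).joint fun _ => h.hr₁ _ _ _).joint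
    fun _ => h.hq₂ _).joint fun _ => h.hr₂ _ _ _).joint fun _ => h.hc _ _

/-- Uncurrying, for functions of all the variables. -/
def tupled {γ : Type*} (F : 𝒮 → 𝒯 → 𝒲₀ → 𝒲₁ → 𝒲₂ → 𝒳₁ → 𝒳₂ → 𝒴 → γ)
    (z : ((((((𝒮 × 𝒯) × 𝒲₀) × 𝒲₁) × 𝒳₁) × 𝒲₂) × 𝒳₂) × 𝒴) : γ :=
  F z.1.1.1.1.1.1.1 z.1.1.1.1.1.1.2 z.1.1.1.1.1.2 z.1.1.1.1.2 z.1.1.2 z.1.1.1.2 z.1.2 z.2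

lemma ev_joint' {α β : Type*} [Fintype α] [Fintype β] (μ : α → ℝ) (ν : α → β → ℝ)
    (F : α × β → ℝ) : ev (joint μ ν) F = ev μ fun a => ev (ν a) fun b => F (a, b) :=
  ev_joint μ ν fun a b => F (a, b)

lemma ev_piw_joint {ι α β : Type*} [Fintype α] [Fintype β] [Fintype ι] [DecidableEq ι]
    (μ : ι → α → ℝ) (ν : ι → α → β → ℝ) (F : (ι → α × β) → ℝ) :
    ev (piw fun i => joint (μ i) (ν i)) F =
      ev (piw μ) fun a => ev (piw fun i => ν i (a i)) fun b => F fun i => (a i, b i) :=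
  (ev_piw_ev_piw μ ν fun a b => F fun i => (a i, b i)).symm

/-- The law of `n` independent copies of all the variables. -/
lemma evSystem_block_eq_ev {n : ℕ} (c : 𝒳₁ → 𝒳₂ → 𝒴₁ × 𝒴₂ → ℝ)
    (F : (Fin n → 𝒮) → (Fin n → 𝒯) → (Fin n → 𝒲₀) → (Fin n → 𝒲₁) → (Fin n → 𝒲₂) →
      (Fin n → 𝒳₁) → (Fin n → 𝒳₂) → (Fin n → 𝒴₁) × (Fin n → 𝒴₂) → ℝ) :
    evSystem (pairw fun _ => p) (piw fun _ => q₀) (fun w₀ => piw fun i => q₁ (w₀ i))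
      (fun w₀ => piw fun i => q₂ (w₀ i)) (fun s w w₀ => piw fun i => r₁ (s i) (w i) (w₀ i))
      (fun s w w₀ => piw fun i => r₂ (s i) (w i) (w₀ i))
      (fun x₁ x₂ => pairw fun i => c (x₁ i) (x₂ i)) F =
    ev (piw fun _ : Fin n => systemLaw p q₀ q₁ q₂ r₁ r₂ c) fun z =>
      F (fun i => (z i).1.1.1.1.1.1.1) (fun i => (z i).1.1.1.1.1.1.2)
        (fun i => (z i).1.1.1.1.1.2) (fun i => (z i).1.1.1.1.2) (fun i => (z i).1.1.2)
        (fun i => (z i).1.1.1.2) (fun i => (z i).1.2)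
        (fun i => (z i).2.1, fun i => (z i).2.2) := by
  simp only [systemLaw, ev_piw_joint, evSystem, ev_pairw]

lemma IsSystem.block {c : 𝒳₁ → 𝒳₂ → 𝒴₁ × 𝒴₂ → ℝ} (h : IsSystem p q₀ q₁ q₂ r₁ r₂ c) (n : ℕ) :
    IsSystem (pairw fun _ : Fin n => p) (piw fun _ => q₀) (fun w₀ => piw fun i => q₁ (w₀ i))
      (fun w₀ => piw fun i => q₂ (w₀ i)) (fun s w w₀ => piw fun i => r₁ (s i) (w i) (w₀ i))
      (fun s w w₀ => piw fun i => r₂ (s i) (w i) (w₀ i))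
      (fun x₁ x₂ => pairw fun i => c (x₁ i) (x₂ i)) where
  hp := .pairw fun _ => h.hp
  hq₀ := .piw fun _ => h.hq₀
  hq₁ _ := .piw fun _ => h.hq₁ _
  hq₂ _ := .piw fun _ => h.hq₂ _
  hr₁ _ _ _ := .piw fun _ => h.hr₁ _ _ _
  hr₂ _ _ _ := .piw fun _ => h.hr₂ _ _ _
  hc _ _ := .pairw fun _ => h.hc _ _

/-- The true words fail the test with probability `O(1/n)`. -/
lemma exists_evSystem_test_le {c : 𝒳₁ → 𝒳₂ → 𝒴₁ × 𝒴₂ → ℝ} (h : IsSystem p q₀ q₁ q₂ r₁ r₂ c)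
    {J : Type*} [Fintype J] {ρ : J → 𝒮 → 𝒯 → 𝒲₀ → 𝒲₁ → 𝒲₂ → 𝒳₁ → 𝒳₂ → 𝒴₁ × 𝒴₂ → ℝ} {D : J → ℝ}
    (hpos : ∀ j z, systemLaw p q₀ q₁ q₂ r₁ r₂ c z ≠ 0 → 0 < tupled (ρ j) z)
    (hD : ∀ j, D j = ev (systemLaw p q₀ q₁ q₂ r₁ r₂ c) fun z => Real.log (tupled (ρ j) z))
    {δ : ℝ} (hδ : 0 < δ) :
    ∃ C : ℝ, 0 ≤ C ∧ ∀ n : ℕ, 0 < n →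
      evSystem (pairw fun _ : Fin n => p) (piw fun _ => q₀) (fun w₀ => piw fun i => q₁ (w₀ i))
        (fun w₀ => piw fun i => q₂ (w₀ i)) (fun s w w₀ => piw fun i => r₁ (s i) (w i) (w₀ i))
        (fun s w w₀ => piw fun i => r₂ (s i) (w i) (w₀ i))
        (fun x₁ x₂ => pairw fun i => c (x₁ i) (x₂ i)) (fun s t w₀ w₁ w₂ x₁ x₂ y =>
          ind (¬ ∀ j, Real.exp (n * (D j - δ)) ≤
            ∏ i, ρ j (s i) (t i) (w₀ i) (w₁ i) (w₂ i) (x₁ i) (x₂ i) (y.1 i, y.2 i))) ≤ C / n := by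
  have hQ := h.isProb_systemLaw
  -- The constant is the sum of the variances of the log-densities over `δ ^ 2`: a union bound over
  -- `j`, then Chebyshev for each.
  refine ⟨∑ j, (ev (systemLaw p q₀ q₁ q₂ r₁ r₂ c) fun z => (Real.log (tupled (ρ j) z) - D j) ^ 2) /
    δ ^ 2, Finset.sum_nonneg fun j _ => div_nonneg (ev_nonneg hQ fun _ => sq_nonneg _)
      (sq_nonneg _), fun n hn => ?_⟩
  rw [evSystem_block_eq_ev, Finset.sum_div]
  calc _ ≤ ev (piw fun _ : Fin n => systemLaw p q₀ q₁ q₂ r₁ r₂ c) fun z => ∑ j,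
        ind (¬ Real.exp (n * (D j - δ)) ≤ ∏ i, tupled (ρ j) (z i)) := by
        refine ev_mono (.piw fun _ => hQ) fun z => ?_
        change ind (¬ ∀ j, Real.exp (n * (D j - δ)) ≤ ∏ i, tupled (ρ j) (z i)) ≤ _
        by_cases hz : ∀ j, Real.exp (n * (D j - δ)) ≤ ∏ i, tupled (ρ j) (z i)
        · rw [ind_of_not (not_not.2 hz)]
          exact Finset.sum_nonneg fun _ _ => ind_nonneg _
        · have hz' := hz
          push Not at hz'
          obtain ⟨j, hj⟩ := hz'
          refine (ind_le_one _).trans ?_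
          rw [← ind_of (not_le.2 hj)]
          exact Finset.single_le_sum (f := fun j =>
            ind (¬ Real.exp (n * (D j - δ)) ≤ ∏ i, tupled (ρ j) (z i)))
            (fun _ _ => ind_nonneg _) (Finset.mem_univ j)
    _ ≤ _ := by
        rw [ev_sum]
        refine Finset.sum_le_sum fun j _ => ?_
        rw [hD j]
        exact ev_density_le hQ (hpos j) hδ hn

end SystemLaw

/-! ### Codebook sizes and exponents. -/

section Rates

lemma exists_codebook_size {R : ℝ} (hR : 0 < R) (n : ℕ) :
    ∃ M : ℕ, 0 < M ∧ Real.exp (n * R) ≤ M ∧ (M : ℝ) ≤ 2 * Real.exp (n * R) := by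
  have h1 : 1 ≤ Real.exp (n * R) := Real.one_le_exp (by positivity)
  refine ⟨⌈Real.exp (n * R)⌉₊, Nat.ceil_pos.2 (by linarith), Nat.le_ceil _, ?_⟩
  have := Nat.ceil_lt_add_one (Real.exp_pos (n * R)).le
  linarith

/-- Of each margin `2 * δ`, one `δ` pays for the slack of the test and the other survives as
exponent. The constant is `8 = 1 + 2 + 1 + 2 + 2`, every factor `M₂` contributing a `2` for
rounding. -/
lemma rate_sum_le {n : ℕ} {M₁ M₂ : ℕ} {R₁ R₂ δ : ℝ} {D : Fin 5 → ℝ} (hM₁ : 0 < M₁)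
    (h₁ : Real.exp (n * R₁) ≤ M₁) (h₂ : (M₂ : ℝ) ≤ 2 * Real.exp (n * R₂))
    (hD₀ : 2 * δ ≤ D 0 + R₁) (hD₁ : 2 * δ ≤ D 1 + R₁ - R₂) (hD₂ : 2 * δ ≤ D 2)
    (hD₃ : 2 * δ ≤ D 3 - R₂) (hD₄ : 2 * δ ≤ D 4 - R₂) :
    (M₁ : ℝ)⁻¹ * Real.exp (-(n * (D 0 - δ))) +
      (M₁ : ℝ)⁻¹ * (M₂ * Real.exp (-(n * (D 1 - δ)))) +
      (Real.exp (-(n * (D 2 - δ))) + M₂ * Real.exp (-(n * (D 3 - δ)))) +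
      M₂ * Real.exp (-(n * (D 4 - δ))) ≤ 8 * Real.exp (-(n * δ)) := by
  have hn : (0 : ℝ) ≤ n := Nat.cast_nonneg n
  have hinv : (M₁ : ℝ)⁻¹ ≤ Real.exp (-(n * R₁)) := by
    rw [Real.exp_neg]
    exact inv_anti₀ (Real.exp_pos _) h₁
  have hinv0 : 0 ≤ (M₁ : ℝ)⁻¹ := by positivity
  have hexp : ∀ {a b c : ℝ}, 2 * δ ≤ c → a - n * (b - δ) = -(n * (c - δ)) →
      Real.exp a * Real.exp (-(n * (b - δ))) ≤ Real.exp (-(n * δ)) := by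
    intro a b c hc hab
    rw [← Real.exp_add, Real.exp_le_exp, ← sub_eq_add_neg, hab]
    nlinarith
  have t2 : ∀ {b : ℝ}, 2 * δ ≤ b - R₂ →
      M₂ * Real.exp (-(n * (b - δ))) ≤ 2 * Real.exp (-(n * δ)) := by
    intro b hb
    calc _ ≤ 2 * Real.exp (n * R₂) * Real.exp (-(n * (b - δ))) :=
          mul_le_mul_of_nonneg_right h₂ (Real.exp_pos _).le
      _ = 2 * (Real.exp (n * R₂) * Real.exp (-(n * (b - δ)))) := mul_assoc _ _ _
      _ ≤ _ := mul_le_mul_of_nonneg_left (hexp hb (by ring)) zero_le_two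
  have t0 : (M₁ : ℝ)⁻¹ * Real.exp (-(n * (D 0 - δ))) ≤ Real.exp (-(n * δ)) :=
    (mul_le_mul_of_nonneg_right hinv (Real.exp_pos _).le).trans (hexp hD₀ (by ring))
  have t1 : (M₁ : ℝ)⁻¹ * (M₂ * Real.exp (-(n * (D 1 - δ)))) ≤ 2 * Real.exp (-(n * δ)) := by
    calc _ ≤ Real.exp (-(n * R₁)) * (2 * Real.exp (n * R₂) * Real.exp (-(n * (D 1 - δ)))) :=
          mul_le_mul hinv (mul_le_mul_of_nonneg_right h₂ (Real.exp_pos _).le)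
            (by positivity) (Real.exp_pos _).le
      _ = 2 * (Real.exp (-(n * R₁) + n * R₂) * Real.exp (-(n * (D 1 - δ)))) := by
          rw [Real.exp_add]; ring
      _ ≤ _ := mul_le_mul_of_nonneg_left (hexp hD₁ (by ring)) zero_le_two
  have t3 : Real.exp (-(n * (D 2 - δ))) ≤ Real.exp (-(n * δ)) := by
    have := hexp (a := 0) (b := D 2) hD₂ (by ring)
    rwa [Real.exp_zero, one_mul] at this
  linarith [t2 hD₃, t2 hD₄]

end Rates

/-! ### Block codes from admissible partition rates. -/

section Block

variable {𝒮 𝒯 κ 𝒲₀ 𝒲₁ 𝒲₂ 𝒳₁ 𝒳₂ 𝒴₁ 𝒴₂ : Type*} [Fintype 𝒮] [Fintype 𝒯] [Fintype κ]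
  [Fintype 𝒲₀] [Fintype 𝒲₁] [Fintype 𝒲₂] [Fintype 𝒳₁] [Fintype 𝒳₂] [Fintype 𝒴₁] [Fintype 𝒴₂]
  [DecidableEq 𝒮] [DecidableEq 𝒯] [DecidableEq κ]
  {f : 𝒮 → κ} {g : 𝒯 → κ} {q₀ : 𝒲₀ → ℝ} {q₁ : 𝒲₀ → 𝒲₁ → ℝ} {q₂ : 𝒲₀ → 𝒲₂ → ℝ}
  {r₁ : 𝒮 → 𝒲₁ → 𝒲₀ → 𝒳₁ → ℝ} {r₂ : 𝒯 → 𝒲₂ → 𝒲₀ → 𝒳₂ → ℝ} {c : 𝒳₁ → 𝒳₂ → 𝒴₁ × 𝒴₂ → ℝ}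
  {p : 𝒮 × 𝒯 → ℝ}

/-- Block codes with vanishing error exist if the partition rates `R₁`, `R₂` are compatible with
the typical values `D`, `D'` of the densities. -/
theorem exists_block_code [Nonempty 𝒮] [Nonempty 𝒯] (hsys : IsSystem p q₀ q₁ q₂ r₁ r₂ c)
    (hfg : ∀ s t, p (s, t) ≠ 0 → f s = g t)
    {ρ : Fin 5 → 𝒮 → 𝒲₀ → 𝒲₁ → 𝒲₂ → 𝒳₁ → 𝒴₁ → ℝ}
    {ρ' : Fin 5 → 𝒯 → 𝒲₀ → 𝒲₂ → 𝒲₁ → 𝒳₂ → 𝒴₂ → ℝ} {D D' : Fin 5 → ℝ}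
    (hρ : IsDensityFamily f q₀ q₁ q₂ r₁ ρ) (hρ' : IsDensityFamily g q₀ q₂ q₁ r₂ ρ')
    (hpos : ∀ j z, systemLaw p q₀ q₁ q₂ r₁ r₂ c z ≠ 0 →
      0 < tupled (fun s _ w₀ w₁ w₂ x₁ _ y => ρ j s w₀ w₁ w₂ x₁ y.1) z)
    (hpos' : ∀ j z, systemLaw p q₀ q₁ q₂ r₁ r₂ c z ≠ 0 →
      0 < tupled (fun _ t w₀ w₁ w₂ _ x₂ y => ρ' j t w₀ w₂ w₁ x₂ y.2) z)
    (hD : ∀ j, D j = ev (systemLaw p q₀ q₁ q₂ r₁ r₂ c) fun z =>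
      Real.log (tupled (fun s _ w₀ w₁ w₂ x₁ _ y => ρ j s w₀ w₁ w₂ x₁ y.1) z))
    (hD' : ∀ j, D' j = ev (systemLaw p q₀ q₁ q₂ r₁ r₂ c) fun z =>
      Real.log (tupled (fun _ t w₀ w₁ w₂ _ x₂ y => ρ' j t w₀ w₂ w₁ x₂ y.2) z))
    {R₁ R₂ : ℝ} (hR₁ : 0 < R₁) (hR₂ : 0 < R₂)
    (h₀ : 0 < D 0 + R₁) (h₁ : 0 < D 1 + R₁ - R₂) (h₂ : 0 < D 2) (h₃ : 0 < D 3 - R₂)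
    (h₄ : 0 < D 4 - R₂)
    (h₀' : 0 < D' 0 + R₂) (h₁' : 0 < D' 1 + R₂ - R₁) (h₂' : 0 < D' 2) (h₃' : 0 < D' 3 - R₁)
    (h₄' : 0 < D' 4 - R₁) {ε : ℝ} (hε : 0 < ε) :
    ∃ N : ℕ, ∀ n ≥ N, ∃ (f₁ : (Fin n → 𝒮) → Fin n → 𝒳₁) (f₂ : (Fin n → 𝒯) → Fin n → 𝒳₂)
      (φ₁ : (Fin n → 𝒴₁) → Fin n → 𝒮) (φ₂ : (Fin n → 𝒴₂) → Fin n → 𝒯),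
      (ev (pairw fun _ => p) fun st => ev (pairw fun i => c (f₁ st.1 i) (f₂ st.2 i)) fun y =>
        ind (φ₁ y.1 ≠ st.1) + ind (φ₂ y.2 ≠ st.2)) ≤ ε := by
  obtain ⟨δ, hδ, k₀, k₁, k₂, k₃, k₄, k₀', k₁', k₂', k₃', k₄'⟩ : ∃ δ : ℝ, 0 < δ ∧
      2 * δ ≤ D 0 + R₁ ∧ 2 * δ ≤ D 1 + R₁ - R₂ ∧ 2 * δ ≤ D 2 ∧ 2 * δ ≤ D 3 - R₂ ∧
      2 * δ ≤ D 4 - R₂ ∧ 2 * δ ≤ D' 0 + R₂ ∧ 2 * δ ≤ D' 1 + R₂ - R₁ ∧ 2 * δ ≤ D' 2 ∧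
      2 * δ ≤ D' 3 - R₁ ∧ 2 * δ ≤ D' 4 - R₁ := by
    have hmin : ∀ {a b : ℝ}, 0 < a → 0 < b → ∃ m : ℝ, 0 < m ∧ m ≤ a ∧ m ≤ b := fun ha hb =>
      ⟨_, lt_min ha hb, min_le_left _ _, min_le_right _ _⟩
    obtain ⟨m, hm, _, _⟩ := hmin h₀ h₁
    obtain ⟨m, hm, _, _⟩ := hmin hm h₂
    obtain ⟨m, hm, _, _⟩ := hmin hm h₃
    obtain ⟨m, hm, _, _⟩ := hmin hm h₄
    obtain ⟨m, hm, _, _⟩ := hmin hm h₀'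
    obtain ⟨m, hm, _, _⟩ := hmin hm h₁'
    obtain ⟨m, hm, _, _⟩ := hmin hm h₂'
    obtain ⟨m, hm, _, _⟩ := hmin hm h₃'
    obtain ⟨m, hm, _, _⟩ := hmin hm h₄'
    refine ⟨m / 2, half_pos hm, ?_, ?_, ?_, ?_, ?_, ?_, ?_, ?_, ?_, ?_⟩ <;> linarith
  obtain ⟨C, hC, hbad⟩ := exists_evSystem_test_le hsys hpos hD hδ
  obtain ⟨C', hC', hbad'⟩ := exists_evSystem_test_le hsys hpos' hD' hδ
  -- Every error term is `O(1/n)`: two Chebyshev constants, and `8` exponentials per decoder with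
  -- `exp (-(n * δ)) ≤ 1 / δ / n`. Starting at `N + 1` excludes `n = 0`.
  obtain ⟨N, hN⟩ := exists_nat_gt ((C + C' + 16 / δ) / ε)
  refine ⟨N + 1, fun n hn => ?_⟩
  have hn0 : 0 < n := by omega
  have hn' : (0 : ℝ) < n := by exact_mod_cast hn0
  obtain ⟨M₁, hM₁, hM₁l, hM₁u⟩ := exists_codebook_size hR₁ n
  obtain ⟨M₂, hM₂, hM₂l, hM₂u⟩ := exists_codebook_size hR₂ n
  have hfgn : ∀ (s : Fin n → 𝒮) (t : Fin n → 𝒯), pairw (fun _ => p) (s, t) ≠ 0 →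
      (fun i => f (s i)) = fun i => g (t i) := fun s t h => funext fun i =>
    hfg _ _ fun h0 => h (Finset.prod_eq_zero (Finset.mem_univ i) h0)
  obtain ⟨f₁, f₂, φ₁, φ₂, hcode⟩ := exists_oneShot_code hM₁ hM₂ (hsys.block n) hfgn
    (testBound_densityTest hsys.hq₀ hsys.hq₁ hsys.hq₂ hsys.hr₁ hρ D δ)
    (testBound_densityTest hsys.hq₀ hsys.hq₂ hsys.hq₁ hsys.hr₂ hρ' D' δ)
  refine ⟨f₁, f₂, φ₁, φ₂, hcode.trans ?_⟩
  have hb := hbad n hn0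
  have hb' := hbad' n hn0
  have hr := rate_sum_le hM₁ hM₁l hM₂u k₀ k₁ k₂ k₃ k₄
  have hr' := rate_sum_le hM₂ hM₂l hM₁u k₀' k₁' k₂' k₃' k₄'
  have hexp : Real.exp (-(n * δ)) ≤ 1 / δ / n := by
    rw [Real.exp_neg, div_div, mul_comm δ, ← one_div]
    refine one_div_le_one_div_of_le (by positivity) ?_
    linarith [Real.add_one_le_exp (n * δ)]
  have hfin : (C + C' + 16 / δ) / n ≤ ε := by
    rw [div_le_iff₀ hn']
    rw [div_lt_iff₀ hε] at hN
    have : (N : ℝ) ≤ n := by exact_mod_cast (by omega : N ≤ n)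
    nlinarith
  have hsplit : (C + C' + 16 / δ) / n = C / n + C' / n + 16 * (1 / δ / n) := by ring
  unfold densityTest
  linarith

end Block

/-! ### Marginals of a finite law. -/

section Marginal

variable {Z A B C D : Type*} [Fintype Z] {Q : Z → ℝ}

/-- The probability that `φ = a` under the law `Q`. -/
noncomputable def pr (Q : Z → ℝ) (φ : Z → A) (a : A) : ℝ := ev Q fun z => ind (φ z = a)

lemma pr_nonneg (hQ : IsProb Q) (φ : Z → A) (a : A) : 0 ≤ pr Q φ a :=
  ev_nonneg hQ fun _ => ind_nonneg _

lemma pr_mono (hQ : IsProb Q) {φ : Z → A} {ψ : Z → B} {a : A} {b : B}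
    (h : ∀ z, φ z = a → ψ z = b) : pr Q φ a ≤ pr Q ψ b :=
  ev_mono hQ fun z => ind_mono (h z)

lemma pr_congr {φ : Z → A} {ψ : Z → B} {a : A} {b : B} (h : ∀ z, φ z = a ↔ ψ z = b) :
    pr Q φ a = pr Q ψ b := by
  simp only [pr, h]

lemma pr_congr_supp {φ ψ : Z → A} (h : ∀ z, Q z ≠ 0 → φ z = ψ z) (a : A) :
    pr Q φ a = pr Q ψ a := by
  refine Finset.sum_congr rfl fun z _ => ?_
  by_cases hz : Q z = 0
  · rw [hz, zero_mul, zero_mul]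
  · simp only [h z hz]

lemma pr_pos (hQ : IsProb Q) (φ : Z → A) {z : Z} (hz : Q z ≠ 0) : 0 < pr Q φ (φ z) := by
  have h : Q z * ind (φ z = φ z) ≤ pr Q φ (φ z) :=
    Finset.single_le_sum (f := fun x => Q x * ind (φ x = φ z))
      (fun x _ => mul_nonneg (hQ.nonneg x) (ind_nonneg _)) (Finset.mem_univ z)
  rw [ind_of rfl, mul_one] at h
  exact (lt_of_le_of_ne (hQ.nonneg z) (Ne.symm hz)).trans_le h

lemma sum_ind_mul [Fintype A] (a : A) (L : A → ℝ) : ∑ x, ind (a = x) * L x = L a := by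
  rw [Finset.sum_eq_single a, ind_of rfl, one_mul]
  · intro b _ hb
    rw [ind_of_not hb.symm, zero_mul]
  · simp

lemma sum_pr_mul [Fintype A] (φ : Z → A) (L : A → ℝ) :
    ∑ a, pr Q φ a * L a = ev Q fun z => L (φ z) := by
  simp only [pr, ev, Finset.sum_mul]
  rw [Finset.sum_comm]
  refine Finset.sum_congr rfl fun z _ => ?_
  simp only [mul_assoc, ← Finset.mul_sum, sum_ind_mul]

lemma isProb_pr [Fintype A] (hQ : IsProb Q) (φ : Z → A) : IsProb (pr Q φ) where
  nonneg := pr_nonneg hQ φ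
  sum_one := by
    have h := sum_pr_mul (Q := Q) φ fun _ => 1
    simpa [ev_const hQ] using h

lemma sum_pr_pair [Fintype A] (φ : Z → A) (ψ : Z → B) (b : B) :
    ∑ a, pr Q (φ ⋄ ψ) (a, b) = pr Q ψ b := by
  simp only [pr, ← ev_sum, Prod.mk.injEq, ind_and]
  exact congrArg _ (funext fun z => sum_ind_mul (φ z) fun _ => ind (ψ z = b))

lemma ev_congr_supp {F G : Z → ℝ} (h : ∀ z, Q z ≠ 0 → F z = G z) : ev Q F = ev Q G := by
  refine Finset.sum_congr rfl fun z _ => ?_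
  by_cases hz : Q z = 0
  · rw [hz, zero_mul, zero_mul]
  · rw [h z hz]

/-- If the conditioning event is null, the quotient is `0` by convention and the joint probability
vanishes as well. -/
lemma div_mul_pr (hQ : IsProb Q) (φ : Z → A) (ψ : Z → B) (a : A) (b : B) :
    pr Q (φ ⋄ ψ) (a, b) / pr Q ψ b * pr Q ψ b = pr Q (φ ⋄ ψ) (a, b) := by
  by_cases h : pr Q ψ b = 0
  · have : pr Q (φ ⋄ ψ) (a, b) ≤ pr Q ψ b := pr_mono hQ fun z hz => congrArg Prod.snd hz
    rw [h, mul_zero]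
    exact le_antisymm (pr_nonneg hQ _ _) (h ▸ this)
  · exact div_mul_cancel₀ _ h

end Marginal

/-! ### Information densities and conditional mutual information. -/

section Density

variable {Z A A' B C C' : Type*} [Fintype Z] {Q : Z → ℝ}

/-- The ratio inside the logarithm of conditional mutual information. -/
noncomputable def condInfoDensity (Q : Z → ℝ) (U : Z → A) (Y : Z → B) (V : Z → C) (a : A) (b : B)
    (c : C) : ℝ :=
  (pr Q (U ⋄ Y ⋄ V) (a, b, c) / pr Q V c) /
    ((pr Q (U ⋄ V) (a, c) / pr Q V c) * (pr Q (Y ⋄ V) (b, c) / pr Q V c))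

/-- Conditional mutual information as an expectation. -/
noncomputable def cmi (Q : Z → ℝ) (U : Z → A) (Y : Z → B) (V : Z → C) : ℝ :=
  ev Q fun z => Real.log (condInfoDensity Q U Y V (U z) (Y z) (V z))

/-- The ratio inside the logarithm of mutual information. -/
noncomputable def infoDensity (Q : Z → ℝ) (U : Z → A) (Y : Z → B) (a : A) (b : B) : ℝ :=
  pr Q (U ⋄ Y) (a, b) / (pr Q U a * pr Q Y b)

/-- Mutual information as an expectation. -/
noncomputable def mi (Q : Z → ℝ) (U : Z → A) (Y : Z → B) : ℝ :=
  ev Q fun z => Real.log (infoDensity Q U Y (U z) (Y z))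

/-- Entropy as an expectation. -/
noncomputable def ent (Q : Z → ℝ) (U : Z → A) : ℝ := -ev Q fun z => Real.log (pr Q U (U z))

/-- Conditional entropy as an expectation. -/
noncomputable def condEnt (Q : Z → ℝ) (U : Z → A) (V : Z → C) : ℝ :=
  -ev Q fun z => Real.log (pr Q (U ⋄ V) (U z, V z) / pr Q V (V z))

lemma condInfoDensity_nonneg (hQ : IsProb Q) (U : Z → A) (Y : Z → B) (V : Z → C) (a : A) (b : B)
    (c : C) : 0 ≤ condInfoDensity Q U Y V a b c := by
  have h1 := pr_nonneg hQ (U ⋄ Y ⋄ V) (a, b, c)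
  have h2 := pr_nonneg hQ (U ⋄ V) (a, c)
  have h3 := pr_nonneg hQ (Y ⋄ V) (b, c)
  have h4 := pr_nonneg hQ V c
  unfold condInfoDensity
  positivity

lemma condInfoDensity_pos (hQ : IsProb Q) (U : Z → A) (Y : Z → B) (V : Z → C) {z : Z}
    (hz : Q z ≠ 0) : 0 < condInfoDensity Q U Y V (U z) (Y z) (V z) := by
  have h1 := pr_pos hQ (U ⋄ Y ⋄ V) hz
  have h2 := pr_pos hQ (U ⋄ V) hz
  have h3 := pr_pos hQ (Y ⋄ V) hz
  have h4 := pr_pos hQ V hz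
  unfold condInfoDensity
  positivity

lemma infoDensity_nonneg (hQ : IsProb Q) (U : Z → A) (Y : Z → B) (a : A) (b : B) :
    0 ≤ infoDensity Q U Y a b :=
  div_nonneg (pr_nonneg hQ _ _) (mul_nonneg (pr_nonneg hQ _ _) (pr_nonneg hQ _ _))

lemma infoDensity_pos (hQ : IsProb Q) (U : Z → A) (Y : Z → B) {z : Z} (hz : Q z ≠ 0) :
    0 < infoDensity Q U Y (U z) (Y z) :=
  div_pos (pr_pos hQ (U ⋄ Y) hz) (mul_pos (pr_pos hQ _ hz) (pr_pos hQ _ hz))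

/-- Here `α` is a codebook weight and `h` a source probability given the common part. When `α * h`
equals `p(a|c)`, multiplying by the density turns it into the posterior `p(a|b,c)`. If a denominator
or `p(a,c)` vanishes, the left side is zero, whence the inequality. -/
lemma mul_condInfoDensity_le (hQ : IsProb Q) (U : Z → A) (Y : Z → B) (V : Z → C) {a : A} (b : B)
    {c : C} {α h : ℝ} (hα : α * h * pr Q V c = pr Q (U ⋄ V) (a, c)) :
    α * (condInfoDensity Q U Y V a b c * h) ≤
      pr Q (U ⋄ Y ⋄ V) (a, b, c) / pr Q (Y ⋄ V) (b, c) := by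
  have hnn : 0 ≤ pr Q (U ⋄ Y ⋄ V) (a, b, c) / pr Q (Y ⋄ V) (b, c) :=
    div_nonneg (pr_nonneg hQ _ _) (pr_nonneg hQ _ _)
  unfold condInfoDensity
  by_cases h1 : pr Q V c = 0
  · simpa [h1] using hnn
  by_cases h2 : pr Q (Y ⋄ V) (b, c) = 0
  · simp [h2]
  by_cases h3 : pr Q (U ⋄ V) (a, c) = 0
  · simpa [h3] using hnn
  · refine le_of_eq ?_
    have : α * h = pr Q (U ⋄ V) (a, c) / pr Q V c := by rw [← hα]; field_simp
    rw [mul_comm _ h, ← mul_assoc, this]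
    field_simp

lemma mul_infoDensity_le (hQ : IsProb Q) (U : Z → A) (Y : Z → B) {a : A} (b : B)
    {α h : ℝ} (hα : α * h = pr Q U a) :
    α * (infoDensity Q U Y a b * h) ≤ pr Q (U ⋄ Y) (a, b) / pr Q Y b := by
  unfold infoDensity
  by_cases h2 : pr Q Y b = 0
  · simp [h2]
  by_cases h3 : pr Q U a = 0
  · simpa [h3] using div_nonneg (pr_nonneg hQ _ _) (pr_nonneg hQ _ _)
  · refine le_of_eq ?_
    rw [mul_comm _ h, ← mul_assoc, hα]
    field_simp

lemma sum_pr_div_le [Fintype A] (U : Z → A) (Y : Z → B) (b : B) :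
    ∑ a, pr Q (U ⋄ Y) (a, b) / pr Q Y b ≤ 1 := by
  rw [← Finset.sum_div, sum_pr_pair]
  exact div_self_le_one _

lemma cmi_congr {U : Z → A} {U' : Z → A'} (h : ∀ z z', U z = U z' ↔ U' z = U' z') (Y : Z → B)
    (V : Z → C) : cmi Q U Y V = cmi Q U' Y V := by
  unfold cmi
  refine congrArg _ (funext fun z => ?_)
  unfold condInfoDensity
  rw [pr_congr (φ := U ⋄ Y ⋄ V) (ψ := U' ⋄ Y ⋄ V) (b := (U' z, Y z, V z)) fun z' => by
      simp only [Prod.mk.injEq, h],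
    pr_congr (φ := U ⋄ V) (ψ := U' ⋄ V) (b := (U' z, V z)) fun z' => by
      simp only [Prod.mk.injEq, h]]

/-- Moving a conditioning variable to the left does not decrease conditional mutual
information. -/
lemma cmi_le_cmi [Fintype B] [Fintype C] (hQ : IsProb Q) {U : Z → A} {U' : Z → A'} (Y : Z → B)
    {V : Z → C} (v : C → C')
    (h : ∀ z z', (U z = U z' ∧ V z = V z') ↔ (U' z = U' z' ∧ v (V z) = v (V z'))) :
    cmi Q U Y V ≤ cmi Q U' Y fun z => v (V z) := by
  set V' : Z → C' := fun z => v (V z) with hV'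
  -- `L` is `p(y|v') / p(y|v)`, the quotient of the two densities. From `log L ≤ L - 1` and the fact
  -- that `L` has mean at most one, the mean of `log L` is nonpositive.
  let L : B × C → ℝ := fun bc => pr Q V bc.2 * pr Q (Y ⋄ V') (bc.1, v bc.2) /
    (pr Q (Y ⋄ V) bc * pr Q V' (v bc.2))
  have hlog : ∀ z, Q z ≠ 0 → Real.log (condInfoDensity Q U Y V (U z) (Y z) (V z)) ≤
      Real.log (condInfoDensity Q U' Y V' (U' z) (Y z) (V' z)) + (L (Y z, V z) + -1) := by
    intro z hz
    have e1 : pr Q (U ⋄ Y ⋄ V) (U z, Y z, V z) = pr Q (U' ⋄ Y ⋄ V') (U' z, Y z, V' z) :=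
      pr_congr fun z' => by
        have := h z' z
        simp only [Prod.mk.injEq, hV']
        tauto
    have e2 : pr Q (U ⋄ V) (U z, V z) = pr Q (U' ⋄ V') (U' z, V' z) :=
      pr_congr fun z' => by
        have := h z' z
        simp only [Prod.mk.injEq, hV']
        tauto
    have p1 := pr_pos hQ (U' ⋄ Y ⋄ V') hz
    have p2 := pr_pos hQ (U' ⋄ V') hz
    have p3 := pr_pos hQ V hz
    have p4 := pr_pos hQ V' hz
    have p5 := pr_pos hQ (Y ⋄ V) hz
    have p6 := pr_pos hQ (Y ⋄ V') hz
    have hL : 0 < L (Y z, V z) := by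
      simp only [L]
      positivity
    have hmul : condInfoDensity Q U Y V (U z) (Y z) (V z) =
        condInfoDensity Q U' Y V' (U' z) (Y z) (V' z) * L (Y z, V z) := by
      simp only [condInfoDensity, L, e1, e2]
      change _ = _ * (_ * pr Q (Y ⋄ V') (Y z, V' z) / (_ * pr Q V' (V' z)))
      field_simp
    rw [hmul, Real.log_mul (condInfoDensity_pos hQ U' Y V' hz).ne' hL.ne']
    linarith [Real.log_le_sub_one_of_pos hL]
  have hsum : (ev Q fun z => L (Y z, V z)) ≤ 1 := by
    rw [← sum_pr_mul (Y ⋄ V) L, Fintype.sum_prod_type, Finset.sum_comm]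
    calc _ ≤ ∑ c, ∑ b, pr Q V c * (pr Q (Y ⋄ V') (b, v c) / pr Q V' (v c)) := by
          refine Finset.sum_le_sum fun c _ => Finset.sum_le_sum fun b _ => ?_
          have n1 := pr_nonneg hQ V c
          have n2 := pr_nonneg hQ (Y ⋄ V') (b, v c)
          have n3 := pr_nonneg hQ V' (v c)
          by_cases h0 : pr Q (Y ⋄ V) (b, c) = 0
          · rw [h0, zero_mul]
            positivity
          · refine le_of_eq ?_
            simp only [L]
            rw [← mul_div_mul_left _ _ h0]
            field_simp
      _ ≤ ∑ c, pr Q V c * 1 := by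
          refine Finset.sum_le_sum fun c _ => ?_
          rw [← Finset.mul_sum]
          exact mul_le_mul_of_nonneg_left (sum_pr_div_le Y V' (v c)) (pr_nonneg hQ _ _)
      _ = 1 := by simp [(isProb_pr hQ V).sum_one]
  have := ev_mono_supp hQ hlog
  rw [ev_add, ev_add, ev_const hQ] at this
  unfold cmi
  linarith

end Density

/-! ### From sums over alphabets under `P` to expectations under a finite law. -/

section Transfer

variable {Ω Z A B C : Type*} [Fintype Z] [Fintype A] [Fintype B] [Fintype C] {P : PMF Ω}
  {τ : Ω → Z} {Q : Z → ℝ}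

omit [Fintype A] in
lemma prob_eq_pr (hQ : ∀ z, (P.map τ z).toReal = Q z) (φ : Z → A) (a : A) :
    prob P (fun ω => φ (τ ω)) a = pr Q φ a := by
  classical
  have h : P.map (fun ω => φ (τ ω)) = (P.map τ).map φ := (PMF.map_comp τ P φ).symm
  rw [prob, h, PMF.map_apply, tsum_fintype, ENNReal.toReal_sum fun z _ => by
    split_ifs
    · exact PMF.apply_ne_top _ _
    · exact ENNReal.zero_ne_top]
  refine Finset.sum_congr rfl fun z _ => ?_
  rw [← hQ z]
  by_cases hz : φ z = a
  · simp [hz, ind]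
  · simp [hz, Ne.symm hz, ind]

lemma condMutualInfo_eq_cmi (hQ : ∀ z, (P.map τ z).toReal = Q z) (U : Z → A) (Y : Z → B)
    (V : Z → C) : condMutualInfo P (fun ω => U (τ ω)) (fun ω => Y (τ ω)) (fun ω => V (τ ω)) =
      cmi Q U Y V := by
  have h := sum_pr_mul (Q := Q) (U ⋄ Y ⋄ V) fun a => Real.log (condInfoDensity Q U Y V a.1 a.2.1 a.2.2)
  rw [cmi, ← h, condMutualInfo]
  simp only [Fintype.sum_prod_type, condInfoDensity, ← prob_eq_pr hQ]

lemma mutualInfo_eq_mi (hQ : ∀ z, (P.map τ z).toReal = Q z) (U : Z → A) (Y : Z → B) :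
    mutualInfo P (fun ω => U (τ ω)) (fun ω => Y (τ ω)) = mi Q U Y := by
  have h := sum_pr_mul (Q := Q) (U ⋄ Y) fun a => Real.log (infoDensity Q U Y a.1 a.2)
  rw [mi, ← h, mutualInfo]
  simp only [Fintype.sum_prod_type, infoDensity, ← prob_eq_pr hQ]

lemma condEntropy_eq_condEnt (hQ : ∀ z, (P.map τ z).toReal = Q z) (U : Z → A) (V : Z → C) :
    condEntropy P (fun ω => U (τ ω)) (fun ω => V (τ ω)) = condEnt Q U V := by
  have h := sum_pr_mul (Q := Q) (U ⋄ V) fun a => Real.log (pr Q (U ⋄ V) a / pr Q V a.2)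
  rw [condEnt, ← h, condEntropy]
  simp only [Fintype.sum_prod_type, ← prob_eq_pr hQ]

lemma entropy_eq_ent (hQ : ∀ z, (P.map τ z).toReal = Q z) (U : Z → A) :
    entropy P (fun ω => U (τ ω)) = ent Q U := by
  have h := sum_pr_mul (Q := Q) U fun a => Real.log (pr Q U a)
  rw [ent, ← h, entropy]
  simp only [← prob_eq_pr hQ]

end Transfer

/-! ### Evaluating averages of indicators. -/

section Marginals

variable {α β : Type*} [Fintype α] [Fintype β]

lemma ev_ind_mul (μ : α → ℝ) (a : α) (F : α → ℝ) :
    ev μ (fun x => ind (x = a) * F x) = μ a * F a := by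
  have h := sum_ind_mul a fun x => μ x * F x
  rw [← h]
  refine Finset.sum_congr rfl fun x _ => ?_
  simp only [eq_comm (a := x)]
  ring

lemma ev_ind (μ : α → ℝ) (a : α) : ev μ (fun x => ind (x = a)) = μ a := by
  simpa using ev_ind_mul μ a fun _ => 1

lemma ev_mul_right (μ F : α → ℝ) (c : ℝ) : ev μ (fun x => F x * c) = ev μ F * c := by
  simp only [ev, Finset.sum_mul, mul_assoc]

lemma ev_ev_eq_sum (μ : α → ℝ) (ν : α → β → ℝ) (F : β → ℝ) :
    (ev μ fun x => ev (ν x) F) = ∑ y, (ev μ fun x => ν x y) * F y := by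
  simp only [ev, Finset.mul_sum, Finset.sum_mul]
  rw [Finset.sum_comm]
  exact Finset.sum_congr rfl fun _ _ => Finset.sum_congr rfl fun _ _ => by ring

end Marginals

/-! ### Marginals of the law seen by one user. -/

section Family

variable {Z 𝒮 κ 𝒲₀ 𝒲₁ 𝒲₂ 𝒳 𝒴 : Type*} [Fintype Z] [Fintype 𝒮] [Fintype 𝒲₀]
  [Fintype 𝒲₁] [Fintype 𝒲₂] [Fintype 𝒳]
  {f : 𝒮 → κ} {q₀ : 𝒲₀ → ℝ} {q₁ : 𝒲₀ → 𝒲₁ → ℝ} {q₂ : 𝒲₀ → 𝒲₂ → ℝ}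
  {r : 𝒮 → 𝒲₁ → 𝒲₀ → 𝒳 → ℝ} {Q : Z → ℝ}
  {S : Z → 𝒮} {W₀ : Z → 𝒲₀} {W₁ : Z → 𝒲₁} {W₂ : Z → 𝒲₂} {X : Z → 𝒳}

/-- The conditional probability of a source letter given the common part. -/
noncomputable def condSource (Q : Z → ℝ) (S : Z → 𝒮) (f : 𝒮 → κ) (s : 𝒮) : ℝ :=
  pr Q (S ⋄ fun z => f (S z)) (s, f s) / pr Q (fun z => f (S z)) (f s)

omit [Fintype 𝒮] in
lemma condSource_mul (hQ : IsProb Q) (s : 𝒮) :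
    condSource Q S f s * pr Q (fun z => f (S z)) (f s) = pr Q S s := by
  rw [condSource, div_mul_pr hQ]
  exact pr_congr fun z => by
    simp only [Prod.mk.injEq, and_iff_left_iff_imp]
    exact fun h => h ▸ rfl

/-- The law of the variables of the first user and of the interfering codeword. -/
def HasUserLaw (q₀ : 𝒲₀ → ℝ) (q₁ : 𝒲₀ → 𝒲₁ → ℝ) (q₂ : 𝒲₀ → 𝒲₂ → ℝ)
    (r : 𝒮 → 𝒲₁ → 𝒲₀ → 𝒳 → ℝ) (Q : Z → ℝ) (S : Z → 𝒮) (W₀ : Z → 𝒲₀) (W₁ : Z → 𝒲₁)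
    (W₂ : Z → 𝒲₂) (X : Z → 𝒳) : Prop :=
  ∀ s w₀ w₁ w₂ x, pr Q (S ⋄ W₀ ⋄ W₁ ⋄ W₂ ⋄ X) (s, w₀, w₁, w₂, x) =
    pr Q S s * (q₀ w₀ * (q₁ w₀ w₁ * (q₂ w₀ w₂ * r s w₁ w₀ x)))

lemma HasUserLaw.ev_eq (h : HasUserLaw q₀ q₁ q₂ r Q S W₀ W₁ W₂ X)
    (L : 𝒮 → 𝒲₀ → 𝒲₁ → 𝒲₂ → 𝒳 → ℝ) :
    ev Q (fun z => L (S z) (W₀ z) (W₁ z) (W₂ z) (X z)) =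
      ev (pr Q S) fun s => ev q₀ fun w₀ => ev (q₁ w₀) fun w₁ => ev (q₂ w₀) fun w₂ =>
        ev (r s w₁ w₀) fun x => L s w₀ w₁ w₂ x := by
  have h1 := sum_pr_mul (Q := Q) (S ⋄ W₀ ⋄ W₁ ⋄ W₂ ⋄ X) fun a =>
    L a.1 a.2.1 a.2.2.1 a.2.2.2.1 a.2.2.2.2
  rw [← h1]
  simp only [Fintype.sum_prod_type, h _ _ _ _ _, ev, Finset.mul_sum, mul_assoc]

variable (hlaw : HasUserLaw q₀ q₁ q₂ r Q S W₀ W₁ W₂ X)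

include hlaw

/-- The marginals `pr_joint₁` to `pr_joint₅` serve the five sharing patterns. Where the wrong word
has a fresh satellite, `W₁` is summed out and the input kernel is averaged over `q₁`. -/
lemma pr_joint₁ (s : 𝒮) (w₀ : 𝒲₀) (w₁ : 𝒲₁) (w₂ : 𝒲₂) (x : 𝒳) :
    pr Q ((S ⋄ X) ⋄ W₀ ⋄ W₁ ⋄ W₂ ⋄ (fun z => f (S z))) ((s, x), (w₀, w₁, w₂, f s)) =
      pr Q S s * (q₀ w₀ * (q₁ w₀ w₁ * (q₂ w₀ w₂ * r s w₁ w₀ x))) := by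
  have h1 : ∀ s' a b c d, ind (((s', d), (a, b, c, f s')) = ((s, x), (w₀, w₁, w₂, f s))) =
      ind (s' = s) * (ind (a = w₀) * (ind (b = w₁) * (ind (c = w₂) * ind (d = x)))) := by
    intros
    simp only [← ind_and]
    exact congrArg ind (propext (by grind))
  rw [pr, hlaw.ev_eq fun s' a b c d => ind (((s', d), (a, b, c, f s')) = ((s, x), (w₀, w₁, w₂, f s)))]
  simp only [h1, ev_mul_left, ev_mul_right, ev_ind_mul, ev_ind]

lemma pr_joint₂ (s : 𝒮) (w₀ : 𝒲₀) (w₁ : 𝒲₁) (w₂ : 𝒲₂) (x : 𝒳) :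
    pr Q ((S ⋄ W₂ ⋄ X) ⋄ W₀ ⋄ W₁ ⋄ (fun z => f (S z))) ((s, w₂, x), (w₀, w₁, f s)) =
      pr Q S s * (q₀ w₀ * (q₁ w₀ w₁ * (q₂ w₀ w₂ * r s w₁ w₀ x))) := by
  have h1 : ∀ s' a b c d, ind (((s', c, d), (a, b, f s')) = ((s, w₂, x), (w₀, w₁, f s))) =
      ind (s' = s) * (ind (a = w₀) * (ind (b = w₁) * (ind (c = w₂) * ind (d = x)))) := by
    intros
    simp only [← ind_and]
    exact congrArg ind (propext (by grind))
  rw [pr, hlaw.ev_eq fun s' a b c d => ind (((s', c, d), (a, b, f s')) = ((s, w₂, x), (w₀, w₁, f s)))]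
  simp only [h1, ev_mul_left, ev_mul_right, ev_ind_mul, ev_ind]

lemma pr_joint₃ (s : 𝒮) (w₀ : 𝒲₀) (w₂ : 𝒲₂) (x : 𝒳) :
    pr Q ((S ⋄ X) ⋄ W₀ ⋄ W₂ ⋄ (fun z => f (S z))) ((s, x), (w₀, w₂, f s)) =
      pr Q S s * (q₀ w₀ * (q₂ w₀ w₂ * (ev (q₁ w₀) fun w₁ => r s w₁ w₀ x))) := by
  have h1 : ∀ s' a c d, ind (((s', d), (a, c, f s')) = ((s, x), (w₀, w₂, f s))) =
      ind (s' = s) * (ind (a = w₀) * (ind (c = w₂) * ind (d = x))) := by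
    intros
    simp only [← ind_and]
    exact congrArg ind (propext (by grind))
  rw [pr, hlaw.ev_eq fun s' a _ c d => ind (((s', d), (a, c, f s')) = ((s, x), (w₀, w₂, f s)))]
  simp only [h1, ev_mul_left, ev_mul_right, ev_ind_mul, ev_ind]

lemma pr_joint₄ (s : 𝒮) (w₀ : 𝒲₀) (w₂ : 𝒲₂) (x : 𝒳) :
    pr Q ((S ⋄ W₂ ⋄ X) ⋄ W₀ ⋄ (fun z => f (S z))) ((s, w₂, x), (w₀, f s)) =
      pr Q S s * (q₀ w₀ * (q₂ w₀ w₂ * (ev (q₁ w₀) fun w₁ => r s w₁ w₀ x))) := by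
  have h1 : ∀ s' a c d, ind (((s', c, d), (a, f s')) = ((s, w₂, x), (w₀, f s))) =
      ind (s' = s) * (ind (a = w₀) * (ind (c = w₂) * ind (d = x))) := by
    intros
    simp only [← ind_and]
    exact congrArg ind (propext (by grind))
  rw [pr, hlaw.ev_eq fun s' a _ c d => ind (((s', c, d), (a, f s')) = ((s, w₂, x), (w₀, f s)))]
  simp only [h1, ev_mul_left, ev_mul_right, ev_ind_mul, ev_ind]

lemma pr_joint₅ (s : 𝒮) (w₀ : 𝒲₀) (w₂ : 𝒲₂) (x : 𝒳) :
    pr Q (W₀ ⋄ W₂ ⋄ S ⋄ X) (w₀, w₂, s, x) =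
      pr Q S s * (q₀ w₀ * (q₂ w₀ w₂ * (ev (q₁ w₀) fun w₁ => r s w₁ w₀ x))) := by
  have h1 : ∀ s' a c d, ind ((a, c, s', d) = (w₀, w₂, s, x)) =
      ind (s' = s) * (ind (a = w₀) * (ind (c = w₂) * ind (d = x))) := by
    intros
    simp only [← ind_and]
    exact congrArg ind (propext (by grind))
  rw [pr, hlaw.ev_eq fun s' a _ c d => ind ((a, c, s', d) = (w₀, w₂, s, x))]
  simp only [h1, ev_mul_left, ev_mul_right, ev_ind_mul, ev_ind]

variable (hq₀ : IsProb q₀) (hq₁ : ∀ w₀, IsProb (q₁ w₀)) (hq₂ : ∀ w₀, IsProb (q₂ w₀))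
  (hr : ∀ s w w₀, IsProb (r s w w₀))

include hq₀ hq₁ hq₂ hr

/-- Codewords are drawn without regard to the sources, so the common part is independent of them.
Dividing the matching `pr_joint` by this product leaves the codebook weights times `condSource`. -/
lemma pr_cond₁ (k : κ) (w₀ : 𝒲₀) (w₁ : 𝒲₁) (w₂ : 𝒲₂) :
    pr Q (W₀ ⋄ W₁ ⋄ W₂ ⋄ (fun z => f (S z))) (w₀, w₁, w₂, k) =
      pr Q (fun z => f (S z)) k * (q₀ w₀ * (q₁ w₀ w₁ * q₂ w₀ w₂)) := by
  have h1 : ∀ s' a b c, ind ((a, b, c, f s') = (w₀, w₁, w₂, k)) =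
      ind (f s' = k) * (ind (a = w₀) * (ind (b = w₁) * ind (c = w₂))) := by
    intros
    simp only [← ind_and]
    exact congrArg ind (propext (by grind))
  rw [pr, hlaw.ev_eq fun s' a b c _ => ind ((a, b, c, f s') = (w₀, w₁, w₂, k)), pr,
    hlaw.ev_eq fun s' _ _ _ _ => ind (f s' = k)]
  simp only [h1, ev_const (hr _ _ _), ev_const (hq₂ _), ev_const (hq₁ _), ev_const hq₀, ev_mul_left,
    ev_mul_right, ev_ind_mul, ev_ind]

lemma pr_cond₂ (k : κ) (w₀ : 𝒲₀) (w₁ : 𝒲₁) :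
    pr Q (W₀ ⋄ W₁ ⋄ (fun z => f (S z))) (w₀, w₁, k) =
      pr Q (fun z => f (S z)) k * (q₀ w₀ * q₁ w₀ w₁) := by
  have h1 : ∀ s' a b, ind ((a, b, f s') = (w₀, w₁, k)) =
      ind (f s' = k) * (ind (a = w₀) * ind (b = w₁)) := by
    intros
    simp only [← ind_and]
    exact congrArg ind (propext (by grind))
  rw [pr, hlaw.ev_eq fun s' a b _ _ => ind ((a, b, f s') = (w₀, w₁, k)), pr,
    hlaw.ev_eq fun s' _ _ _ _ => ind (f s' = k)]
  simp only [h1, ev_const (hr _ _ _), ev_const (hq₂ _), ev_const (hq₁ _), ev_const hq₀, ev_mul_left,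
    ev_mul_right, ev_ind_mul, ev_ind]

lemma pr_cond₃ (k : κ) (w₀ : 𝒲₀) (w₂ : 𝒲₂) :
    pr Q (W₀ ⋄ W₂ ⋄ (fun z => f (S z))) (w₀, w₂, k) =
      pr Q (fun z => f (S z)) k * (q₀ w₀ * q₂ w₀ w₂) := by
  have h1 : ∀ s' a c, ind ((a, c, f s') = (w₀, w₂, k)) =
      ind (f s' = k) * (ind (a = w₀) * ind (c = w₂)) := by
    intros
    simp only [← ind_and]
    exact congrArg ind (propext (by grind))
  rw [pr, hlaw.ev_eq fun s' a _ c _ => ind ((a, c, f s') = (w₀, w₂, k)), pr,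
    hlaw.ev_eq fun s' _ _ _ _ => ind (f s' = k)]
  simp only [h1, ev_const (hr _ _ _), ev_const (hq₂ _), ev_const (hq₁ _), ev_const hq₀, ev_mul_left,
    ev_mul_right, ev_ind_mul, ev_ind]

lemma pr_cond₄ (k : κ) (w₀ : 𝒲₀) :
    pr Q (W₀ ⋄ (fun z => f (S z))) (w₀, k) =
      pr Q (fun z => f (S z)) k * q₀ w₀ := by
  have h1 : ∀ s' a, ind ((a, f s') = (w₀, k)) =
      ind (f s' = k) * ind (a = w₀) := by
    intros
    simp only [← ind_and]
    exact congrArg ind (propext (by grind))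
  rw [pr, hlaw.ev_eq fun s' a _ _ _ => ind ((a, f s') = (w₀, k)), pr,
    hlaw.ev_eq fun s' _ _ _ _ => ind (f s' = k)]
  simp only [h1, ev_const (hr _ _ _), ev_const (hq₂ _), ev_const (hq₁ _), ev_const hq₀, ev_mul_left,
    ev_mul_right, ev_ind]

end Family

/-! ### The five densities and their normalisation. -/

section Family

variable {Z 𝒮 κ 𝒲₀ 𝒲₁ 𝒲₂ 𝒳 𝒴 : Type*} [Fintype Z] [Fintype 𝒮] [Fintype 𝒲₀]
  [Fintype 𝒲₁] [Fintype 𝒲₂] [Fintype 𝒳] [DecidableEq κ]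
  {f : 𝒮 → κ} {q₀ : 𝒲₀ → ℝ} {q₁ : 𝒲₀ → 𝒲₁ → ℝ} {q₂ : 𝒲₀ → 𝒲₂ → ℝ}
  {r : 𝒮 → 𝒲₁ → 𝒲₀ → 𝒳 → ℝ} {Q : Z → ℝ}
  {S : Z → 𝒮} {W₀ : Z → 𝒲₀} {W₁ : Z → 𝒲₁} {W₂ : Z → 𝒲₂} {X : Z → 𝒳}

/-- The density ratios for the five ways in which a wrong source word may share codewords with the
true one. -/
noncomputable def densities (f : 𝒮 → κ) (Q : Z → ℝ) (S : Z → 𝒮) (W₀ : Z → 𝒲₀) (W₁ : Z → 𝒲₁)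
    (W₂ : Z → 𝒲₂) (X : Z → 𝒳) (Y : Z → 𝒴) : Fin 5 → 𝒮 → 𝒲₀ → 𝒲₁ → 𝒲₂ → 𝒳 → 𝒴 → ℝ :=
  ![fun s w₀ w₁ w₂ x y => condInfoDensity Q (S ⋄ X) Y (W₀ ⋄ W₁ ⋄ W₂ ⋄ fun z => f (S z))
      (s, x) y (w₀, w₁, w₂, f s) * condSource Q S f s,
    fun s w₀ w₁ w₂ x y => condInfoDensity Q (S ⋄ W₂ ⋄ X) Y (W₀ ⋄ W₁ ⋄ fun z => f (S z))
      (s, w₂, x) y (w₀, w₁, f s) * condSource Q S f s,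
    -- A fresh satellite of the user is averaged out instead of tested: this density and the next
    -- two ignore `w₁`, so no Markov property is needed to remove `W₁` from the mutual informations.
    fun s w₀ _ w₂ x y => condInfoDensity Q (S ⋄ X) Y (W₀ ⋄ W₂ ⋄ fun z => f (S z))
      (s, x) y (w₀, w₂, f s) * condSource Q S f s,
    fun s w₀ _ w₂ x y => condInfoDensity Q (S ⋄ W₂ ⋄ X) Y (W₀ ⋄ fun z => f (S z))
      (s, w₂, x) y (w₀, f s) * condSource Q S f s,
    fun s w₀ _ w₂ x y => infoDensity Q (W₀ ⋄ W₂ ⋄ S ⋄ X) Y (w₀, w₂, s, x) y * pr Q S s]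

omit [Fintype 𝒮] [Fintype 𝒲₀] [Fintype 𝒲₁] [Fintype 𝒲₂] [Fintype 𝒳] [DecidableEq κ] in
lemma condSource_nonneg (hQ : IsProb Q) (s : 𝒮) : 0 ≤ condSource Q S f s :=
  div_nonneg (pr_nonneg hQ _ _) (pr_nonneg hQ _ _)

omit [Fintype 𝒮] [Fintype 𝒲₀] [Fintype 𝒲₁] [Fintype 𝒲₂] [Fintype 𝒳] [DecidableEq κ] in
lemma condSource_pos (hQ : IsProb Q) {z : Z} (hz : Q z ≠ 0) : 0 < condSource Q S f (S z) :=
  div_pos (pr_pos hQ (S ⋄ fun z => f (S z)) hz) (pr_pos hQ (fun z => f (S z)) hz)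

omit [Fintype 𝒮] [Fintype 𝒲₀] [Fintype 𝒲₁] [Fintype 𝒲₂] [Fintype 𝒳] [DecidableEq κ] in
lemma densities_pos (hQ : IsProb Q) (Y : Z → 𝒴) (j : Fin 5) {z : Z} (hz : Q z ≠ 0) :
    0 < densities f Q S W₀ W₁ W₂ X Y j (S z) (W₀ z) (W₁ z) (W₂ z) (X z) (Y z) := by
  fin_cases j
  · exact mul_pos (condInfoDensity_pos hQ _ _ _ hz) (condSource_pos hQ hz)
  · exact mul_pos (condInfoDensity_pos hQ _ _ _ hz) (condSource_pos hQ hz)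
  · exact mul_pos (condInfoDensity_pos hQ _ _ _ hz) (condSource_pos hQ hz)
  · exact mul_pos (condInfoDensity_pos hQ _ _ _ hz) (condSource_pos hQ hz)
  · exact mul_pos (infoDensity_pos hQ _ _ hz) (pr_pos hQ _ hz)

/-- The typical values of the densities. -/
noncomputable def densityRate (f : 𝒮 → κ) (Q : Z → ℝ) (S : Z → 𝒮) (W₀ : Z → 𝒲₀) (W₁ : Z → 𝒲₁)
    (W₂ : Z → 𝒲₂) (X : Z → 𝒳) (Y : Z → 𝒴) : Fin 5 → ℝ :=
  ![cmi Q (S ⋄ X) Y (W₀ ⋄ W₁ ⋄ W₂ ⋄ fun z => f (S z)) - condEnt Q S fun z => f (S z),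
    cmi Q (S ⋄ W₂ ⋄ X) Y (W₀ ⋄ W₁ ⋄ fun z => f (S z)) - condEnt Q S fun z => f (S z),
    cmi Q (S ⋄ X) Y (W₀ ⋄ W₂ ⋄ fun z => f (S z)) - condEnt Q S fun z => f (S z),
    cmi Q (S ⋄ W₂ ⋄ X) Y (W₀ ⋄ fun z => f (S z)) - condEnt Q S fun z => f (S z),
    mi Q (W₀ ⋄ W₂ ⋄ S ⋄ X) Y - ent Q S]

omit [Fintype 𝒮] [Fintype 𝒲₀] [Fintype 𝒲₁] [Fintype 𝒲₂] [Fintype 𝒳] [DecidableEq κ] in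
lemma densityRate_eq (hQ : IsProb Q) (Y : Z → 𝒴) (j : Fin 5) :
    densityRate f Q S W₀ W₁ W₂ X Y j = ev Q fun z =>
      Real.log (densities f Q S W₀ W₁ W₂ X Y j (S z) (W₀ z) (W₁ z) (W₂ z) (X z) (Y z)) := by
  have hmul : ∀ F G : Z → ℝ, (∀ z, Q z ≠ 0 → 0 < F z) → (∀ z, Q z ≠ 0 → 0 < G z) →
      (ev Q fun z => Real.log (F z)) - -(ev Q fun z => Real.log (G z)) =
        ev Q fun z => Real.log (F z * G z) := by
    intro F G hF hG
    rw [sub_neg_eq_add, ← ev_add]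
    exact ev_congr_supp fun z hz => (Real.log_mul (hF z hz).ne' (hG z hz).ne').symm
  fin_cases j
  · exact hmul _ _ (fun _ => condInfoDensity_pos hQ _ _ _) fun _ => condSource_pos hQ
  · exact hmul _ _ (fun _ => condInfoDensity_pos hQ _ _ _) fun _ => condSource_pos hQ
  · exact hmul _ _ (fun _ => condInfoDensity_pos hQ _ _ _) fun _ => condSource_pos hQ
  · exact hmul _ _ (fun _ => condInfoDensity_pos hQ _ _ _) fun _ => condSource_pos hQ
  · exact hmul _ _ (fun _ => infoDensity_pos hQ _ _) fun _ => pr_pos hQ _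

omit [Fintype 𝒮] [Fintype 𝒲₀] [Fintype 𝒲₁] [Fintype 𝒲₂] [Fintype 𝒳] [DecidableEq κ] in
lemma pr_div_nonneg {A B : Type*} (hQ : IsProb Q) (U : Z → A) (V : Z → B) (a : A) (b : B) :
    0 ≤ pr Q (U ⋄ V) (a, b) / pr Q V b :=
  div_nonneg (pr_nonneg hQ _ _) (pr_nonneg hQ _ _)

omit [DecidableEq κ] in
lemma sum_filter_le_sum (a : 𝒮 → Prop) [DecidablePred a] {F : 𝒮 → ℝ} (hF : ∀ s, 0 ≤ F s) :
    ∑ s with a s, F s ≤ ∑ s, F s :=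
  Finset.sum_le_sum_of_subset_of_nonneg (Finset.filter_subset _ _) fun s _ _ => hF s

variable (hQ : IsProb Q) (hlaw : HasUserLaw q₀ q₁ q₂ r Q S W₀ W₁ W₂ X)
  (hq₀ : IsProb q₀) (hq₁ : ∀ w₀, IsProb (q₁ w₀)) (hq₂ : ∀ w₀, IsProb (q₂ w₀))
  (hr : ∀ s w w₀, IsProb (r s w w₀)) (Y : Z → 𝒴)

include hQ hlaw hq₀ hq₁ hq₂ hr

/-- Codebook weight times `p(s|k)` is the conditional law of source letter and input, so each
summand is at most a posterior probability given the output. Posteriors sum to at most one, also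
after dropping the restriction to the fibre of `k`. The other four bounds have the same pattern. -/
lemma sum_density₁_le (k : κ) (w₀ : 𝒲₀) (w₁ : 𝒲₁) (w₂ : 𝒲₂) (y : 𝒴) :
    ∑ s with f s = k, ev (r s w₁ w₀) (fun x =>
      condInfoDensity Q (S ⋄ X) Y (W₀ ⋄ W₁ ⋄ W₂ ⋄ fun z => f (S z)) (s, x) y (w₀, w₁, w₂, f s) *
        condSource Q S f s) ≤ 1 := by
  set V := W₀ ⋄ W₁ ⋄ W₂ ⋄ fun z => f (S z) with hV
  refine le_trans (b := ∑ s with f s = k, ∑ x, pr Q ((S ⋄ X) ⋄ Y ⋄ V)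
    ((s, x), y, (w₀, w₁, w₂, k)) / pr Q (Y ⋄ V) (y, (w₀, w₁, w₂, k))) ?_ ?_
  · refine Finset.sum_le_sum fun s hs => Finset.sum_le_sum fun x _ => ?_
    obtain rfl := (Finset.mem_filter.1 hs).2
    refine mul_condInfoDensity_le hQ (S ⋄ X) Y V y ?_
    rw [hV, pr_joint₁ hlaw, pr_cond₁ hlaw hq₀ hq₁ hq₂ hr, ← condSource_mul (f := f) hQ]
    ring
  · refine (sum_filter_le_sum _ fun s => Finset.sum_nonneg fun x _ =>
      pr_div_nonneg hQ (S ⋄ X) (Y ⋄ V) (s, x) (y, _)).trans ?_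
    have h := sum_pr_div_le (Q := Q) (S ⋄ X) (Y ⋄ V) (y, (w₀, w₁, w₂, k))
    simpa only [Fintype.sum_prod_type] using h

lemma sum_density₂_le (k : κ) (w₀ : 𝒲₀) (w₁ : 𝒲₁) (y : 𝒴) :
    ∑ s with f s = k, ev (r s w₁ w₀) (fun x => ev (q₂ w₀) fun w₂ =>
      condInfoDensity Q (S ⋄ W₂ ⋄ X) Y (W₀ ⋄ W₁ ⋄ fun z => f (S z)) (s, w₂, x) y (w₀, w₁, f s) *
        condSource Q S f s) ≤ 1 := by
  set V := W₀ ⋄ W₁ ⋄ fun z => f (S z) with hV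
  refine le_trans (b := ∑ s with f s = k, ∑ w₂, ∑ x, pr Q ((S ⋄ W₂ ⋄ X) ⋄ Y ⋄ V)
    ((s, w₂, x), y, (w₀, w₁, k)) / pr Q (Y ⋄ V) (y, (w₀, w₁, k))) ?_ ?_
  · refine Finset.sum_le_sum fun s hs => ?_
    obtain rfl := (Finset.mem_filter.1 hs).2
    rw [ev_comm]
    refine Finset.sum_le_sum fun w₂ _ => (Finset.mul_sum _ _ _).trans_le
      (Finset.sum_le_sum fun x _ => (mul_assoc _ _ _).symm.trans_le ?_)
    refine mul_condInfoDensity_le hQ (S ⋄ W₂ ⋄ X) Y V y ?_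
    rw [hV, pr_joint₂ hlaw, pr_cond₂ hlaw hq₀ hq₁ hq₂ hr, ← condSource_mul (f := f) hQ]
    ring
  · refine (sum_filter_le_sum _ fun s => Finset.sum_nonneg fun w₂ _ => Finset.sum_nonneg fun x _ =>
      pr_div_nonneg hQ (S ⋄ W₂ ⋄ X) (Y ⋄ V) (s, w₂, x) (y, _)).trans ?_
    have h := sum_pr_div_le (Q := Q) (S ⋄ W₂ ⋄ X) (Y ⋄ V) (y, (w₀, w₁, k))
    simpa only [Fintype.sum_prod_type] using h

lemma sum_density₃_le (k : κ) (w₀ : 𝒲₀) (w₂ : 𝒲₂) (y : 𝒴) :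
    ∑ s with f s = k, ev (q₁ w₀) (fun w₁ => ev (r s w₁ w₀) fun x =>
      condInfoDensity Q (S ⋄ X) Y (W₀ ⋄ W₂ ⋄ fun z => f (S z)) (s, x) y (w₀, w₂, f s) *
        condSource Q S f s) ≤ 1 := by
  set V := W₀ ⋄ W₂ ⋄ fun z => f (S z) with hV
  refine le_trans (b := ∑ s with f s = k, ∑ x, pr Q ((S ⋄ X) ⋄ Y ⋄ V)
    ((s, x), y, (w₀, w₂, k)) / pr Q (Y ⋄ V) (y, (w₀, w₂, k))) ?_ ?_
  · refine Finset.sum_le_sum fun s hs => ?_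
    obtain rfl := (Finset.mem_filter.1 hs).2
    rw [ev_ev_eq_sum]
    refine Finset.sum_le_sum fun x _ => mul_condInfoDensity_le hQ (S ⋄ X) Y V y ?_
    rw [hV, pr_joint₃ hlaw, pr_cond₃ hlaw hq₀ hq₁ hq₂ hr, ← condSource_mul (f := f) hQ]
    ring
  · refine (sum_filter_le_sum _ fun s => Finset.sum_nonneg fun x _ =>
      pr_div_nonneg hQ (S ⋄ X) (Y ⋄ V) (s, x) (y, _)).trans ?_
    have h := sum_pr_div_le (Q := Q) (S ⋄ X) (Y ⋄ V) (y, (w₀, w₂, k))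
    simpa only [Fintype.sum_prod_type] using h

omit [Fintype Z] [Fintype 𝒮] [Fintype 𝒲₀] [DecidableEq κ] hQ hlaw hq₀ hq₁ hq₂ hr in
lemma ev_ev_ev_eq_sum (s : 𝒮) (w₀ : 𝒲₀) (F : 𝒲₂ → 𝒳 → ℝ) :
    (ev (q₁ w₀) fun w₁ => ev (r s w₁ w₀) fun x => ev (q₂ w₀) fun w₂ => F w₂ x) =
      ∑ w₂, ∑ x, (q₂ w₀ w₂ * ev (q₁ w₀) fun w₁ => r s w₁ w₀ x) * F w₂ x := by
  rw [ev_ev_eq_sum]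
  change ∑ x, (ev (q₁ w₀) fun w₁ => r s w₁ w₀ x) * ∑ w₂, q₂ w₀ w₂ * F w₂ x = _
  simp only [Finset.mul_sum]
  rw [Finset.sum_comm]
  exact Finset.sum_congr rfl fun _ _ => Finset.sum_congr rfl fun _ _ => by ring

lemma sum_density₄_le (k : κ) (w₀ : 𝒲₀) (y : 𝒴) :
    ∑ s with f s = k, ev (q₁ w₀) (fun w₁ => ev (r s w₁ w₀) fun x => ev (q₂ w₀) fun w₂ =>
      condInfoDensity Q (S ⋄ W₂ ⋄ X) Y (W₀ ⋄ fun z => f (S z)) (s, w₂, x) y (w₀, f s) *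
        condSource Q S f s) ≤ 1 := by
  set V := W₀ ⋄ fun z => f (S z) with hV
  refine le_trans (b := ∑ s with f s = k, ∑ w₂, ∑ x, pr Q ((S ⋄ W₂ ⋄ X) ⋄ Y ⋄ V)
    ((s, w₂, x), y, (w₀, k)) / pr Q (Y ⋄ V) (y, (w₀, k))) ?_ ?_
  · refine Finset.sum_le_sum fun s hs => ?_
    obtain rfl := (Finset.mem_filter.1 hs).2
    rw [ev_ev_ev_eq_sum s w₀ fun w₂ x =>
      condInfoDensity Q (S ⋄ W₂ ⋄ X) Y V (s, w₂, x) y (w₀, f s) * condSource Q S f s]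
    refine Finset.sum_le_sum fun w₂ _ => Finset.sum_le_sum fun x _ =>
      mul_condInfoDensity_le hQ (S ⋄ W₂ ⋄ X) Y V y ?_
    rw [hV, pr_joint₄ hlaw, pr_cond₄ hlaw hq₀ hq₁ hq₂ hr, ← condSource_mul (f := f) hQ]
    ring
  · refine (sum_filter_le_sum _ fun s => Finset.sum_nonneg fun w₂ _ => Finset.sum_nonneg fun x _ =>
      pr_div_nonneg hQ (S ⋄ W₂ ⋄ X) (Y ⋄ V) (s, w₂, x) (y, _)).trans ?_
    have h := sum_pr_div_le (Q := Q) (S ⋄ W₂ ⋄ X) (Y ⋄ V) (y, (w₀, k))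
    simpa only [Fintype.sum_prod_type] using h

omit [DecidableEq κ] hq₀ hq₁ hq₂ hr in
lemma sum_density₅_le (y : 𝒴) :
    ∑ s, ev q₀ (fun w₀ => ev (q₁ w₀) fun w₁ => ev (r s w₁ w₀) fun x => ev (q₂ w₀) fun w₂ =>
      infoDensity Q (W₀ ⋄ W₂ ⋄ S ⋄ X) Y (w₀, w₂, s, x) y * pr Q S s) ≤ 1 := by
  refine le_trans (b := ∑ s, ∑ w₀, ∑ w₂, ∑ x, pr Q ((W₀ ⋄ W₂ ⋄ S ⋄ X) ⋄ Y)
    ((w₀, w₂, s, x), y) / pr Q Y y) ?_ ?_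
  · refine Finset.sum_le_sum fun s _ => Finset.sum_le_sum fun w₀ _ => ?_
    beta_reduce
    rw [ev_ev_ev_eq_sum s w₀ fun w₂ x =>
      infoDensity Q (W₀ ⋄ W₂ ⋄ S ⋄ X) Y (w₀, w₂, s, x) y * pr Q S s, Finset.mul_sum]
    refine Finset.sum_le_sum fun w₂ _ => ?_
    rw [Finset.mul_sum]
    refine Finset.sum_le_sum fun x _ => ?_
    rw [← mul_assoc]
    refine mul_infoDensity_le hQ (W₀ ⋄ W₂ ⋄ S ⋄ X) Y y ?_
    rw [pr_joint₅ hlaw]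
    ring
  · have h := sum_pr_div_le (Q := Q) (W₀ ⋄ W₂ ⋄ S ⋄ X) Y y
    simp only [Fintype.sum_prod_type] at h
    refine le_trans (le_of_eq ?_) h
    rw [Finset.sum_comm]
    exact Finset.sum_congr rfl fun w₀ _ => Finset.sum_comm

lemma isDensityFamily_densities : IsDensityFamily f q₀ q₁ q₂ r (densities f Q S W₀ W₁ W₂ X Y) where
  nonneg j s w₀ w₁ w₂ x y := by
    fin_cases j
    · exact mul_nonneg (condInfoDensity_nonneg hQ _ _ _ _ _ _) (condSource_nonneg hQ _)
    · exact mul_nonneg (condInfoDensity_nonneg hQ _ _ _ _ _ _) (condSource_nonneg hQ _)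
    · exact mul_nonneg (condInfoDensity_nonneg hQ _ _ _ _ _ _) (condSource_nonneg hQ _)
    · exact mul_nonneg (condInfoDensity_nonneg hQ _ _ _ _ _ _) (condSource_nonneg hQ _)
    · exact mul_nonneg (infoDensity_nonneg hQ _ _ _ _) (pr_nonneg hQ _ _)
  b₁ := sum_density₁_le hQ hlaw hq₀ hq₁ hq₂ hr Y
  b₂ := sum_density₂_le hQ hlaw hq₀ hq₁ hq₂ hr Y
  b₃ := sum_density₃_le hQ hlaw hq₀ hq₁ hq₂ hr Y
  b₄ := sum_density₄_le hQ hlaw hq₀ hq₁ hq₂ hr Y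
  b₅ := sum_density₅_le hQ hlaw Y

end Family

/-- Fourier–Motzkin elimination of the two partition rates. -/
lemma exists_rates {A B C D E A' B' C' D' E' a b s t : ℝ}
    (hAB : A ≤ B) (hEC : E ≤ C) (hAB' : A' ≤ B') (hEC' : E' ≤ C')
    (h1 : a < E) (h2 : b < E') (h3 : s < D) (h4 : t < D') (h5 : a + b < A + C')
    (h6 : a + b < A' + C) (h7 : a + b < B + B') (h8 : a + t < D' + A) (h9 : s + b < D + A')
    (h10 : 2 * a + b < A + C + B') (h11 : a + 2 * b < A' + C' + B)
    (h12 : s + a + b < A + D + B') (h13 : t + a + b < A' + D' + B) :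
    ∃ R₁ R₂ : ℝ, 0 < R₁ ∧ 0 < R₂ ∧ 0 < A - a + R₁ ∧ 0 < B - a + R₁ - R₂ ∧ 0 < C - a - R₂ ∧
      0 < D - s - R₂ ∧ 0 < A' - b + R₂ ∧ 0 < B' - b + R₂ - R₁ ∧ 0 < C' - b - R₁ ∧
      0 < D' - t - R₁ := by
  -- The bounds `b - B'`, `a + b - A - B'` from below and `B + C' - a - b`, `B + D' - a - t` from
  -- above arise by pairing bounds on `R₁` that leave `R₂` behind; the rest are the direct
  -- constraints on `R₂`.
  obtain ⟨R₂, hl, hu⟩ : ∃ R₂ : ℝ, max (max 0 (b - A')) (max (b - B') (a + b - A - B')) < R₂ ∧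
      R₂ < min (min (C - a) (D - s)) (min (B + C' - a - b) (B + D' - a - t)) := by
    refine exists_between ?_
    simp only [max_lt_iff, lt_min_iff]
    -- Sixteen comparisons. Those that are not hypotheses follow from them by the monotonicities `A
    -- ≤ B`, `E ≤ C` and their primed forms, or, for `a + b - A - B'` against the last two upper
    -- bounds, by adding `h7` to `h5` or `h8`.
    refine ⟨⟨⟨⟨?_, ?_⟩, ?_, ?_⟩, ⟨?_, ?_⟩, ?_, ?_⟩, ⟨⟨?_, ?_⟩, ?_, ?_⟩, ⟨?_, ?_⟩, ?_, ?_⟩ <;>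
      linarith
  simp only [max_lt_iff, lt_min_iff] at hl hu
  obtain ⟨⟨l1, l2⟩, l3, l4⟩ := hl
  obtain ⟨⟨u1, u2⟩, u3, u4⟩ := hu
  obtain ⟨R₁, hl, hu⟩ : ∃ R₁ : ℝ, max 0 (max (a - A) (a + R₂ - B)) < R₁ ∧
      R₁ < min (B' - b + R₂) (min (C' - b) (D' - t)) := by
    refine exists_between ?_
    simp only [max_lt_iff, lt_min_iff]
    refine ⟨⟨?_, ?_, ?_⟩, ⟨?_, ?_, ?_⟩, ?_, ?_, ?_⟩ <;> linarith
  simp only [max_lt_iff, lt_min_iff] at hl hu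
  obtain ⟨m1, m2, m3⟩ := hl
  obtain ⟨n1, n2, n3⟩ := hu
  exact ⟨R₁, R₂, m1, l1, by linarith, by linarith, by linarith, by linarith, by linarith,
    by linarith, by linarith, by linarith⟩

lemma isProb_toReal {α : Type*} [Fintype α] (μ : PMF α) : IsProb fun x => (μ x).toReal where
  nonneg _ := ENNReal.toReal_nonneg
  sum_one := by
    rw [← ENNReal.toReal_sum fun x _ => μ.apply_ne_top x, ← tsum_fintype (L := .unconditional _),
      μ.tsum_coe, ENNReal.toReal_one]

/-! ### Replacing a conditioning variable by one that agrees on the support. -/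

section CommonPart

variable {Z A B C D : Type*} [Fintype Z] {Q : Z → ℝ} {V V' : Z → C}

lemma condEnt_congr_supp (h : ∀ z, Q z ≠ 0 → V z = V' z) (U : Z → A) :
    condEnt Q U V = condEnt Q U V' := by
  unfold condEnt
  refine congrArg _ (ev_congr_supp fun z hz => ?_)
  rw [h z hz, pr_congr_supp h, pr_congr_supp fun z hz => show (U ⋄ V) z = (U ⋄ V') z from
    congrArg (Prod.mk _) (h z hz)]

lemma cmi_congr_supp (h : ∀ z, Q z ≠ 0 → V z = V' z) (U : Z → A) (Y : Z → B) :
    cmi Q U Y V = cmi Q U Y V' := by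
  refine ev_congr_supp fun z hz => ?_
  unfold condInfoDensity
  rw [h z hz, pr_congr_supp h,
    pr_congr_supp fun z hz => show (U ⋄ V) z = (U ⋄ V') z from congrArg (Prod.mk _) (h z hz),
    pr_congr_supp fun z hz => show (Y ⋄ V) z = (Y ⋄ V') z from congrArg (Prod.mk _) (h z hz),
    pr_congr_supp fun z hz => show (U ⋄ Y ⋄ V) z = (U ⋄ Y ⋄ V') z from
      congrArg (fun v => (U z, Y z, v)) (h z hz)]

end CommonPart

/-! ### Each user's marginal of the joint law. -/

section SystemLaw

variable {𝒮 𝒯 𝒲₀ 𝒲₁ 𝒲₂ 𝒳₁ 𝒳₂ 𝒴 : Type*} [Fintype 𝒮] [Fintype 𝒯] [Fintype 𝒲₀]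
  [Fintype 𝒲₁] [Fintype 𝒲₂] [Fintype 𝒳₁] [Fintype 𝒳₂] [Fintype 𝒴]
  {p : 𝒮 × 𝒯 → ℝ} {q₀ : 𝒲₀ → ℝ} {q₁ : 𝒲₀ → 𝒲₁ → ℝ} {q₂ : 𝒲₀ → 𝒲₂ → ℝ}
  {r₁ : 𝒮 → 𝒲₁ → 𝒲₀ → 𝒳₁ → ℝ} {r₂ : 𝒯 → 𝒲₂ → 𝒲₀ → 𝒳₂ → ℝ} {c : 𝒳₁ → 𝒳₂ → 𝒴 → ℝ}

/-- The other source letter enters only through the other user's input kernel and the channel, which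
sum to one. On the event `st.1 = s` the remaining kernel can be evaluated at `s` and leaves the
average over source pairs. -/
lemma IsSystem.hasUserLaw₁ (h : IsSystem p q₀ q₁ q₂ r₁ r₂ c) :
    HasUserLaw q₀ q₁ q₂ r₁ (systemLaw p q₀ q₁ q₂ r₁ r₂ c) (fun z => z.1.1.1.1.1.1.1)
      (fun z => z.1.1.1.1.1.2) (fun z => z.1.1.1.1.2) (fun z => z.1.1.2) (fun z => z.1.1.1.2) := by
  intro s w₀ w₁ w₂ x
  have h1 : ∀ (st : 𝒮 × 𝒯) a b d e, ind ((st.1, a, b, e, d) = (s, w₀, w₁, w₂, x)) =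
      ind (st.1 = s) * (ind (a = w₀) * (ind (b = w₁) * (ind (d = x) * ind (e = w₂)))) := by
    intros
    simp only [← ind_and]
    exact congrArg ind (propext (by grind))
  have h2 : ∀ st : 𝒮 × 𝒯, ind (st.1 = s) * r₁ st.1 w₁ w₀ x = ind (st.1 = s) * r₁ s w₁ w₀ x := by
    intro st
    by_cases hs : st.1 = s
    · rw [hs]
    · rw [ind_of_not hs, zero_mul, zero_mul]
  have h3 : ∀ (st : 𝒮 × 𝒯), ind (st.1 = s) * (q₀ w₀ * (q₁ w₀ w₁ * (r₁ st.1 w₁ w₀ x * q₂ w₀ w₂))) =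
      ind (st.1 = s) * (q₀ w₀ * (q₁ w₀ w₁ * (q₂ w₀ w₂ * r₁ s w₁ w₀ x))) := by
    intro st
    linear_combination (q₀ w₀ * q₁ w₀ w₁ * q₂ w₀ w₂) * h2 st
  simp only [pr, systemLaw, ev_joint', h1, ev_const (h.hr₁ _ _ _), ev_const (h.hr₂ _ _ _),
    ev_const (h.hq₂ _), ev_const (h.hq₁ _), ev_const h.hq₀, ev_const (h.hc _ _), ev_mul_left,
    ev_ind_mul, ev_ind, h3]
  rw [ev_mul_right]

lemma IsSystem.hasUserLaw₂ (h : IsSystem p q₀ q₁ q₂ r₁ r₂ c) :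
    HasUserLaw q₀ q₂ q₁ r₂ (systemLaw p q₀ q₁ q₂ r₁ r₂ c) (fun z => z.1.1.1.1.1.1.2)
      (fun z => z.1.1.1.1.1.2) (fun z => z.1.1.2) (fun z => z.1.1.1.1.2) (fun z => z.1.2) := by
  intro t w₀ w₂ w₁ x
  have h1 : ∀ (st : 𝒮 × 𝒯) a b d e, ind ((st.2, a, d, b, e) = (t, w₀, w₂, w₁, x)) =
      ind (st.2 = t) * (ind (a = w₀) * (ind (b = w₁) * (ind (d = w₂) * ind (e = x)))) := by
    intros
    simp only [← ind_and]
    exact congrArg ind (propext (by grind))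
  have h2 : ∀ st : 𝒮 × 𝒯, ind (st.2 = t) * r₂ st.2 w₂ w₀ x = ind (st.2 = t) * r₂ t w₂ w₀ x := by
    intro st
    by_cases hs : st.2 = t
    · rw [hs]
    · rw [ind_of_not hs, zero_mul, zero_mul]
  have h3 : ∀ (st : 𝒮 × 𝒯), ind (st.2 = t) * (q₀ w₀ * (q₁ w₀ w₁ * (q₂ w₀ w₂ * r₂ st.2 w₂ w₀ x))) =
      ind (st.2 = t) * (q₀ w₀ * (q₂ w₀ w₂ * (q₁ w₀ w₁ * r₂ t w₂ w₀ x))) := by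
    intro st
    linear_combination (q₀ w₀ * q₁ w₀ w₁ * q₂ w₀ w₂) * h2 st
  simp only [pr, systemLaw, ev_joint', h1, ev_const (h.hr₁ _ _ _), ev_const (h.hr₂ _ _ _),
    ev_const (h.hq₂ _), ev_const (h.hq₁ _), ev_const h.hq₀, ev_const (h.hc _ _), ev_mul_left,
    ev_ind_mul, ev_ind, h3]
  rw [ev_mul_right]

end SystemLaw

/-! ### Error probabilities as expectations. -/

section ErrorProb

variable {𝒮 𝒯 𝒳₁ 𝒳₂ 𝒴₁ 𝒴₂ : Type*} [Fintype 𝒮] [Fintype 𝒯] [Fintype 𝒴₁] [Fintype 𝒴₂] {n : ℕ}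
  (p : PMF (𝒮 × 𝒯)) (ch : 𝒳₁ → 𝒳₂ → PMF (𝒴₁ × 𝒴₂)) (c : BlockCode 𝒮 𝒯 𝒳₁ 𝒳₂ 𝒴₁ 𝒴₂ n)

lemma errorProb₁_eq_ev : errorProb₁ p ch c =
    ev (pairw fun _ => fun st => (p st).toReal) fun st =>
      ev (pairw fun i => fun y => (ch (c.f₁ st.1 i) (c.f₂ st.2 i) y).toReal) fun y =>
        ind (c.φ₁ y.1 ≠ st.1) := by
  simp only [errorProb₁, systemProb, ev, pairw, Fintype.sum_prod_type, Finset.mul_sum]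
  refine Finset.sum_congr rfl fun s _ => Finset.sum_congr rfl fun t _ =>
    Finset.sum_congr rfl fun y₁ _ => Finset.sum_congr rfl fun y₂ _ => ?_
  by_cases h : c.φ₁ y₁ = s <;> simp [h, ind]

lemma errorProb₂_eq_ev : errorProb₂ p ch c =
    ev (pairw fun _ => fun st => (p st).toReal) fun st =>
      ev (pairw fun i => fun y => (ch (c.f₁ st.1 i) (c.f₂ st.2 i) y).toReal) fun y =>
        ind (c.φ₂ y.2 ≠ st.2) := by
  simp only [errorProb₂, systemProb, ev, pairw, Fintype.sum_prod_type, Finset.mul_sum]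
  refine Finset.sum_congr rfl fun s _ => Finset.sum_congr rfl fun t _ =>
    Finset.sum_congr rfl fun y₁ _ => Finset.sum_congr rfl fun y₂ _ => ?_
  by_cases h : c.φ₂ y₂ = t <;> simp [h, ind]

end ErrorProb

lemma cmi_congr_right {Z A B C C' : Type*} [Fintype Z] {Q : Z → ℝ} (U : Z → A) (Y : Z → B)
    {V : Z → C} {V' : Z → C'} (h : ∀ z z', V z = V z' ↔ V' z = V' z') :
    cmi Q U Y V = cmi Q U Y V' := by
  unfold cmi
  refine congrArg _ (funext fun z => ?_)
  unfold condInfoDensity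
  rw [pr_congr (φ := U ⋄ Y ⋄ V) (ψ := U ⋄ Y ⋄ V') (b := (U z, Y z, V' z)) fun z' => by
      simp only [Prod.mk.injEq, h],
    pr_congr (φ := U ⋄ V) (ψ := U ⋄ V') (b := (U z, V' z)) fun z' => by
      simp only [Prod.mk.injEq, h],
    pr_congr (φ := Y ⋄ V) (ψ := Y ⋄ V') (b := (Y z, V' z)) fun z' => by
      simp only [Prod.mk.injEq, h],
    pr_congr (φ := V) (ψ := V') (b := V' z) fun z' => h z' z]

/-! ### From the thirteen inequalities to partition rates. -/

section Rates

variable {𝒮 𝒯 𝒲₀ 𝒲₁ 𝒲₂ 𝒳₁ 𝒳₂ 𝒴₁ 𝒴₂ κ Z : Type*} [Fintype 𝒮] [Fintype 𝒯] [Fintype 𝒲₀]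
  [Fintype 𝒲₁] [Fintype 𝒲₂] [Fintype 𝒳₁] [Fintype 𝒳₂] [Fintype 𝒴₁] [Fintype 𝒴₂] [Fintype κ]
  [Fintype Z]

lemma exists_rates_of_inequalities {Ω : Type*} {P : PMF Ω} {τ : Ω → Z} {Q : Z → ℝ}
    (hQp : IsProb Q) (hQ : ∀ z, (P.map τ z).toReal = Q z) {f : 𝒮 → κ} {g : 𝒯 → κ}
    (s : Z → 𝒮) (t : Z → 𝒯) (w₀ : Z → 𝒲₀) (w₁ : Z → 𝒲₁) (w₂ : Z → 𝒲₂) (x₁ : Z → 𝒳₁)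
    (x₂ : Z → 𝒳₂) (y₁ : Z → 𝒴₁) (y₂ : Z → 𝒴₂) (hk : ∀ z, Q z ≠ 0 → f (s z) = g (t z))
    {S : Ω → 𝒮} {T : Ω → 𝒯} {W₀ : Ω → 𝒲₀} {W₁ : Ω → 𝒲₁} {W₂ : Ω → 𝒲₂}
    {X₁ : Ω → 𝒳₁} {X₂ : Ω → 𝒳₂} {Y₁ : Ω → 𝒴₁} {Y₂ : Ω → 𝒴₂} {K : Ω → κ}
    (hS : S = fun ω => s (τ ω)) (hT : T = fun ω => t (τ ω)) (hW₀ : W₀ = fun ω => w₀ (τ ω))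
    (hW₁ : W₁ = fun ω => w₁ (τ ω)) (hW₂ : W₂ = fun ω => w₂ (τ ω)) (hX₁ : X₁ = fun ω => x₁ (τ ω))
    (hX₂ : X₂ = fun ω => x₂ (τ ω)) (hY₁ : Y₁ = fun ω => y₁ (τ ω)) (hY₂ : Y₂ = fun ω => y₂ (τ ω))
    (hK : K = fun ω => f (S ω))
    (h1 : condEntropy P S K < condMutualInfo P (S ⋄ X₁) Y₁ (W₀ ⋄ W₂ ⋄ K))
    (h2 : condEntropy P T K < condMutualInfo P (T ⋄ X₂) Y₂ (W₀ ⋄ W₁ ⋄ K))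
    (h3 : entropy P S < mutualInfo P (W₀ ⋄ W₂ ⋄ S ⋄ X₁) Y₁)
    (h4 : entropy P T < mutualInfo P (W₀ ⋄ W₁ ⋄ T ⋄ X₂) Y₂)
    (h5 : condEntropy P S K + condEntropy P T K <
      condMutualInfo P (S ⋄ X₁) Y₁ (W₀ ⋄ W₁ ⋄ W₂ ⋄ K) +
        condMutualInfo P (W₁ ⋄ T ⋄ X₂) Y₂ (W₀ ⋄ K))
    (h6 : condEntropy P S K + condEntropy P T K <
      condMutualInfo P (T ⋄ X₂) Y₂ (W₀ ⋄ W₁ ⋄ W₂ ⋄ K) +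
        condMutualInfo P (W₂ ⋄ S ⋄ X₁) Y₁ (W₀ ⋄ K))
    (h7 : condEntropy P S K + condEntropy P T K <
      condMutualInfo P (S ⋄ W₂ ⋄ X₁) Y₁ (W₀ ⋄ W₁ ⋄ K) +
        condMutualInfo P (T ⋄ W₁ ⋄ X₂) Y₂ (W₀ ⋄ W₂ ⋄ K))
    (h8 : condEntropy P S K + entropy P T <
      mutualInfo P (W₀ ⋄ W₁ ⋄ T ⋄ X₂) Y₂ +
        condMutualInfo P (S ⋄ X₁) Y₁ (W₀ ⋄ W₁ ⋄ W₂ ⋄ K))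
    (h9 : entropy P S + condEntropy P T K <
      mutualInfo P (W₀ ⋄ W₂ ⋄ S ⋄ X₁) Y₁ +
        condMutualInfo P (T ⋄ X₂) Y₂ (W₀ ⋄ W₁ ⋄ W₂ ⋄ K))
    (h10 : 2 * condEntropy P S K + condEntropy P T K <
      condMutualInfo P (S ⋄ X₁) Y₁ (W₀ ⋄ W₁ ⋄ W₂ ⋄ K) +
        condMutualInfo P (S ⋄ W₂ ⋄ X₁) Y₁ (W₀ ⋄ K) +
        condMutualInfo P (T ⋄ W₁ ⋄ X₂) Y₂ (W₀ ⋄ W₂ ⋄ K))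
    (h11 : condEntropy P S K + 2 * condEntropy P T K <
      condMutualInfo P (T ⋄ X₂) Y₂ (W₀ ⋄ W₁ ⋄ W₂ ⋄ K) +
        condMutualInfo P (T ⋄ W₁ ⋄ X₂) Y₂ (W₀ ⋄ K) +
        condMutualInfo P (S ⋄ W₂ ⋄ X₁) Y₁ (W₀ ⋄ W₁ ⋄ K))
    (h12 : entropy P S + condEntropy P S K + condEntropy P T K <
      condMutualInfo P (S ⋄ X₁) Y₁ (W₀ ⋄ W₁ ⋄ W₂ ⋄ K) +
        mutualInfo P (W₀ ⋄ W₂ ⋄ S ⋄ X₁) Y₁ +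
        condMutualInfo P (T ⋄ W₁ ⋄ X₂) Y₂ (W₀ ⋄ W₂ ⋄ K))
    (h13 : entropy P T + condEntropy P S K + condEntropy P T K <
      condMutualInfo P (T ⋄ X₂) Y₂ (W₀ ⋄ W₁ ⋄ W₂ ⋄ K) +
        mutualInfo P (W₀ ⋄ W₁ ⋄ T ⋄ X₂) Y₂ +
        condMutualInfo P (S ⋄ W₂ ⋄ X₁) Y₁ (W₀ ⋄ W₁ ⋄ K)) :
    ∃ R₁ R₂ : ℝ, 0 < R₁ ∧ 0 < R₂ ∧
      0 < densityRate f Q s w₀ w₁ w₂ x₁ y₁ 0 + R₁ ∧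
      0 < densityRate f Q s w₀ w₁ w₂ x₁ y₁ 1 + R₁ - R₂ ∧
      0 < densityRate f Q s w₀ w₁ w₂ x₁ y₁ 2 ∧
      0 < densityRate f Q s w₀ w₁ w₂ x₁ y₁ 3 - R₂ ∧
      0 < densityRate f Q s w₀ w₁ w₂ x₁ y₁ 4 - R₂ ∧
      0 < densityRate g Q t w₀ w₂ w₁ x₂ y₂ 0 + R₂ ∧
      0 < densityRate g Q t w₀ w₂ w₁ x₂ y₂ 1 + R₂ - R₁ ∧
      0 < densityRate g Q t w₀ w₂ w₁ x₂ y₂ 2 ∧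
      0 < densityRate g Q t w₀ w₂ w₁ x₂ y₂ 3 - R₁ ∧
      0 < densityRate g Q t w₀ w₂ w₁ x₂ y₂ 4 - R₁ := by
  set k : Z → κ := fun z => f (s z)
  set k' : Z → κ := fun z => g (t z)
  subst hS hT hW₀ hW₁ hW₂ hX₁ hX₂ hY₁ hY₂ hK
  have eS : entropy P (fun ω => s (τ ω)) = ent Q s := entropy_eq_ent hQ s
  have eT : entropy P (fun ω => t (τ ω)) = ent Q t := entropy_eq_ent hQ t
  have ea :
      condEntropy P (fun ω => s (τ ω)) (fun ω => f (s (τ ω))) =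
      condEnt Q s k := condEntropy_eq_condEnt hQ s k
  -- The common part is given through `S`, while the densities of user 2 use `g (T)`; the two agree
  -- on the support of `Q`.
  have eb : condEntropy P (fun ω => t (τ ω)) (fun ω => f (s (τ ω))) = condEnt Q t k' :=
    (condEntropy_eq_condEnt hQ t k).trans (condEnt_congr_supp hk t)
  have eA :
      condMutualInfo P ((fun ω => s (τ ω)) ⋄ (fun ω => x₁ (τ ω)))
        (fun ω => y₁ (τ ω))
        ((fun ω => w₀ (τ ω)) ⋄ (fun ω => w₁ (τ ω)) ⋄ (fun ω => w₂ (τ ω)) ⋄ fun ω => f (s (τ ω))) =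
      cmi Q (s ⋄ x₁) y₁ (w₀ ⋄ w₁ ⋄ w₂ ⋄ k) :=
    condMutualInfo_eq_cmi hQ (s ⋄ x₁) y₁ (w₀ ⋄ w₁ ⋄ w₂ ⋄ k)
  have eB :
      condMutualInfo P ((fun ω => s (τ ω)) ⋄ (fun ω => w₂ (τ ω)) ⋄ (fun ω => x₁ (τ ω)))
        (fun ω => y₁ (τ ω))
        ((fun ω => w₀ (τ ω)) ⋄ (fun ω => w₁ (τ ω)) ⋄ fun ω => f (s (τ ω))) =
      cmi Q (s ⋄ w₂ ⋄ x₁) y₁ (w₀ ⋄ w₁ ⋄ k) :=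
    condMutualInfo_eq_cmi hQ (s ⋄ w₂ ⋄ x₁) y₁ (w₀ ⋄ w₁ ⋄ k)
  have eC :
      condMutualInfo P ((fun ω => s (τ ω)) ⋄ (fun ω => w₂ (τ ω)) ⋄ (fun ω => x₁ (τ ω)))
        (fun ω => y₁ (τ ω))
        ((fun ω => w₀ (τ ω)) ⋄ fun ω => f (s (τ ω))) =
      cmi Q (s ⋄ w₂ ⋄ x₁) y₁ (w₀ ⋄ k) :=
    condMutualInfo_eq_cmi hQ (s ⋄ w₂ ⋄ x₁) y₁ (w₀ ⋄ k)
  have eC₀ :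
      condMutualInfo P ((fun ω => w₂ (τ ω)) ⋄ (fun ω => s (τ ω)) ⋄ (fun ω => x₁ (τ ω)))
        (fun ω => y₁ (τ ω))
        ((fun ω => w₀ (τ ω)) ⋄ fun ω => f (s (τ ω))) =
      cmi Q (s ⋄ w₂ ⋄ x₁) y₁ (w₀ ⋄ k) :=
    (condMutualInfo_eq_cmi hQ (w₂ ⋄ s ⋄ x₁) y₁ (w₀ ⋄ k)).trans <|
      cmi_congr (fun z z' => by simp only [Prod.mk.injEq, and_left_comm]) _ _
  have eD :
      mutualInfo P ((fun ω => w₀ (τ ω)) ⋄ (fun ω => w₂ (τ ω)) ⋄ (fun ω => s (τ ω)) ⋄ (fun ω => x₁ (τ ω)))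
        (fun ω => y₁ (τ ω)) = mi Q (w₀ ⋄ w₂ ⋄ s ⋄ x₁) y₁ :=
    mutualInfo_eq_mi hQ (w₀ ⋄ w₂ ⋄ s ⋄ x₁) y₁
  have eE :
      condMutualInfo P ((fun ω => s (τ ω)) ⋄ (fun ω => x₁ (τ ω)))
        (fun ω => y₁ (τ ω))
        ((fun ω => w₀ (τ ω)) ⋄ (fun ω => w₂ (τ ω)) ⋄ fun ω => f (s (τ ω))) =
      cmi Q (s ⋄ x₁) y₁ (w₀ ⋄ w₂ ⋄ k) :=
    condMutualInfo_eq_cmi hQ (s ⋄ x₁) y₁ (w₀ ⋄ w₂ ⋄ k)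
  have eA' :
      condMutualInfo P ((fun ω => t (τ ω)) ⋄ (fun ω => x₂ (τ ω)))
        (fun ω => y₂ (τ ω))
        ((fun ω => w₀ (τ ω)) ⋄ (fun ω => w₁ (τ ω)) ⋄ (fun ω => w₂ (τ ω)) ⋄ fun ω => f (s (τ ω))) =
      cmi Q (t ⋄ x₂) y₂ (w₀ ⋄ w₂ ⋄ w₁ ⋄ k') :=
    ((condMutualInfo_eq_cmi hQ (t ⋄ x₂) y₂ (w₀ ⋄ w₁ ⋄ w₂ ⋄ k)).trans <|
      cmi_congr_right (V' := w₀ ⋄ w₂ ⋄ w₁ ⋄ k) _ _ fun z z' => by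
        simp only [Prod.mk.injEq, and_left_comm]).trans <|
      cmi_congr_supp (fun z hz => congrArg (fun a => (w₀ z, w₂ z, w₁ z, a)) (hk z hz)) _ _
  have eB' :
      condMutualInfo P ((fun ω => t (τ ω)) ⋄ (fun ω => w₁ (τ ω)) ⋄ (fun ω => x₂ (τ ω)))
        (fun ω => y₂ (τ ω))
        ((fun ω => w₀ (τ ω)) ⋄ (fun ω => w₂ (τ ω)) ⋄ fun ω => f (s (τ ω))) =
      cmi Q (t ⋄ w₁ ⋄ x₂) y₂ (w₀ ⋄ w₂ ⋄ k') :=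
    (condMutualInfo_eq_cmi hQ (t ⋄ w₁ ⋄ x₂) y₂ (w₀ ⋄ w₂ ⋄ k)).trans <|
      cmi_congr_supp (fun z hz => congrArg (fun a => (w₀ z, w₂ z, a)) (hk z hz)) _ _
  have eC' :
      condMutualInfo P ((fun ω => t (τ ω)) ⋄ (fun ω => w₁ (τ ω)) ⋄ (fun ω => x₂ (τ ω)))
        (fun ω => y₂ (τ ω))
        ((fun ω => w₀ (τ ω)) ⋄ fun ω => f (s (τ ω))) =
      cmi Q (t ⋄ w₁ ⋄ x₂) y₂ (w₀ ⋄ k') :=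
    (condMutualInfo_eq_cmi hQ (t ⋄ w₁ ⋄ x₂) y₂ (w₀ ⋄ k)).trans <|
      cmi_congr_supp (fun z hz => congrArg (fun a => (w₀ z, a)) (hk z hz)) _ _
  have eC₀' :
      condMutualInfo P ((fun ω => w₁ (τ ω)) ⋄ (fun ω => t (τ ω)) ⋄ (fun ω => x₂ (τ ω)))
        (fun ω => y₂ (τ ω))
        ((fun ω => w₀ (τ ω)) ⋄ fun ω => f (s (τ ω))) =
      cmi Q (t ⋄ w₁ ⋄ x₂) y₂ (w₀ ⋄ k') :=
    ((condMutualInfo_eq_cmi hQ (w₁ ⋄ t ⋄ x₂) y₂ (w₀ ⋄ k)).trans <|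
      cmi_congr (fun z z' => by simp only [Prod.mk.injEq, and_left_comm]) _ _).trans <|
      cmi_congr_supp (fun z hz => congrArg (fun a => (w₀ z, a)) (hk z hz)) _ _
  have eD' :
      mutualInfo P ((fun ω => w₀ (τ ω)) ⋄ (fun ω => w₁ (τ ω)) ⋄ (fun ω => t (τ ω)) ⋄ (fun ω => x₂ (τ ω)))
        (fun ω => y₂ (τ ω)) = mi Q (w₀ ⋄ w₁ ⋄ t ⋄ x₂) y₂ :=
    mutualInfo_eq_mi hQ (w₀ ⋄ w₁ ⋄ t ⋄ x₂) y₂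
  have eE' :
      condMutualInfo P ((fun ω => t (τ ω)) ⋄ (fun ω => x₂ (τ ω)))
        (fun ω => y₂ (τ ω))
        ((fun ω => w₀ (τ ω)) ⋄ (fun ω => w₁ (τ ω)) ⋄ fun ω => f (s (τ ω))) =
      cmi Q (t ⋄ x₂) y₂ (w₀ ⋄ w₁ ⋄ k') :=
    (condMutualInfo_eq_cmi hQ (t ⋄ x₂) y₂ (w₀ ⋄ w₁ ⋄ k)).trans <|
      cmi_congr_supp (fun z hz => congrArg (fun a => (w₀ z, w₁ z, a)) (hk z hz)) _ _
  -- These four monotonicities, each moving the interfering satellite from the conditioning to the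
  -- left, make the remaining Fourier–Motzkin inequalities redundant.
  have hAB : cmi Q (s ⋄ x₁) y₁ (w₀ ⋄ w₁ ⋄ w₂ ⋄ k) ≤ cmi Q (s ⋄ w₂ ⋄ x₁) y₁ (w₀ ⋄ w₁ ⋄ k) :=
    cmi_le_cmi hQp (V := w₀ ⋄ w₁ ⋄ w₂ ⋄ k) y₁ (fun a => (a.1, a.2.1, a.2.2.2)) fun z z' => by
      clear * -
      simp only [Prod.mk.injEq]
      tauto
  have hEC : cmi Q (s ⋄ x₁) y₁ (w₀ ⋄ w₂ ⋄ k) ≤ cmi Q (s ⋄ w₂ ⋄ x₁) y₁ (w₀ ⋄ k) :=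
    cmi_le_cmi hQp (V := w₀ ⋄ w₂ ⋄ k) y₁ (fun a => (a.1, a.2.2)) fun z z' => by
      clear * -
      simp only [Prod.mk.injEq]
      tauto
  have hAB' : cmi Q (t ⋄ x₂) y₂ (w₀ ⋄ w₂ ⋄ w₁ ⋄ k') ≤ cmi Q (t ⋄ w₁ ⋄ x₂) y₂ (w₀ ⋄ w₂ ⋄ k') :=
    cmi_le_cmi hQp (V := w₀ ⋄ w₂ ⋄ w₁ ⋄ k') y₂ (fun a => (a.1, a.2.1, a.2.2.2)) fun z z' => by
      clear * -
      simp only [Prod.mk.injEq]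
      tauto
  have hEC' : cmi Q (t ⋄ x₂) y₂ (w₀ ⋄ w₁ ⋄ k') ≤ cmi Q (t ⋄ w₁ ⋄ x₂) y₂ (w₀ ⋄ k') :=
    cmi_le_cmi hQp (V := w₀ ⋄ w₁ ⋄ k') y₂ (fun a => (a.1, a.2.2)) fun z z' => by
      clear * -
      simp only [Prod.mk.injEq]
      tauto
  rw [ea, eE] at h1
  rw [eb, eE'] at h2
  rw [eS, eD] at h3
  rw [eT, eD'] at h4
  rw [ea, eb, eA, eC₀'] at h5
  rw [ea, eb, eA', eC₀] at h6
  rw [ea, eb, eB, eB'] at h7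
  rw [ea, eT, eD', eA] at h8
  rw [eS, eb, eD, eA'] at h9
  rw [ea, eb, eA, eC, eB'] at h10
  rw [ea, eb, eA', eC', eB] at h11
  rw [eS, ea, eb, eA, eD, eB'] at h12
  rw [eT, ea, eb, eA', eD', eB] at h13
  obtain ⟨R₁, R₂, hR₁, hR₂, d0, d1, d3, d4, d0', d1', d3', d4'⟩ :=
    exists_rates hAB hEC hAB' hEC' h1 h2 h3 h4 h5 h6 h7 h8 h9 h10 h11 h12 h13
  exact ⟨R₁, R₂, hR₁, hR₂, d0, d1, sub_pos.2 h1, d3, d4, d0', d1', sub_pos.2 h2, d3', d4'⟩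

end Rates

end CorrIC

/-! ### Assembly of the theorem. -/

theorem theorem1
    {𝒮 𝒯 𝒳₁ 𝒳₂ 𝒴₁ 𝒴₂ : Type*}
    [Fintype 𝒮] [Fintype 𝒯] [Fintype 𝒳₁] [Fintype 𝒳₂] [Fintype 𝒴₁] [Fintype 𝒴₂]
    -- the source pair and the interference channel
    (p : PMF (𝒮 × 𝒯)) (ch : 𝒳₁ → 𝒳₂ → PMF (𝒴₁ × 𝒴₂))
    -- the functions that define the common part
    {κ : Type*} [Fintype κ] (f : 𝒮 → κ) (g : 𝒯 → κ) (hfg : IsCommonPart p f g)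
    -- the factors of the joint distribution
    {𝒲₀ 𝒲₁ 𝒲₂ : Type*} [Fintype 𝒲₀] [Fintype 𝒲₁] [Fintype 𝒲₂]
    (q₀ : PMF 𝒲₀) (q₁ : 𝒲₀ → PMF 𝒲₁) (q₂ : 𝒲₀ → PMF 𝒲₂)
    (r₁ : 𝒮 → 𝒲₁ → 𝒲₀ → PMF 𝒳₁) (r₂ : 𝒯 → 𝒲₂ → 𝒲₀ → PMF 𝒳₂)
    -- the random variables
    {Ω : Type*} (P : PMF Ω)
    (S : Ω → 𝒮) (T : Ω → 𝒯) (W₀ : Ω → 𝒲₀) (W₁ : Ω → 𝒲₁) (W₂ : Ω → 𝒲₂)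
    (X₁ : Ω → 𝒳₁) (X₂ : Ω → 𝒳₂) (Y₁ : Ω → 𝒴₁) (Y₂ : Ω → 𝒴₂) (K : Ω → κ)
    (hK : K = fun ω => f (S ω))
    (hP : ∀ s t w₀ w₁ w₂ x₁ x₂ y₁ y₂,
      P.map (S ⋄ T ⋄ W₀ ⋄ W₁ ⋄ W₂ ⋄ X₁ ⋄ X₂ ⋄ Y₁ ⋄ Y₂) (s, t, w₀, w₁, w₂, x₁, x₂, y₁, y₂) =
        p (s, t) * q₀ w₀ * q₁ w₀ w₁ * q₂ w₀ w₂ * r₁ s w₁ w₀ x₁ * r₂ t w₂ w₀ x₂ *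
          ch x₁ x₂ (y₁, y₂))
    -- the thirteen inequalities
    (h1 : condEntropy P S K < condMutualInfo P (S ⋄ X₁) Y₁ (W₀ ⋄ W₂ ⋄ K))
    (h2 : condEntropy P T K < condMutualInfo P (T ⋄ X₂) Y₂ (W₀ ⋄ W₁ ⋄ K))
    (h3 : entropy P S < mutualInfo P (W₀ ⋄ W₂ ⋄ S ⋄ X₁) Y₁)
    (h4 : entropy P T < mutualInfo P (W₀ ⋄ W₁ ⋄ T ⋄ X₂) Y₂)
    (h5 : condEntropy P S K + condEntropy P T K <
      condMutualInfo P (S ⋄ X₁) Y₁ (W₀ ⋄ W₁ ⋄ W₂ ⋄ K) +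
        condMutualInfo P (W₁ ⋄ T ⋄ X₂) Y₂ (W₀ ⋄ K))
    (h6 : condEntropy P S K + condEntropy P T K <
      condMutualInfo P (T ⋄ X₂) Y₂ (W₀ ⋄ W₁ ⋄ W₂ ⋄ K) +
        condMutualInfo P (W₂ ⋄ S ⋄ X₁) Y₁ (W₀ ⋄ K))
    (h7 : condEntropy P S K + condEntropy P T K <
      condMutualInfo P (S ⋄ W₂ ⋄ X₁) Y₁ (W₀ ⋄ W₁ ⋄ K) +
        condMutualInfo P (T ⋄ W₁ ⋄ X₂) Y₂ (W₀ ⋄ W₂ ⋄ K))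
    (h8 : condEntropy P S K + entropy P T <
      mutualInfo P (W₀ ⋄ W₁ ⋄ T ⋄ X₂) Y₂ +
        condMutualInfo P (S ⋄ X₁) Y₁ (W₀ ⋄ W₁ ⋄ W₂ ⋄ K))
    (h9 : entropy P S + condEntropy P T K <
      mutualInfo P (W₀ ⋄ W₂ ⋄ S ⋄ X₁) Y₁ +
        condMutualInfo P (T ⋄ X₂) Y₂ (W₀ ⋄ W₁ ⋄ W₂ ⋄ K))
    (h10 : 2 * condEntropy P S K + condEntropy P T K <
      condMutualInfo P (S ⋄ X₁) Y₁ (W₀ ⋄ W₁ ⋄ W₂ ⋄ K) +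
        condMutualInfo P (S ⋄ W₂ ⋄ X₁) Y₁ (W₀ ⋄ K) +
        condMutualInfo P (T ⋄ W₁ ⋄ X₂) Y₂ (W₀ ⋄ W₂ ⋄ K))
    (h11 : condEntropy P S K + 2 * condEntropy P T K <
      condMutualInfo P (T ⋄ X₂) Y₂ (W₀ ⋄ W₁ ⋄ W₂ ⋄ K) +
        condMutualInfo P (T ⋄ W₁ ⋄ X₂) Y₂ (W₀ ⋄ K) +
        condMutualInfo P (S ⋄ W₂ ⋄ X₁) Y₁ (W₀ ⋄ W₁ ⋄ K))
    (h12 : entropy P S + condEntropy P S K + condEntropy P T K <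
      condMutualInfo P (S ⋄ X₁) Y₁ (W₀ ⋄ W₁ ⋄ W₂ ⋄ K) +
        mutualInfo P (W₀ ⋄ W₂ ⋄ S ⋄ X₁) Y₁ +
        condMutualInfo P (T ⋄ W₁ ⋄ X₂) Y₂ (W₀ ⋄ W₂ ⋄ K))
    (h13 : entropy P T + condEntropy P S K + condEntropy P T K <
      condMutualInfo P (T ⋄ X₂) Y₂ (W₀ ⋄ W₁ ⋄ W₂ ⋄ K) +
        mutualInfo P (W₀ ⋄ W₁ ⋄ T ⋄ X₂) Y₂ +
        condMutualInfo P (S ⋄ W₂ ⋄ X₁) Y₁ (W₀ ⋄ W₁ ⋄ K)) :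
    Admissible p ch := by
  classical
  subst hK
  obtain ⟨s₀, t₀⟩ := p.support_nonempty.some
  have : Nonempty 𝒮 := ⟨s₀⟩
  have : Nonempty 𝒯 := ⟨t₀⟩
  have hsys : IsSystem (fun st => (p st).toReal) (fun w₀ => (q₀ w₀).toReal)
      (fun w₀ w₁ => (q₁ w₀ w₁).toReal) (fun w₀ w₂ => (q₂ w₀ w₂).toReal)
      (fun s w₁ w₀ x₁ => (r₁ s w₁ w₀ x₁).toReal) (fun t w₂ w₀ x₂ => (r₂ t w₂ w₀ x₂).toReal)
      (fun x₁ x₂ y => (ch x₁ x₂ y).toReal) :=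
    ⟨isProb_toReal _, isProb_toReal _, fun _ => isProb_toReal _, fun _ => isProb_toReal _,
      fun _ _ _ => isProb_toReal _, fun _ _ _ => isProb_toReal _, fun _ _ => isProb_toReal _⟩
  have hcommon : ∀ s t, (p (s, t)).toReal ≠ 0 → f s = g t := fun s t h =>
    hfg.common s t fun h0 => h (by rw [h0, ENNReal.toReal_zero])
  set Q := systemLaw (fun st => (p st).toReal) (fun w₀ => (q₀ w₀).toReal)
      (fun w₀ w₁ => (q₁ w₀ w₁).toReal) (fun w₀ w₂ => (q₂ w₀ w₂).toReal)
      (fun s w₁ w₀ x₁ => (r₁ s w₁ w₀ x₁).toReal) (fun t w₂ w₀ x₂ => (r₂ t w₂ w₀ x₂).toReal)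
      (fun x₁ x₂ y => (ch x₁ x₂ y).toReal) with hQdef
  have hQp : IsProb Q := hsys.isProb_systemLaw
  have hu₁ := hsys.hasUserLaw₁
  have hu₂ := hsys.hasUserLaw₂
  rw [← hQdef] at hu₁ hu₂
  -- `systemLaw` nests the variables in order of generation, so the joint law is transported along a
  -- rearrangement of the tuple.
  let τ : Ω → ((((((𝒮 × 𝒯) × 𝒲₀) × 𝒲₁) × 𝒳₁) × 𝒲₂) × 𝒳₂) × (𝒴₁ × 𝒴₂) := fun ω =>
    (((((((S ω, T ω), W₀ ω), W₁ ω), X₁ ω), W₂ ω), X₂ ω), (Y₁ ω, Y₂ ω))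
  have hQ : ∀ z, (P.map τ z).toReal = Q z := by
    rintro ⟨⟨⟨⟨⟨⟨⟨s, t⟩, w₀⟩, w₁⟩, x₁⟩, w₂⟩, x₂⟩, y₁, y₂⟩
    have h : P.map τ (((((((s, t), w₀), w₁), x₁), w₂), x₂), (y₁, y₂)) =
        P.map (S ⋄ T ⋄ W₀ ⋄ W₁ ⋄ W₂ ⋄ X₁ ⋄ X₂ ⋄ Y₁ ⋄ Y₂) (s, t, w₀, w₁, w₂, x₁, x₂, y₁, y₂) := by
      rw [PMF.map_apply, PMF.map_apply]
      refine tsum_congr fun ω => ?_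
      congr 1
      simp only [τ, Prod.mk.injEq, eq_iff_iff]
      tauto
    rw [h, hP]
    simp only [hQdef, systemLaw, joint, ENNReal.toReal_mul]
    ring
  let s : ((((((𝒮 × 𝒯) × 𝒲₀) × 𝒲₁) × 𝒳₁) × 𝒲₂) × 𝒳₂) × (𝒴₁ × 𝒴₂) → 𝒮 := fun z => z.1.1.1.1.1.1.1
  let t : ((((((𝒮 × 𝒯) × 𝒲₀) × 𝒲₁) × 𝒳₁) × 𝒲₂) × 𝒳₂) × (𝒴₁ × 𝒴₂) → 𝒯 := fun z => z.1.1.1.1.1.1.2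
  let w₀ : ((((((𝒮 × 𝒯) × 𝒲₀) × 𝒲₁) × 𝒳₁) × 𝒲₂) × 𝒳₂) × (𝒴₁ × 𝒴₂) → 𝒲₀ := fun z => z.1.1.1.1.1.2
  let w₁ : ((((((𝒮 × 𝒯) × 𝒲₀) × 𝒲₁) × 𝒳₁) × 𝒲₂) × 𝒳₂) × (𝒴₁ × 𝒴₂) → 𝒲₁ := fun z => z.1.1.1.1.2
  let w₂ : ((((((𝒮 × 𝒯) × 𝒲₀) × 𝒲₁) × 𝒳₁) × 𝒲₂) × 𝒳₂) × (𝒴₁ × 𝒴₂) → 𝒲₂ := fun z => z.1.1.2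
  let x₁ : ((((((𝒮 × 𝒯) × 𝒲₀) × 𝒲₁) × 𝒳₁) × 𝒲₂) × 𝒳₂) × (𝒴₁ × 𝒴₂) → 𝒳₁ := fun z => z.1.1.1.2
  let x₂ : ((((((𝒮 × 𝒯) × 𝒲₀) × 𝒲₁) × 𝒳₁) × 𝒲₂) × 𝒳₂) × (𝒴₁ × 𝒴₂) → 𝒳₂ := fun z => z.1.2
  let y₁ : ((((((𝒮 × 𝒯) × 𝒲₀) × 𝒲₁) × 𝒳₁) × 𝒲₂) × 𝒳₂) × (𝒴₁ × 𝒴₂) → 𝒴₁ := fun z => z.2.1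
  let y₂ : ((((((𝒮 × 𝒯) × 𝒲₀) × 𝒲₁) × 𝒳₁) × 𝒲₂) × 𝒳₂) × (𝒴₁ × 𝒴₂) → 𝒴₂ := fun z => z.2.2
  have hk : ∀ z, Q z ≠ 0 → f (s z) = g (t z) := fun z hz => hcommon _ _ fun h0 => hz (by
    have h0' : (p z.1.1.1.1.1.1).toReal = 0 := h0
    simp only [hQdef, systemLaw, joint, h0', zero_mul])
  obtain ⟨R₁, R₂, hR₁, hR₂, d0, d1, d2, d3, d4, d0', d1', d2', d3', d4'⟩ :=
    exists_rates_of_inequalities hQp hQ s t w₀ w₁ w₂ x₁ x₂ y₁ y₂ hk rfl rfl rfl rfl rfl rfl rfl rfl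
      rfl rfl h1 h2 h3 h4 h5 h6 h7 h8 h9 h10 h11 h12 h13
  intro ε hε _
  obtain ⟨N, hN⟩ := exists_block_code (f := f) (g := g) hsys hcommon
    (isDensityFamily_densities hQp hu₁ hsys.hq₀ hsys.hq₁ hsys.hq₂ hsys.hr₁ y₁)
    (isDensityFamily_densities hQp hu₂ hsys.hq₀ hsys.hq₂ hsys.hq₁ hsys.hr₂ y₂)
    (fun j z hz => densities_pos (S := s) (W₀ := w₀) (W₁ := w₁) (W₂ := w₂) (X := x₁) hQp y₁ j hz)
    (fun j z hz => densities_pos (S := t) (W₀ := w₀) (W₁ := w₂) (W₂ := w₁) (X := x₂) hQp y₂ j hz)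
    (D := densityRate f Q s w₀ w₁ w₂ x₁ y₁) (D' := densityRate g Q t w₀ w₂ w₁ x₂ y₂)
    (densityRate_eq hQp y₁) (densityRate_eq hQp y₂) hR₁ hR₂
    d0 d1 d2 d3 d4 d0' d1' d2' d3' d4' hε
  refine ⟨N, fun n hn => ?_⟩
  obtain ⟨f₁, f₂, φ₁, φ₂, hcode⟩ := hN n hn
  have hp : IsProb (pairw fun _ : Fin n => fun st => (p st).toReal) := IsProb.pairw fun _ => hsys.hp
  have hch : ∀ (a : Fin n → 𝒳₁) (b : Fin n → 𝒳₂),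
      IsProb (pairw fun i => fun y => (ch (a i) (b i) y).toReal) :=
    fun a b => IsProb.pairw fun i => hsys.hc _ _
  refine ⟨⟨f₁, f₂, φ₁, φ₂⟩, max_le ?_ ?_⟩
  -- `hcode` bounds the sum of the two error probabilities, hence each of them.
  · rw [errorProb₁_eq_ev]
    exact (ev_mono hp fun st => ev_mono (hch _ _) fun y =>
      le_add_of_nonneg_right (ind_nonneg _)).trans hcode
  · rw [errorProb₂_eq_ev]
    exact (ev_mono hp fun st => ev_mono (hch _ _) fun y =>
      le_add_of_nonneg_left (ind_nonneg _)).trans hcode
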